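/- Let $n>1$ be an odd integer, $\lambda=4\cdot 5^n-1$, and let $h$ be an integer with $\lambda\nmid h$. Let $\mathcal J$ be the Jacobian of the genus-2 curve $\mathcal H: y^2=x^5+h$ over $\mathbb Q(\sqrt5)$. For a ring of constants containing $\sqrt5$ in which $2$ is invertible, put $\eta=\frac{-1+\sqrt5}{2}$ and adjoin $\zeta$ with $\zeta^2-\eta\zeta+1=0$ (so $\zeta^5=1$ and $\zeta+\zeta^4=\eta$); the endomorphism $[\sqrt5]$ of the Jacobian is $1+2(\zeta+\zeta^4)$, where $\zeta^i$ acts through $(x,y)\mapsto(\zeta^i x,y)$. Reduction modulo $\lambda$ is taken along the ring homomorphism $\mathbb Z[\frac{1+\sqrt5}{2}]\to\mathbb Z[\frac{1+\sqrt5}{2}]/(2\cdot5^{(n-1)/2}\sqrt5-1)\cong\mathbb Z/(\lambda)$, i.e. $\sqrt5\mapsto 2\cdot5^{(n+1)/2}$, extended to the ring $S\subset\mathbb Q(\sqrt5)$ of fractions $a/b$ with $a,b\in\mathbb Z[\frac{1+\sqrt5}2]$ and $b$ a unit modulo $\lambda$. For a ring $A$ of constants write $\mathcal J(A)$ for the Picard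 group of the affine coordinate ring $A[x,y]/(y^2-x^5-h)$; when $A$ is a field in which $10h\ne0$ this is the group of $A$-rational points of the Jacobian of $y^2=x^5+h$ over $A$. A point $P\in\mathcal J(\mathbb Q(\sqrt5))$ reduces to $Q\in\mathcal J(\mathbb Z/(\lambda))$ if both are images of one element of $\mathcal J(S)$. The reduction of $P$ is well defined and equal to $\langle u,v\rangle$ in Mumford form if $u,v\in(\mathbb Z/(\lambda))[x]$, $u$ is monic of degree at most $2$, $\deg v<\deg u$, $u\mid v^2-x^5-h$, and $P$ reduces to the class of the ideal $(u(x),\,y-v(x))$. The identity is $\langle 1,0\rangle$. Let $F\in\mathcal J(\mathbb Q(\sqrt5))$, $D_0=4F$ and $D_i=[\sqrt5]D_{i-1}$ for $1\le i\le 2n$. Suppose that for $0\le j\le 2n-1$ the reduction of $D_j$ modulo $\lambda$ is well defined in Mumford form and is not $\langle1,0\rangle$, and that the reduction of $D_{2n}$ modulo $\lambda$ is $\langle 1,0\rangle$. Then $\lambda$ is prime, $F$ has a reduction $\overline F\in\mathcal J(\mathbb F_\lambda)$, and $\overline F\notin[\sqrt5]\,\mathcal J(\mathbb F_\lambda)$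 (for every reduction $\overline F$ of $F$). -/

import Mathlib

open Polynomial

noncomputable section

/-- The integer `λ_n = 4·5^n - 1`. -/
def lam (n : ℕ) : ℕ := 4 * 5 ^ n - 1

/-! ### The ring `ℤ[(1+√5)/2]`, the field `ℚ(√5)`, and reduction modulo `λ_n` -/

/-- `ℤ[(1+√5)/2]`, i.e. `ℤ[ω]` with `ω² = 1 + ω`; here `ω` stands for `(1+√5)/2`. -/
abbrev GoldenInt : Type := QuadraticAlgebra ℤ 1 1

/-- The field `ℚ(√5)`, i.e. `ℚ ⊕ ℚ√5` with `√5² = 5`. -/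
abbrev QSqrtFive : Type := QuadraticAlgebra ℚ 5 0

instance : Fact (∀ r : ℚ, r ^ 2 ≠ (5 : ℚ) + 0 * r) := ⟨by
  intro r hr
  have h5 : IsSquare (5 : ℚ) := ⟨r, by linarith [hr, sq r]⟩
  have h5' : IsSquare (5 : ℕ) := by exact_mod_cast h5
  obtain ⟨m, hm⟩ := h5'
  have : m ≤ 2 := by nlinarith
  interval_cases m <;> omega⟩

/-- `η = (-1+√5)/2` in `ℤ[(1+√5)/2]`, so that `√5 = 1 + 2η`. -/
def goldenEta : GoldenInt := QuadraticAlgebra.omega - 1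

theorem goldenEta_sq : goldenEta ^ 2 + goldenEta = 1 := by
  ext <;> simp [goldenEta, sq, QuadraticAlgebra.re_one, QuadraticAlgebra.im_one]

/-- The inclusion `ℤ[(1+√5)/2] ⊂ ℚ(√5)`. -/
def goldenToField : GoldenInt →+* QSqrtFive :=
  (QuadraticAlgebra.lift (R := ℤ) (a := 1) (b := 1) (A := QSqrtFive)
    ⟨⟨1 / 2, 1 / 2⟩, by ext <;> simp [QuadraticAlgebra.re_one, QuadraticAlgebra.im_one] <;> norm_num⟩).toRingHom

theorem goldenToField_apply (z : GoldenInt) :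
    goldenToField z = ⟨z.re + z.im / 2, z.im / 2⟩ := by
  ext <;> simp [goldenToField, QuadraticAlgebra.lift] <;> ring

theorem goldenToField_ne_zero {z : GoldenInt} (hz : z ≠ 0) : goldenToField z ≠ 0 := by
  intro h
  rw [goldenToField_apply] at h
  have h2 := congrArg QuadraticAlgebra.im h
  have h1 := congrArg QuadraticAlgebra.re h
  simp at h1 h2
  apply hz
  ext
  · simpa [h2] using h1
  · simpa using h2

theorem lam_add_one (n : ℕ) : lam n + 1 = 4 * 5 ^ n := by
  have : 0 < 5 ^ n := by positivity
  unfold lam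
  omega

theorem two_lt_lam (n : ℕ) : 2 < lam n := by
  have : 0 < 5 ^ n := by positivity
  unfold lam
  omega

theorem four_mul_five_pow (n : ℕ) : (4 : ZMod (lam n)) * 5 ^ n = 1 := by
  have h : ((lam n + 1 : ℕ) : ZMod (lam n)) = ((4 * 5 ^ n : ℕ) : ZMod (lam n)) := by
    rw [lam_add_one]
  push_cast at h
  simpa using h.symm

/-- Reduction `ℤ[(1+√5)/2] → ℤ/(λ_n)` for odd `n`. It sends `√5` to `2·5^((n+1)/2)`, the inverse
of `2·5^((n-1)/2)`, and so `(1+√5)/2` to `2·5^n + 5^((n+1)/2)` (as `2·5^n` is the inverse of `2`).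
Its kernel is the ideal generated by `2·5^((n-1)/2)·√5 - 1`. -/
def goldenToZMod (n : ℕ) (hn : Odd n) : GoldenInt →+* ZMod (lam n) :=
  (QuadraticAlgebra.lift (R := ℤ) (a := 1) (b := 1) (A := ZMod (lam n))
    ⟨2 * 5 ^ n + 5 ^ ((n + 1) / 2), by
      have h := four_mul_five_pow n
      obtain ⟨m, rfl⟩ := hn
      have e : (2 * m + 1 + 1) / 2 = m + 1 := by omega
      rw [e]
      simp only [one_smul]
      linear_combination (5 ^ (2 * m + 1) + 5 ^ (m + 1) + 1 : ZMod (lam (2 * m + 1))) * h⟩).toRingHom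

/-- The elements of `ℤ[(1+√5)/2]` that are units modulo `λ_n`: the admissible denominators. -/
def goodDenominators (n : ℕ) (hn : Odd n) : Submonoid GoldenInt :=
  (IsUnit.submonoid (ZMod (lam n))).comap (goldenToZMod n hn)

/-- The ring of the elements `a / b` of `ℚ(√5)`, with `a, b ∈ ℤ[(1+√5)/2]`, whose denominator `b`
is a unit modulo `λ_n`. -/
abbrev LocalGolden (n : ℕ) (hn : Odd n) : Type := Localization (goodDenominators n hn)

/-- The inclusion of `LocalGolden n hn` in `ℚ(√5)`. -/
def localToField (n : ℕ) (hn : Odd n) : LocalGolden n hn →+* QSqrtFive :=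
  IsLocalization.lift (M := goodDenominators n hn) (g := goldenToField) (by
    rintro ⟨b, hb⟩
    refine (goldenToField_ne_zero ?_).isUnit
    rintro rfl
    have h0 : IsUnit (goldenToZMod n hn 0) := hb
    have : Fact (1 < lam n) := ⟨by have := two_lt_lam n; omega⟩
    rw [map_zero] at h0
    exact not_isUnit_zero h0)

/-- Reduction of the elements of `LocalGolden n hn` modulo `λ_n`. -/
def localToZMod (n : ℕ) (hn : Odd n) : LocalGolden n hn →+* ZMod (lam n) :=
  IsLocalization.lift (M := goodDenominators n hn) (g := goldenToZMod n hn) (fun b => b.2)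

/-! ### The curve `y² = x⁵ + h` and its Jacobian -/

/-- The coordinate ring `A[x, y] / (y² - x⁵ - h)` of the affine part of `y² = x⁵ + h` over `A`
(the complement of the point at infinity). -/
abbrev CoordRing (A : Type) [CommRing A] (h : ℤ) : Type :=
  AdjoinRoot (X ^ 2 - C (X ^ 5 + C (h : A)) : A[X][X])

/-- A polynomial in `x` as a function on the curve. -/
abbrev CoordRing.ofPoly {A : Type} [CommRing A] (h : ℤ) (p : A[X]) : CoordRing A h :=
  AdjoinRoot.of _ p

/-- The function `y` on the curve. -/
abbrev CoordRing.y (A : Type) [CommRing A] (h : ℤ) : CoordRing A h := AdjoinRoot.root _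

/-- The ring homomorphism of coordinate rings which is `f` on constants and maps `x ↦ c·x`, `y ↦ y`,
where `c⁵ = 1`. -/
def CoordRing.map {A B : Type} [CommRing A] [CommRing B] (h : ℤ) (f : A →+* B) (c : B)
    (hc : c ^ 5 = 1) : CoordRing A h →+* CoordRing B h :=
  AdjoinRoot.lift
    ((AdjoinRoot.of _).comp (Polynomial.eval₂RingHom ((C : B →+* B[X]).comp f) (C c * X)))
    (CoordRing.y B h) (by
      have hy := AdjoinRoot.eval₂_root (X ^ 2 - C (X ^ 5 + C (h : B)) : B[X][X])
      have h1 : (C c * X : B[X]) ^ 5 = X ^ 5 := by rw [mul_pow, ← C_pow, hc, C_1, one_mul]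
      have h2 : eval₂ ((C : B →+* B[X]).comp f) (C c * X) (h : A[X]) = (h : B[X]) :=
        map_intCast (eval₂RingHom ((C : B →+* B[X]).comp f) (C c * X)) h
      simp only [eval₂_sub, eval₂_pow, eval₂_X, eval₂_C] at hy ⊢
      simp only [RingHom.comp_apply, coe_eval₂RingHom, eval₂_add, eval₂_pow, eval₂_X, h1, h2,
        map_intCast] at hy ⊢
      simpa using hy)

/-- The Jacobian of `y² = x⁵ + h`, over a field `A` in which the curve is smooth, is the group of
divisor classes of degree zero. The curve has exactly one point at infinity, which is rational, so
that group is the Picard group of the affine part: a divisor class `D - deg(D)·∞` corresponds to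
the class of the ideal of `D` in the coordinate ring. The same definition is used for the other
rings of constants that occur, `LocalGolden n hn` and `ℤ/(λ_n)`. -/
abbrev Jac (A : Type) [CommRing A] (h : ℤ) : Type := Additive (CommRing.Pic (CoordRing A h))

/-- The homomorphism of Jacobians induced by a homomorphism of coordinate rings (extension of
ideals). -/
def Jac.push {A B : Type} [CommRing A] [CommRing B] {h : ℤ} (φ : CoordRing A h →+* CoordRing B h) :
    Jac A h →+ Jac B h :=
  (CommRing.Pic.mapRingHom φ).toAdditive

/-- Change of constants along `f`. -/
def Jac.baseChange {A B : Type} [CommRing A] [CommRing B] (h : ℤ) (f : A →+* B) :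
    Jac A h →+ Jac B h :=
  Jac.push (CoordRing.map h f 1 (one_pow 5))

/-! ### Mumford representation -/

/-- `⟨u, v⟩` is a Mumford pair for `y² = x⁵ + h` with coefficients in `A`: `u` is monic of degree at
most `2`, `deg v < deg u`, and `v² ≡ x⁵ + h` modulo `u`. The identity is `⟨1, 0⟩`. -/
structure IsMumford {A : Type} [CommRing A] (h : ℤ) (u v : A[X]) : Prop where
  monic : u.Monic
  natDegree_le : u.natDegree ≤ 2
  degree_lt : v.degree < u.degree
  dvd : u ∣ v ^ 2 - (X ^ 5 + C (h : A))

/-- The ideal `(u(x), y - v(x))` of the divisor described by `⟨u, v⟩`. -/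
def mumfordIdeal {A : Type} [CommRing A] (h : ℤ) (u v : A[X]) : Ideal (CoordRing A h) :=
  Ideal.span {CoordRing.ofPoly h u, CoordRing.y A h - CoordRing.ofPoly h v}

/-- The point `P` of the Jacobian is `⟨u, v⟩` in Mumford representation. -/
def IsMumfordRep {A : Type} [CommRing A] {h : ℤ} (P : Jac A h) (u v : A[X]) : Prop :=
  IsMumford h u v ∧
    Nonempty (P.toMul.AsModule ≃ₗ[CoordRing A h] mumfordIdeal h u v)

/-! ### Multiplication by `√5` -/

/-- `A[ζ]` with `ζ² - e·ζ + 1 = 0`, so that `ζ + ζ⁻¹ = e`. -/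
abbrev ZetaExt (A : Type) [CommRing A] (e : A) : Type :=
  AdjoinRoot (X ^ 2 - C e * X + 1 : A[X])

/-- The root `ζ`. -/
abbrev ZetaExt.zeta {A : Type} [CommRing A] (e : A) : ZetaExt A e := AdjoinRoot.root _

theorem ZetaExt.zeta_pow_five {A : Type} [CommRing A] {e : A} (he : e ^ 2 + e = 1) :
    (ZetaExt.zeta e) ^ 5 = 1 := by
  have h := AdjoinRoot.eval₂_root (X ^ 2 - C e * X + 1 : A[X])
  simp only [eval₂_sub, eval₂_add, eval₂_mul, eval₂_pow, eval₂_X, eval₂_C, eval₂_one] at h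
  have he' : (AdjoinRoot.of (X ^ 2 - C e * X + 1 : A[X]) e) ^ 2
      + AdjoinRoot.of (X ^ 2 - C e * X + 1 : A[X]) e = 1 := by
    rw [← map_pow, ← map_add, he, map_one]
  set z := ZetaExt.zeta e
  set E := AdjoinRoot.of (X ^ 2 - C e * X + 1 : A[X]) e
  linear_combination (z - 1) * (z ^ 2 + (1 + E) * z + 1) * h + (z - 1) * z ^ 2 * he'

/-- The action on the Jacobian of the automorphism `(x, y) ↦ (ζ^i·x, y)` of the curve over
`A[ζ]`, where `e² + e = 1` and hence `ζ⁵ = 1`. (It sends the ideal `(x - x₀, y - y₀)` to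
`(ζ^{-i}·x - x₀, y - y₀) = (x - ζ^i·x₀, y - y₀)`, so on functions it is `x ↦ ζ^{-i}·x = ζ^{4i}·x`.) -/
def zetaAct {A : Type} [CommRing A] (h : ℤ) {e : A} (he : e ^ 2 + e = 1) (i : ℕ) :
    Jac (ZetaExt A e) h →+ Jac (ZetaExt A e) h :=
  Jac.push (CoordRing.map h (RingHom.id _) (ZetaExt.zeta e ^ (4 * i)) (by
    calc (ZetaExt.zeta e ^ (4 * i)) ^ 5 = (ZetaExt.zeta e ^ 5) ^ (4 * i) := by ring
      _ = 1 := by rw [ZetaExt.zeta_pow_five he, one_pow]))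

/-- `Q = √5·P` in the Jacobian over `A`, where `A` contains `√5` through `f : ℤ[(1+√5)/2] → A`.
With `η = (-1+√5)/2` and `ζ` a primitive fifth root of unity such that `ζ + ζ⁴ = η`, the
endomorphism `√5 = 1 + 2(ζ + ζ⁴)` is computed over `A[ζ]`. -/
def IsSqrtFiveMul {A : Type} [CommRing A] {h : ℤ} (f : GoldenInt →+* A) (P Q : Jac A h) : Prop :=
  have he : (f goldenEta) ^ 2 + f goldenEta = 1 := by
    rw [← map_pow, ← map_add, goldenEta_sq, map_one]
  let ι : Jac A h →+ Jac (ZetaExt A (f goldenEta)) h := Jac.baseChange h (AdjoinRoot.of _)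
  ι Q = ι P + 2 • (zetaAct h he 1 (ι P) + zetaAct h he 4 (ι P))

/-! ### Reduction of points modulo `λ_n` -/

/-- The point `P` over `ℚ(√5)` reduces to `Q` modulo `λ_n`: both come from one point over the
ring of elements of `ℚ(√5)` whose denominators are units modulo `λ_n`. -/
def ReducesTo (n : ℕ) (hn : Odd n) {h : ℤ} (P : Jac QSqrtFive h) (Q : Jac (ZMod (lam n)) h) :
    Prop :=
  ∃ R : Jac (LocalGolden n hn) h,
    Jac.baseChange h (localToField n hn) R = P ∧ Jac.baseChange h (localToZMod n hn) R = Q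

/-- The reduction modulo `λ_n` of the point `P` over `ℚ(√5)` is well defined and is `⟨u, v⟩` in
Mumford representation, with coefficients in `ℤ/(λ_n)`. -/
def ReducesToMumford (n : ℕ) (hn : Odd n) {h : ℤ} (P : Jac QSqrtFive h) (u v : (ZMod (lam n))[X]) :
    Prop :=
  ∃ Q : Jac (ZMod (lam n)) h, ReducesTo n hn P Q ∧ IsMumfordRep Q u v

end

/-! The argument works at one well-chosen prime p dividing λ. Since 4·5^n ≡ 1 (mod λ) with n odd, 5
is a square modulo λ, so all prime factors of λ are ±1 mod 5. As λ ≡ 4 mod 5, one of them has p ≡ 4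
mod 5, hence p ≡ 9 mod 10 (`exists_prime_dvd_lam`).

Let L be an algebraic closure of 𝔽_p and m the image in 𝒥(L) of the reduction of D_0. Reduction to L
commutes with [√5] (`Jac.exists_sqrtFive_reduction`, through the Witt vectors of L), so D_j maps to
√5^j·m. This is nonzero for j < 2n, because a nontrivial Mumford ideal stays nonprincipal over every
field (`IsMumfordRep.baseChange_ne_zero`), and zero for j = 2n. The norm 1 + ζ + … + ζ⁴ kills m
(`Jac.norm_scale_eq_zero`), so √5² acts on m as 5 and m has order exactly 5^n. If p divided h, the
curve modulo p would be cuspidal with Picard group killed by p (`Jac.nsmul_eq_zero_of_cusp`),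
forcing m = 0.

For p ∤ h the number p + 1 kills the classes coming from 𝔽_p (`Jac.succ_nsmul_baseChange_eq_zero`).
The curve is covered by the Hermitian curve, whose tangent lines have divisor p·P plus the
p²-Frobenius image of P, up to infinity; norms of tangent lines give the functions needed. Hence 5^n
∣ p + 1, and p ∣ 4·5^n − 1 then leaves only p = λ (`eq_lam_of_dvd`).

Once λ is prime the curve has good reduction, so every class over ℚ(√5) extends to S
(`Jac.baseChange_surjective`) and F reduces. If a reduction of F were √5·G, with g the image of G in
𝒥(L), then √5^(2n−1)·m = 4·5^n·g = (p + 1)·g = 0, a contradiction. -/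

noncomputable section

/-! ### Picard classes represented by ideals. -/

section PicardIdeals

open CommRing TensorProduct

/-- The class `P` of the Picard group is represented by the ideal `I`. -/
def IsIdealRep {R : Type} [CommRing R] (P : Pic R) (I : Ideal R) : Prop :=
  Nonempty (P.AsModule ≃ₗ[R] I)

namespace IsIdealRep

variable {R : Type} [CommRing R]

theorem invertible {P : Pic R} {I : Ideal R} (h : IsIdealRep P I) : Module.Invertible R I :=
  .congr h.some

theorem unique {P Q : Pic R} {I : Ideal R} (hP : IsIdealRep P I) (hQ : IsIdealRep Q I) : P = Q :=
  Pic.ext_iff.mpr ⟨hP.some ≪≫ₗ hQ.some.symm⟩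

theorem of_invertible (I : Ideal R) [Module.Invertible R I] : IsIdealRep (Pic.mk R I) I :=
  ⟨Pic.mk.linearEquiv R I⟩

theorem trans {P : Pic R} {I J : Ideal R} (hP : IsIdealRep P I) (e : I ≃ₗ[R] J) : IsIdealRep P J :=
  ⟨hP.some ≪≫ₗ e⟩

theorem one : IsIdealRep (1 : Pic R) ⊤ := by
  have e : Pic.mk R R ≃ₗ[R] R := Pic.mk.linearEquiv R R
  rw [← Pic.mk_self]
  exact ⟨e ≪≫ₗ Submodule.topEquiv.symm⟩

/-- The multiplication map I ⊗ J → IJ is injective because J, being invertible, is flat. -/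
theorem mul {P Q : Pic R} {I J : Ideal R} (hP : IsIdealRep P I) (hQ : IsIdealRep Q J) :
    IsIdealRep (P * Q) (I * J) := by
  have := hP.invertible
  have := hQ.invertible
  have inj : Function.Injective (Submodule.mulMap' I J) := by
    have h1 : (I * J : Ideal R).subtype ∘ₗ Submodule.mulMap' I J =
        J.subtype ∘ₗ (TensorProduct.lid R J).toLinearMap ∘ₗ I.subtype.rTensor J :=
      TensorProduct.ext' fun a b => by simp
    have h2 : Function.Injective ((I * J : Ideal R).subtype ∘ₗ Submodule.mulMap' I J) := by
      rw [h1]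
      exact J.subtype_injective.comp ((TensorProduct.lid R J).injective.comp
        (Module.Flat.rTensor_preserves_injective_linearMap _ I.subtype_injective))
    rw [LinearMap.coe_comp] at h2
    exact h2.of_comp
  have e : I ⊗[R] J ≃ₗ[R] (I * J : Ideal R) :=
    .ofBijective _ ⟨inj, Submodule.mulMap'_surjective I J⟩
  have hp : P * Q = Pic.mk R (I ⊗[R] J) := by
    rw [Pic.mk_tensor, hP.unique (of_invertible I), hQ.unique (of_invertible J)]
  rw [hp]
  exact ⟨Pic.mk.linearEquiv R _ ≪≫ₗ e⟩

variable [IsDomain R]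

theorem ne_bot {P : Pic R} {I : Ideal R} (h : IsIdealRep P I) : I ≠ ⊥ := by
  rintro rfl
  have := h.invertible
  have h1 := FaithfulSMul.eq_of_smul_eq_smul (M := R) (α := (⊥ : Ideal R)) (m₁ := 0) (m₂ := 1)
    (fun a => Subsingleton.elim _ _)
  exact zero_ne_one h1

theorem exists_rep (P : Pic R) : ∃ I, IsIdealRep P I :=
  Module.Invertible.exists_linearEquiv_ideal R P.AsModule

theorem span_singleton {a : R} (ha : a ≠ 0) : IsIdealRep (1 : Pic R) (Ideal.span {a}) :=
  one.trans (Submodule.topEquiv ≪≫ₗ (LinearEquiv.toSpanNonzeroSingleton R R a ha))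

theorem eq_one_iff {P : Pic R} {I : Ideal R} (h : IsIdealRep P I) :
    P = 1 ↔ ∃ a ≠ 0, I = Ideal.span {a} := by
  constructor
  · rintro rfl
    let e : R ≃ₗ[R] I := Submodule.topEquiv.symm ≪≫ₗ (one.some.symm ≪≫ₗ h.some)
    have key : I = Ideal.span {(e 1 : R)} := by
      apply le_antisymm
      · intro x hx
        obtain ⟨r, hr⟩ := e.surjective ⟨x, hx⟩
        rw [Ideal.mem_span_singleton']
        refine ⟨r, ?_⟩
        have : e r = r • e 1 := by rw [← map_smul, smul_eq_mul, mul_one]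
        rw [hr] at this
        simpa using (congrArg Subtype.val this).symm
      · rw [Ideal.span_singleton_le_iff_mem]
        exact (e 1).2
    refine ⟨e 1, fun h0 => h.ne_bot ?_, key⟩
    rw [key, h0, Ideal.span_singleton_eq_bot]
  · rintro ⟨a, ha, rfl⟩
    exact h.unique (span_singleton ha)

theorem exists_inverse {P : Pic R} {I : Ideal R} (h : IsIdealRep P I) :
    ∃ (J : Ideal R) (a : R), IsIdealRep P⁻¹ J ∧ a ≠ 0 ∧ I * J = Ideal.span {a} := by
  obtain ⟨J, hJ⟩ := exists_rep P⁻¹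
  obtain ⟨a, ha, h2⟩ := (h.mul hJ).eq_one_iff.mp (mul_inv_cancel P)
  exact ⟨J, a, hJ, ha, h2⟩

end IsIdealRep

/-- Inside the fraction field I has the inverse a⁻¹J, so it is a unit among the R-submodules, and
such units are invertible modules. -/
theorem invertible_of_mul_eq_span {R : Type} [CommRing R] [IsDomain R] {I J : Ideal R} {a : R}
    (ha : a ≠ 0) (h : I * J = Ideal.span {a}) : Module.Invertible R I := by
  let K := FractionRing R
  let ι : Ideal R → Submodule R K := fun I => Submodule.map (Algebra.linearMap R K) I
  have hmul : ∀ I J, ι (I * J) = ι I * ι J := fun I J =>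
    Submodule.map_mul I J (Algebra.ofId R K)
  have ha' : algebraMap R K a ≠ 0 := by simpa using ha
  have hspan : ι (Ideal.span {a}) = Submodule.span R {algebraMap R K a} := by
    simp [ι, Ideal.span, Submodule.map_span]
  have hu : IsUnit (ι I) := by
    refine IsUnit.of_mul_eq_one (ι J * Submodule.span R {(algebraMap R K a)⁻¹}) ?_
    rw [← mul_assoc, ← hmul, h, hspan, Submodule.span_mul_span,
      Set.singleton_mul_singleton, mul_inv_cancel₀ ha', Submodule.one_eq_span]
  have e : I ≃ₗ[R] ι I := Submodule.equivMapOfInjective _ (IsFractionRing.injective R K) I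
  have : Module.Invertible R (ι I) := (inferInstance : Module.Invertible R hu.unit)
  exact .congr e.symm

theorem IsIdealRep.of_mul_eq_span {R : Type} [CommRing R] [IsDomain R] {I J : Ideal R} {a : R}
    (ha : a ≠ 0) (h : I * J = Ideal.span {a}) : ∃ P, IsIdealRep P I :=
  have := invertible_of_mul_eq_span ha h
  ⟨_, .of_invertible I⟩

/-- The map is r ⊗ x ↦ r·x. It need not be injective, as `R'` need not be flat over `R`;
surjectivity suffices for the two results below. -/
theorem exists_tensor_surjective {R R' : Type} [CommRing R] [CommRing R'] [Algebra R R']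
    (I : Ideal R) :
    ∃ g : R' ⊗[R] I →ₗ[R'] (I.map (algebraMap R R')), Function.Surjective g := by
  let f : R' ⊗[R] I →ₗ[R'] R' := TensorProduct.AlgebraTensorModule.lift
    ((LinearMap.lsmul R' (I →ₗ[R] R')).flip ((Algebra.linearMap R R').comp I.subtype))
  have hf : ∀ r x, f (r ⊗ₜ x) = r * algebraMap R R' x := fun r x => by simp [f]
  have hr : LinearMap.range f = I.map (algebraMap R R') := by
    apply le_antisymm
    · rintro _ ⟨z, rfl⟩
      induction z with
      | zero => simp
      | add a b ha hb => rw [map_add]; exact add_mem ha hb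
      | tmul r x =>
        rw [hf]
        exact Ideal.mul_mem_left _ _ (Ideal.mem_map_of_mem _ x.2)
    · rw [Ideal.map_le_iff_le_comap]
      intro x hx
      exact ⟨1 ⊗ₜ ⟨x, hx⟩, by simp [hf]⟩
  exact ⟨(LinearEquiv.ofEq _ _ hr).toLinearMap ∘ₗ f.rangeRestrict,
    (LinearEquiv.ofEq _ _ hr).surjective.comp f.surjective_rangeRestrict⟩

/-- If the class of `I` becomes trivial along `φ`, then the extension of `I` is principal. -/
theorem IsIdealRep.map_principal {R R' : Type} [CommRing R] [CommRing R'] (φ : R →+* R')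
    {P : Pic R} {I : Ideal R} (h : IsIdealRep P I) (h1 : Pic.mapRingHom φ P = 1) :
    ∃ a, I.map φ = Ideal.span {a} := by
  algebraize [φ]
  obtain ⟨g, hg⟩ := exists_tensor_surjective (R' := R') I
  have e1 : R' ⊗[R] P.AsModule ≃ₗ[R'] R' := (Pic.mk_eq_one_iff.mp h1).some
  let e : R' ⊗[R] P.AsModule ≃ₗ[R'] R' ⊗[R] I := h.some.baseChange R R' _ _
  -- `k` maps a free module of rank one onto the extended ideal, so `k 1` generates it. No
  -- injectivity is needed, hence `R'` may have zero divisors.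
  let k : R' →ₗ[R'] (I.map φ) := g ∘ₗ e.toLinearMap ∘ₗ e1.symm.toLinearMap
  have hk : Function.Surjective k := hg.comp (e.surjective.comp e1.symm.surjective)
  refine ⟨k 1, le_antisymm (fun x hx => ?_) ?_⟩
  · obtain ⟨r, hr⟩ := hk ⟨x, hx⟩
    rw [Ideal.mem_span_singleton']
    refine ⟨r, ?_⟩
    have : k r = r • k 1 := by rw [← map_smul, smul_eq_mul, mul_one]
    rw [hr] at this
    simpa using (congrArg Subtype.val this).symm
  · rw [Ideal.span_singleton_le_iff_mem]
    exact (k 1).2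

/-- A surjection between invertible modules is bijective, so it suffices that the extended ideal is
invertible; this is where `φ a ≠ 0` enters. -/
theorem IsIdealRep.map {R R' : Type} [CommRing R] [CommRing R'] [IsDomain R']
    (φ : R →+* R') {P : Pic R} {I J : Ideal R} {a : R} (h : IsIdealRep P I)
    (hIJ : I * J = Ideal.span {a}) (ha : φ a ≠ 0) :
    IsIdealRep (Pic.mapRingHom φ P) (I.map φ) := by
  have hinv : Module.Invertible R' (I.map φ) := by
    refine invertible_of_mul_eq_span (J := J.map φ) ha ?_
    rw [← Ideal.map_mul, hIJ, Ideal.map_span, Set.image_singleton]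
  algebraize [φ]
  obtain ⟨g, hg⟩ := exists_tensor_surjective (R' := R') I
  have := h.invertible
  have b := Module.Invertible.bijective_of_surjective hg
  let e : R' ⊗[R] P.AsModule ≃ₗ[R'] R' ⊗[R] I := h.some.baseChange R R' _ _
  exact ⟨Pic.mk.linearEquiv R' _ ≪≫ₗ e ≪≫ₗ .ofBijective g b⟩

theorem IsIdealRep.map_of_injective {R R' : Type} [CommRing R] [IsDomain R] [CommRing R']
    [IsDomain R'] {φ : R →+* R'} (hφ : Function.Injective φ) {P : Pic R} {I : Ideal R}
    (h : IsIdealRep P I) : IsIdealRep (Pic.mapRingHom φ P) (I.map φ) := by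
  obtain ⟨J, a, -, ha, h2⟩ := h.exists_inverse
  exact h.map φ h2 (by rwa [Ne, map_eq_zero_iff φ hφ])

end PicardIdeals

/-! ### The coordinate ring: normal form, norm, integrality, functoriality. -/

namespace CoordRing

section Basic

variable {A : Type} [CommRing A] (h : ℤ)

/-- A constant as a function on the curve. -/
abbrev const (a : A) : CoordRing A h := ofPoly h (C a)

theorem ofPoly_add (a b : A[X]) : ofPoly h (a + b) = ofPoly h a + ofPoly h b := map_add _ a b

theorem ofPoly_sub (a b : A[X]) : ofPoly h (a - b) = ofPoly h a - ofPoly h b := map_sub _ a b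

theorem ofPoly_neg (a : A[X]) : ofPoly h (-a) = -ofPoly h a := map_neg _ a

theorem ofPoly_mul (a b : A[X]) : ofPoly h (a * b) = ofPoly h a * ofPoly h b := map_mul _ a b

theorem ofPoly_pow (a : A[X]) (n : ℕ) : ofPoly h (a ^ n) = ofPoly h a ^ n := map_pow _ a n

theorem ofPoly_zero : ofPoly h (0 : A[X]) = 0 := map_zero _

theorem ofPoly_one : ofPoly h (1 : A[X]) = 1 := map_one _

theorem y_sq : y A h ^ 2 = ofPoly h (X ^ 5 + C (h : A)) := by
  have hy := AdjoinRoot.eval₂_root (X ^ 2 - C (X ^ 5 + C (h : A)) : A[X][X])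
  rw [eval₂_sub, eval₂_pow, eval₂_X, eval₂_C] at hy
  exact sub_eq_zero.mp hy

theorem monic_defining : (X ^ 2 - C (X ^ 5 + C (h : A)) : A[X][X]).Monic :=
  monic_X_pow_sub_C _ two_ne_zero

variable {h} in
theorem exists_eq (z : CoordRing A h) :
    ∃ a b : A[X], z = ofPoly h a + ofPoly h b * y A h := by
  rcases subsingleton_or_nontrivial A with hA | hA
  · have : Subsingleton (CoordRing A h) := (AdjoinRoot.mk_surjective (g := _)).subsingleton
    exact ⟨0, 0, Subsingleton.elim _ _⟩
  obtain ⟨q, rfl⟩ := AdjoinRoot.mk_surjective z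
  have hm := monic_defining (A := A) h
  have hd : (q %ₘ (X ^ 2 - C (X ^ 5 + C (h : A)))).degree ≤ 1 := by
    have := degree_modByMonic_lt q hm
    rw [degree_X_pow_sub_C two_pos] at this
    exact Order.lt_succ_iff.mp this
  refine ⟨(q %ₘ (X ^ 2 - C (X ^ 5 + C (h : A)))).coeff 0,
    (q %ₘ (X ^ 2 - C (X ^ 5 + C (h : A)))).coeff 1, ?_⟩
  conv_lhs => rw [← modByMonic_add_div q (X ^ 2 - C (X ^ 5 + C (h : A)))]
  rw [map_add, map_mul, AdjoinRoot.mk_self, zero_mul, add_zero]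
  conv_lhs => rw [eq_X_add_C_of_degree_le_one hd]
  simp [add_comm]

/-- The coordinate ring as the quadratic extension `A[x] ⊕ A[x]·y`. -/
def toQuad : CoordRing A h →+* QuadraticAlgebra A[X] (X ^ 5 + C (h : A)) 0 :=
  AdjoinRoot.lift (algebraMap _ _) QuadraticAlgebra.omega (by
    simp only [eval₂_sub, eval₂_pow, eval₂_X, eval₂_C]
    rw [sq, QuadraticAlgebra.omega_mul_omega_eq_algebraMap]
    simp)

@[simp]
theorem toQuad_ofPoly_add (a b : A[X]) :
    toQuad h (ofPoly h a + ofPoly h b * y A h) = ⟨a, b⟩ := by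
  rw [map_add, map_mul, toQuad, AdjoinRoot.lift_of, AdjoinRoot.lift_of, AdjoinRoot.lift_root]
  ext <;> simp

variable {h}

theorem ext_iff {a b a' b' : A[X]} :
    ofPoly h a + ofPoly h b * y A h = ofPoly h a' + ofPoly h b' * y A h ↔ a = a' ∧ b = b' := by
  constructor
  · intro e
    have := congrArg (toQuad h) e
    rw [toQuad_ofPoly_add, toQuad_ofPoly_add] at this
    exact ⟨congrArg QuadraticAlgebra.re this, congrArg QuadraticAlgebra.im this⟩
  · rintro ⟨rfl, rfl⟩
    rfl

theorem ofPoly_add_eq_zero {a b : A[X]} :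
    ofPoly h a + ofPoly h b * y A h = 0 ↔ a = 0 ∧ b = 0 := by
  rw [← ext_iff (h := h) (a' := 0) (b' := 0)]
  simp

theorem ofPoly_injective : Function.Injective (ofPoly (A := A) h) := by
  intro a b hab
  exact (ext_iff (h := h) (b := 0) (b' := 0)).mp (by simpa using hab) |>.1

/-- The norm to `A[x]`. -/
def norm (h : ℤ) : CoordRing A h →* A[X] := QuadraticAlgebra.norm.comp (toQuad h).toMonoidHom

theorem norm_eq (a b : A[X]) : norm h (ofPoly h a + ofPoly h b * y A h) =
    a ^ 2 - b ^ 2 * (X ^ 5 + C (h : A)) := by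
  have : norm h (ofPoly h a + ofPoly h b * y A h) =
    QuadraticAlgebra.norm (toQuad h (ofPoly h a + ofPoly h b * y A h)) := rfl
  rw [this, toQuad_ofPoly_add, QuadraticAlgebra.norm_def]
  ring

theorem norm_ofPoly (a : A[X]) : norm h (ofPoly h a) = a ^ 2 := by
  simpa using norm_eq (h := h) a 0

theorem mul_conj (a b : A[X]) :
    (ofPoly h a + ofPoly h b * y A h) * (ofPoly h a - ofPoly h b * y A h) =
      ofPoly h (norm h (ofPoly h a + ofPoly h b * y A h)) := by
  rw [norm_eq, ofPoly_sub, ofPoly_mul, ← y_sq, ofPoly_pow, ofPoly_pow]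
  ring

end Basic

section Domain

variable {A : Type} [CommRing A] [IsDomain A] {h : ℤ}

theorem natDegree_quintic : (X ^ 5 + C (h : A)).natDegree = 5 := natDegree_X_pow_add_C

theorem quintic_ne_zero : (X ^ 5 + C (h : A)) ≠ 0 := (monic_X_pow_add_C _ (by norm_num)).ne_zero

/-- The degrees 2·deg a and 2·deg b + 5 have different parity, so the leading terms cannot cancel.
-/
theorem natDegree_le_of_norm {a b : A[X]} (hb : b ≠ 0) :
    5 ≤ (a ^ 2 - b ^ 2 * (X ^ 5 + C (h : A))).natDegree ∧
      a ^ 2 - b ^ 2 * (X ^ 5 + C (h : A)) ≠ 0 := by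
  have h1 : (b ^ 2 * (X ^ 5 + C (h : A))).natDegree = 2 * b.natDegree + 5 := by
    rw [natDegree_mul (pow_ne_zero 2 hb) quintic_ne_zero, natDegree_pow, natDegree_quintic]
  have h2 : (a ^ 2).natDegree = 2 * a.natDegree := natDegree_pow _ _
  have key : 5 ≤ (a ^ 2 - b ^ 2 * (X ^ 5 + C (h : A))).natDegree := by
    rcases lt_or_ge (a ^ 2).natDegree (b ^ 2 * (X ^ 5 + C (h : A))).natDegree with hlt | hge
    · rw [natDegree_sub_eq_right_of_natDegree_lt hlt]
      omega
    · have hlt : (b ^ 2 * (X ^ 5 + C (h : A))).natDegree < (a ^ 2).natDegree := by omega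
      rw [natDegree_sub_eq_left_of_natDegree_lt hlt]
      omega
  refine ⟨key, fun h0 => ?_⟩
  rw [h0, natDegree_zero] at key
  omega

theorem norm_eq_zero {z : CoordRing A h} (hz : norm h z = 0) : z = 0 := by
  obtain ⟨a, b, rfl⟩ := exists_eq z
  rw [norm_eq] at hz
  have hb : b = 0 := by
    by_contra hb
    exact (natDegree_le_of_norm hb).2 hz
  subst hb
  have ha : a = 0 := by simpa using hz
  simp [ha]

theorem norm_ne_zero {z : CoordRing A h} (hz : z ≠ 0) : norm h z ≠ 0 :=
  fun h0 => hz (norm_eq_zero h0)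

instance : IsDomain (CoordRing A h) where
  exists_pair_ne := ⟨0, 1, fun h0 => by
    have := ofPoly_injective (h := h) (a₁ := (0 : A[X])) (a₂ := 1) (by simpa using h0)
    exact zero_ne_one this⟩
  mul_left_cancel_of_ne_zero := by
    intro a ha b c hbc
    have h1 : norm h (a * (b - c)) = 0 := by
      have : a * (b - c) = ofPoly h 0 := by rw [mul_sub, ofPoly_zero]; exact sub_eq_zero.mpr hbc
      rw [this, norm_ofPoly]
      simp
    rw [map_mul] at h1
    exact sub_eq_zero.mp (norm_eq_zero ((mul_eq_zero.mp h1).resolve_left (norm_ne_zero ha)))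
  mul_right_cancel_of_ne_zero := by
    intro a ha b c hbc
    have h1 : norm h ((b - c) * a) = 0 := by
      have : (b - c) * a = ofPoly h 0 := by rw [sub_mul, ofPoly_zero]; exact sub_eq_zero.mpr hbc
      rw [this, norm_ofPoly]
      simp
    rw [map_mul] at h1
    exact sub_eq_zero.mp (norm_eq_zero ((mul_eq_zero.mp h1).resolve_right (norm_ne_zero ha)))

end Domain

section Map

variable {A B D : Type} [CommRing A] [CommRing B] [CommRing D] {h : ℤ}

theorem hom_ext {T : Type} [CommRing T] {φ ψ : CoordRing A h →+* T}
    (hc : ∀ a, φ (const h a) = ψ (const h a)) (hx : φ (ofPoly h X) = ψ (ofPoly h X))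
    (hy : φ (y A h) = ψ (y A h)) : φ = ψ := by
  have h1 : φ.comp (AdjoinRoot.of _) = ψ.comp (AdjoinRoot.of _) :=
    Polynomial.ringHom_ext hc hx
  refine RingHom.ext fun z => ?_
  obtain ⟨a, b, rfl⟩ := exists_eq z
  have ha : φ (ofPoly h a) = ψ (ofPoly h a) := congrArg (fun g => g a) h1
  have hb : φ (ofPoly h b) = ψ (ofPoly h b) := congrArg (fun g => g b) h1
  rw [map_add φ, map_mul φ, map_add ψ, map_mul ψ, ha, hb, hy]

@[simp]
theorem map_ofPoly (f : A →+* B) (c : B) (hc : c ^ 5 = 1) (a : A[X]) :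
    CoordRing.map h f c hc (ofPoly h a) = ofPoly h ((a.map f).comp (C c * X)) := by
  rw [CoordRing.map, AdjoinRoot.lift_of, RingHom.comp_apply, coe_eval₂RingHom,
    ← eval₂_map, comp]

@[simp]
theorem map_y (f : A →+* B) (c : B) (hc : c ^ 5 = 1) :
    CoordRing.map h f c hc (y A h) = y B h := by
  rw [CoordRing.map, AdjoinRoot.lift_root]

theorem map_comp_map (f : A →+* B) (c : B) (hc : c ^ 5 = 1) (g : B →+* D) (d : D)
    (hd : d ^ 5 = 1) : (CoordRing.map h g d hd).comp (CoordRing.map h f c hc) =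
      CoordRing.map h (g.comp f) (g c * d) (by rw [mul_pow, ← map_pow, hc, map_one, hd, one_mul]) :=
  hom_ext (by simp) (by simp [mul_assoc]) (by simp)

theorem map_one_ofPoly (f : A →+* B) (a : A[X]) :
    CoordRing.map h f 1 (one_pow 5) (ofPoly h a) = ofPoly h (a.map f) := by
  simp

theorem map_injective {f : A →+* B} (hf : Function.Injective f) :
    Function.Injective (CoordRing.map h f 1 (one_pow 5)) := by
  rw [injective_iff_map_eq_zero]
  intro z hz
  obtain ⟨a, b, rfl⟩ := exists_eq z
  rw [_root_.map_add, _root_.map_mul, map_one_ofPoly, map_one_ofPoly, map_y,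
    ofPoly_add_eq_zero] at hz
  rw [ofPoly_add_eq_zero]
  exact ⟨(Polynomial.map_eq_zero_iff hf).mp hz.1, (Polynomial.map_eq_zero_iff hf).mp hz.2⟩

theorem map_surjective {f : A →+* B} (hf : Function.Surjective f) :
    Function.Surjective (CoordRing.map h f 1 (one_pow 5)) := by
  intro z
  obtain ⟨a, b, rfl⟩ := exists_eq z
  obtain ⟨a, rfl⟩ := Polynomial.map_surjective f hf a
  obtain ⟨b, rfl⟩ := Polynomial.map_surjective f hf b
  exact ⟨ofPoly h a + ofPoly h b * y A h, by simp⟩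

theorem map_eq_zero_iff {f : A →+* B} {π : A} (hf : ∀ a, f a = 0 ↔ π ∣ a) (z : CoordRing A h) :
    CoordRing.map h f 1 (one_pow 5) z = 0 ↔ const h π ∣ z := by
  constructor
  · intro hz
    obtain ⟨a, b, rfl⟩ := exists_eq z
    rw [_root_.map_add, _root_.map_mul, map_one_ofPoly, map_one_ofPoly, map_y,
      ofPoly_add_eq_zero] at hz
    have key : ∀ a : A[X], a.map f = 0 → C π ∣ a := by
      intro a ha
      rw [C_dvd_iff_dvd_coeff]
      intro i
      rw [← hf, ← coeff_map, ha, coeff_zero]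
    obtain ⟨a', rfl⟩ := key a hz.1
    obtain ⟨b', rfl⟩ := key b hz.2
    exact ⟨ofPoly h a' + ofPoly h b' * y A h, by rw [ofPoly_mul, ofPoly_mul]; ring⟩
  · rintro ⟨w, rfl⟩
    have : f π = 0 := (hf π).mpr dvd_rfl
    rw [_root_.map_mul, map_one_ofPoly, map_C, this]
    simp

end Map

end CoordRing

section JacFunctoriality

variable {A B D : Type} [CommRing A] [CommRing B] [CommRing D] {h : ℤ}

theorem Jac.push_push (φ : CoordRing A h →+* CoordRing B h) (ψ : CoordRing B h →+* CoordRing D h)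
    (P : Jac A h) : Jac.push ψ (Jac.push φ P) = Jac.push (ψ.comp φ) P :=
  CommRing.Pic.mapRingHom_mapRingHom

theorem Jac.baseChange_baseChange (f : A →+* B) (g : B →+* D) (P : Jac A h) :
    Jac.baseChange h g (Jac.baseChange h f P) = Jac.baseChange h (g.comp f) P := by
  rw [baseChange, baseChange, push_push, CoordRing.map_comp_map, baseChange]
  congr 3
  simp

end JacFunctoriality

namespace CoordRing

/-- The ring homomorphism that is `φ` on polynomials in `x` and maps `y` to `t`. -/
def lift {A T : Type} [CommRing A] [CommRing T] (h : ℤ) (φ : A[X] →+* T) (t : T)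
    (ht : t ^ 2 = φ (X ^ 5 + C (h : A))) : CoordRing A h →+* T :=
  AdjoinRoot.lift φ t (by rw [eval₂_sub, eval₂_pow, eval₂_X, eval₂_C, ht, sub_self])

section Lift

variable {A T : Type} [CommRing A] [CommRing T] {h : ℤ} {φ : A[X] →+* T} {t : T}
  (ht : t ^ 2 = φ (X ^ 5 + C (h : A)))

@[simp]
theorem lift_ofPoly (a : A[X]) : lift h φ t ht (ofPoly h a) = φ a := AdjoinRoot.lift_of _

@[simp]
theorem lift_y : lift h φ t ht (y A h) = t := AdjoinRoot.lift_root _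

end Lift

end CoordRing

/-! ### Mumford ideals over a field and Cantor reduction. -/

section FieldIdeals

open CoordRing

/-- If the three generate a proper ideal, the generator of a maximal ideal containing it is a common
prime factor. -/
theorem Polynomial.exists_bezout_three {k : Type} [Field k] {a b c : k[X]}
    (H : ∀ q : k[X], Prime q → q ∣ a → q ∣ b → q ∣ c → False) :
    ∃ α β γ, α * a + β * b + γ * c = 1 := by
  have htop : Ideal.span {a, b, c} = ⊤ := by
    by_contra hne
    obtain ⟨M, hM, hle⟩ := Ideal.exists_le_maximal _ hne
    have hb : M ≠ ⊥ := Ring.ne_bot_of_isMaximal_of_not_isField hM (Polynomial.not_isField k)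
    have hp := Submodule.IsPrincipal.prime_generator_of_isPrime M hb
    have hmem : ∀ x ∈ ({a, b, c} : Set k[X]), Submodule.IsPrincipal.generator M ∣ x := fun x hx =>
      (Submodule.IsPrincipal.mem_iff_generator_dvd M).mp (hle (Ideal.subset_span hx))
    exact H _ hp (hmem a (by simp)) (hmem b (by simp)) (hmem c (by simp))
  have h1 : (1 : k[X]) ∈ Ideal.span {a, b, c} := by rw [htop]; trivial
  obtain ⟨α, z, hz, h2⟩ := Ideal.mem_span_insert.mp h1
  obtain ⟨β, γ, h3⟩ := Ideal.mem_span_pair.mp hz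
  exact ⟨α, β, γ, by rw [h2, ← h3]; ring⟩

theorem quintic_squarefree {k : Type} [Field k] {h : ℤ} (h5 : (5 : k) ≠ 0) (hh : (h : k) ≠ 0) :
    Squarefree (X ^ 5 + C (h : k)) := by
  have : (X ^ 5 - C (-(h : k))).Separable :=
    separable_X_pow_sub_C _ (by exact_mod_cast h5) (neg_ne_zero.mpr hh)
  rw [C_neg, sub_neg_eq_add] at this
  exact this.squarefree

variable {k : Type} [Field k] {h : ℤ}

theorem y_sub_mul_y_add (v : k[X]) :
    (y k h - ofPoly h v) * (y k h + ofPoly h v) = -ofPoly h (v ^ 2 - (X ^ 5 + C (h : k))) := by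
  rw [ofPoly_sub, ← y_sq, ofPoly_pow]
  ring

/-- Ideals in Mumford form multiply by multiplying their first components. -/
theorem mumfordIdeal_mul (h2 : (2 : k) ≠ 0) (hf : Squarefree (X ^ 5 + C (h : k)))
    {u₁ u₂ v : k[X]} (hd : u₁ * u₂ ∣ v ^ 2 - (X ^ 5 + C (h : k))) :
    mumfordIdeal h u₁ v * mumfordIdeal h u₂ v = mumfordIdeal h (u₁ * u₂) v := by
  obtain ⟨w, hw⟩ := hd
  -- A common prime factor q of u₁, u₂ and v would give q² ∣ x⁵ + h.
  obtain ⟨α, β, γ, hab⟩ := exists_bezout_three (a := u₁) (b := u₂) (c := v) (by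
    intro q hq ha hb hc
    refine hq.not_isUnit (hf q ?_)
    have e : X ^ 5 + C (h : k) = v * v - u₁ * u₂ * w := by rw [← hw]; ring
    rw [e]
    exact dvd_sub (mul_dvd_mul hc hc) ((mul_dvd_mul ha hb).mul_right w))
  have hyy := y_sub_mul_y_add (k := k) (h := h) v
  rw [hw, ofPoly_mul, ofPoly_mul] at hyy
  have hab' := congrArg (ofPoly h) hab
  rw [ofPoly_add, ofPoly_add, ofPoly_mul, ofPoly_mul, ofPoly_mul, ofPoly_one] at hab'
  have hhalf : ofPoly h (C (2⁻¹ : k)) * 2 = 1 := by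
    have : (2 : CoordRing k h) = ofPoly h (C 2) := by
      rw [map_ofNat]; exact (map_ofNat (AdjoinRoot.of _) 2).symm
    rw [this, ← ofPoly_mul, ← C_mul, inv_mul_cancel₀ h2, C_1, ofPoly_one]
  rw [mumfordIdeal, mumfordIdeal, mumfordIdeal, Ideal.span_pair_mul_span_pair]
  set U₁ := ofPoly h u₁
  set U₂ := ofPoly h u₂
  set V := ofPoly h v
  set Y := y k h
  set H := ofPoly h (C (2⁻¹ : k))
  apply le_antisymm
  · rw [Ideal.span_le]
    rintro x (rfl | rfl | rfl | rfl)
    · exact Ideal.mem_span_pair.mpr ⟨1, 0, by rw [ofPoly_mul]; ring⟩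
    · exact Ideal.mem_span_pair.mpr ⟨0, U₁, by ring⟩
    · exact Ideal.mem_span_pair.mpr ⟨0, U₂, by ring⟩
    · exact Ideal.mem_span_pair.mpr ⟨0, Y - V, by ring⟩
  · rw [Ideal.span_le]
    rintro x (rfl | rfl)
    · exact Ideal.subset_span (by rw [ofPoly_mul]; simp [U₁, U₂])
    · set T := Ideal.span {U₁ * U₂, U₁ * (Y - V), (Y - V) * U₂, (Y - V) * (Y - V)}
      have m1 : U₁ * U₂ ∈ T := Ideal.subset_span (by simp)
      have m2 : U₁ * (Y - V) ∈ T := Ideal.subset_span (by simp)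
      have m3 : (Y - V) * U₂ ∈ T := Ideal.subset_span (by simp)
      have m4 : (Y - V) * (Y - V) ∈ T := Ideal.subset_span (by simp)
      -- The γ-terms come from (Y − V)² = −2V(Y − V) − U₁U₂w; inverting 2 isolates V(Y − V).
      have e : Y - V = ofPoly h α * (U₁ * (Y - V)) + ofPoly h β * ((Y - V) * U₂) +
          (-(ofPoly h γ * H)) * ((Y - V) * (Y - V)) +
          (-(ofPoly h γ * H * ofPoly h w)) * (U₁ * U₂) := by
        linear_combination (-(Y - V)) * hab' - ofPoly h γ * V * (Y - V) * hhalf +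
          ofPoly h γ * H * hyy
      change Y - V ∈ T
      rw [e]
      exact add_mem (add_mem (add_mem (T.mul_mem_left _ m2) (T.mul_mem_left _ m3))
        (T.mul_mem_left _ m4)) (T.mul_mem_left _ m1)

/-- The product of an ideal in Mumford form with its conjugate is principal. -/
theorem mumfordIdeal_mul_conj (h2 : (2 : k) ≠ 0) (hf : Squarefree (X ^ 5 + C (h : k)))
    {u v : k[X]} (hd : u ∣ v ^ 2 - (X ^ 5 + C (h : k))) :
    mumfordIdeal h u v * mumfordIdeal h u (-v) = Ideal.span {ofPoly h u} := by
  obtain ⟨w, hw⟩ := hd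
  obtain ⟨α, β, γ, hab⟩ := exists_bezout_three (a := u) (b := w) (c := v) (by
    intro q hq ha hb hc
    refine hq.not_isUnit (hf q ?_)
    have e : X ^ 5 + C (h : k) = v * v - u * w := by rw [← hw]; ring
    rw [e]
    exact dvd_sub (mul_dvd_mul hc hc) (mul_dvd_mul ha hb))
  have hyy := y_sub_mul_y_add (k := k) (h := h) v
  rw [hw, ofPoly_mul] at hyy
  have hab' := congrArg (ofPoly h) hab
  rw [ofPoly_add, ofPoly_add, ofPoly_mul, ofPoly_mul, ofPoly_mul, ofPoly_one] at hab'
  have hhalf : ofPoly h (C (2⁻¹ : k)) * 2 = 1 := by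
    have : (2 : CoordRing k h) = ofPoly h (C 2) := by
      rw [map_ofNat]; exact (map_ofNat (AdjoinRoot.of _) 2).symm
    rw [this, ← ofPoly_mul, ← C_mul, inv_mul_cancel₀ h2, C_1, ofPoly_one]
  rw [mumfordIdeal, mumfordIdeal, Ideal.span_pair_mul_span_pair, ofPoly_neg, sub_neg_eq_add]
  set U := ofPoly h u
  set V := ofPoly h v
  set Y := y k h
  set H := ofPoly h (C (2⁻¹ : k))
  set T := Ideal.span {U * U, U * (Y + V), (Y - V) * U, (Y - V) * (Y + V)}
  have m1 : U * U ∈ T := Ideal.subset_span (by simp)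
  have m2 : U * (Y + V) ∈ T := Ideal.subset_span (by simp)
  have m3 : (Y - V) * U ∈ T := Ideal.subset_span (by simp)
  have m4 : (Y - V) * (Y + V) ∈ T := Ideal.subset_span (by simp)
  apply le_antisymm
  · rw [Ideal.span_le]
    rintro x (rfl | rfl | rfl | rfl)
    · exact Ideal.mem_span_singleton'.mpr ⟨U, rfl⟩
    · exact Ideal.mem_span_singleton'.mpr ⟨Y + V, by ring⟩
    · exact Ideal.mem_span_singleton'.mpr ⟨Y - V, by ring⟩
    · exact Ideal.mem_span_singleton'.mpr ⟨-ofPoly h w, by rw [hyy]; ring⟩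
  · rw [Ideal.span_singleton_le_iff_mem]
    -- U(Y + V) − U(Y − V) = 2UV and (Y − V)(Y + V) = −Uw, so the Bézout relation can be multiplied
    -- by U inside `T`.
    have e : U = ofPoly h α * (U * U) + (ofPoly h γ * H) * (U * (Y + V)) +
          (-(ofPoly h γ * H)) * ((Y - V) * U) + (-ofPoly h β) * ((Y - V) * (Y + V)) := by
      linear_combination (-U) * hab' - ofPoly h γ * V * U * hhalf + ofPoly h β * hyy
    rw [e]
    exact add_mem (add_mem (add_mem (T.mul_mem_left _ m1) (T.mul_mem_left _ m2))
        (T.mul_mem_left _ m3)) (T.mul_mem_left _ m4)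

/-- Here u is a multiple of the norm of y − v, so it already lies in (y − v). -/
theorem mumfordIdeal_eq_span_of_dvd {A : Type} [CommRing A] {h : ℤ} {u v : A[X]}
    (hd : v ^ 2 - (X ^ 5 + C (h : A)) ∣ u) :
    mumfordIdeal h u v = Ideal.span {y A h - ofPoly h v} := by
  obtain ⟨w, rfl⟩ := hd
  apply le_antisymm
  · rw [mumfordIdeal, Ideal.span_le]
    rintro x (rfl | rfl)
    · refine Ideal.mem_span_singleton'.mpr ⟨-(y A h + ofPoly h v) * ofPoly h w, ?_⟩
      rw [ofPoly_mul, ofPoly_sub, ← y_sq, ofPoly_pow]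
      ring
    · exact Ideal.mem_span_singleton_self _
  · exact Ideal.span_mono (by simp)

theorem mumfordIdeal_congr {A : Type} [CommRing A] {h : ℤ} {u v v' : A[X]} (hd : u ∣ v - v') :
    mumfordIdeal h u v = mumfordIdeal h u v' := by
  have key : ∀ v v' : A[X], u ∣ v - v' → mumfordIdeal h u v ≤ mumfordIdeal h u v' := by
    rintro v v' ⟨w, hw⟩
    rw [mumfordIdeal, mumfordIdeal, Ideal.span_le]
    rintro x (rfl | rfl)
    · exact Ideal.subset_span (by simp)
    · refine Ideal.mem_span_pair.mpr ⟨-ofPoly h w, 1, ?_⟩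
      have := congrArg (ofPoly h) hw
      rw [ofPoly_sub, ofPoly_mul] at this
      linear_combination this
  exact le_antisymm (key _ _ hd) (key _ _ (by rw [← neg_sub]; exact hd.neg_right))

/-- Every nonzero ideal of the coordinate ring over a field is a multiple of an ideal in Mumford
form. -/
theorem exists_eq_span_mul_mumfordIdeal {I : Ideal (CoordRing k h)} (hI : I ≠ ⊥) :
    ∃ c u v : k[X], c ≠ 0 ∧ u ≠ 0 ∧ u ∣ v ^ 2 - (X ^ 5 + C (h : k)) ∧
      I = Ideal.span {ofPoly h c} * mumfordIdeal h u v := by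
  -- `J` collects the y-coefficients of elements of I, and `K` below is I ∩ k[x]. Their generators c
  -- and d = cu give the Hermite normal form of I as a k[x]-module.
  let J : Ideal k[X] :=
    { carrier := {b | ∃ a, ofPoly h a + ofPoly h b * y k h ∈ I}
      zero_mem' := ⟨0, by simp⟩
      add_mem' := by
        rintro b b' ⟨a, ha⟩ ⟨a', ha'⟩
        refine ⟨a + a', ?_⟩
        convert add_mem ha ha' using 1
        rw [ofPoly_add, ofPoly_add]
        ring
      smul_mem' := by
        rintro r b ⟨a, ha⟩
        refine ⟨r * a, ?_⟩
        convert I.mul_mem_left (ofPoly h r) ha using 1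
        rw [smul_eq_mul, ofPoly_mul, ofPoly_mul]
        ring }
  let K : Ideal k[X] := I.comap (AdjoinRoot.of _)
  have memK : ∀ a, a ∈ K ↔ ofPoly h a ∈ I := fun a => Iff.rfl
  have KleJ : K ≤ J := fun b hb => ⟨0, by
    rw [ofPoly_zero, zero_add]; exact I.mul_mem_right _ hb⟩
  have hK : K ≠ ⊥ := by
    obtain ⟨z, hz, hz0⟩ := Submodule.exists_mem_ne_zero_of_ne_bot hI
    obtain ⟨a, b, rfl⟩ := exists_eq z
    intro hb
    have : norm h (ofPoly h a + ofPoly h b * y k h) ∈ K := by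
      rw [memK, ← mul_conj]
      exact I.mul_mem_right _ hz
    rw [hb, Ideal.mem_bot] at this
    exact norm_ne_zero hz0 this
  have hJ : J ≠ ⊥ := fun h0 => hK (le_bot_iff.mp (h0 ▸ KleJ))
  set c := Submodule.IsPrincipal.generator J with hc
  set d := Submodule.IsPrincipal.generator K with hdd
  have hJc : ∀ x, x ∈ J ↔ c ∣ x := fun x => Submodule.IsPrincipal.mem_iff_generator_dvd J
  have hKd : ∀ x, x ∈ K ↔ d ∣ x := fun x => Submodule.IsPrincipal.mem_iff_generator_dvd K
  have hc0 : c ≠ 0 := fun h0 => hJ ((Submodule.IsPrincipal.eq_bot_iff_generator_eq_zero J).mpr h0)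
  have hd0 : d ≠ 0 := fun h0 => hK ((Submodule.IsPrincipal.eq_bot_iff_generator_eq_zero K).mpr h0)
  obtain ⟨u, hu⟩ : c ∣ d := (hJc d).mp (KleJ ((hKd d).mpr dvd_rfl))
  obtain ⟨a, ha⟩ : c ∈ J := (hJc c).mpr dvd_rfl
  -- The product y·(a + cy) has y-coefficient a, so a lies in `J`.
  obtain ⟨v, hv⟩ : c ∣ a := by
    rw [← hJc]
    refine ⟨c * (X ^ 5 + C (h : k)), ?_⟩
    convert I.mul_mem_right (y k h) ha using 1
    rw [ofPoly_mul, ← y_sq]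
    ring
  subst hv
  have hu0 : u ≠ 0 := by
    rintro rfl
    exact hd0 (by rw [hu, mul_zero])
  have hdvd : u ∣ v ^ 2 - (X ^ 5 + C (h : k)) := by
    rw [← mul_dvd_mul_iff_left hc0, ← hu, ← hKd, memK]
    convert I.mul_mem_right (ofPoly h v - y k h) ha using 1
    rw [ofPoly_mul, ofPoly_mul, ofPoly_sub, ← y_sq, ofPoly_pow]
    ring
  refine ⟨c, u, -v, hc0, hu0, by rwa [neg_sq], ?_⟩
  rw [mumfordIdeal, Ideal.span_mul_span', Set.singleton_mul, Set.image_pair, ← ofPoly_mul, ← hu, ofPoly_neg,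
    sub_neg_eq_add]
  apply le_antisymm
  · intro z hz
    obtain ⟨a', b', rfl⟩ := exists_eq z
    obtain ⟨b'', rfl⟩ : c ∣ b' := (hJc b').mp ⟨a', hz⟩
    have h1 : a' - b'' * c * v ∈ K := by
      rw [memK]
      convert sub_mem hz (I.mul_mem_left (ofPoly h b'') ha) using 1
      simp only [ofPoly_mul, ofPoly_sub]
      ring
    obtain ⟨e, he⟩ := (hKd _).mp h1
    refine Ideal.mem_span_pair.mpr ⟨ofPoly h e, ofPoly h b'', ?_⟩
    have := congrArg (ofPoly h) he
    simp only [ofPoly_mul, ofPoly_sub] at this ⊢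
    linear_combination -this
  · rw [Ideal.span_le]
    rintro x (rfl | rfl)
    · exact (memK d).mp ((hKd d).mpr dvd_rfl)
    · change _ ∈ I
      convert ha using 1
      rw [ofPoly_mul]
      ring

theorem IsIdealRep.of_span_mul {R : Type} [CommRing R] [IsDomain R] {P : CommRing.Pic R}
    {I J : Ideal R} {a b : R} (hP : IsIdealRep P (Ideal.span {a} * I)) (ha : a ≠ 0) (hb : b ≠ 0)
    (hIJ : I * J = Ideal.span {b}) : IsIdealRep P I := by
  obtain ⟨Q, hQ⟩ := IsIdealRep.of_mul_eq_span hb hIJ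
  have := ((IsIdealRep.span_singleton ha).mul hQ).unique hP
  rw [one_mul] at this
  rwa [← this]

/-- Nonzero ideals of the coordinate ring of a smooth curve over a field are invertible. -/
theorem exists_mul_eq_span (h2 : (2 : k) ≠ 0) (hf : Squarefree (X ^ 5 + C (h : k)))
    {I : Ideal (CoordRing k h)} (hI : I ≠ ⊥) :
    ∃ (J : Ideal (CoordRing k h)) (a : CoordRing k h), a ≠ 0 ∧ I * J = Ideal.span {a} := by
  obtain ⟨c, u, v, hc, hu, hd, rfl⟩ := exists_eq_span_mul_mumfordIdeal hI
  refine ⟨mumfordIdeal h u (-v), ofPoly h (c * u), ?_, ?_⟩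
  · rw [← ofPoly_zero]
    exact ofPoly_injective.ne (mul_ne_zero hc hu)
  · rw [mul_assoc, mumfordIdeal_mul_conj h2 hf hd, Ideal.span_singleton_mul_span_singleton,
      ofPoly_mul]

/-- Every divisor class over a field is given by a polynomial `u` of degree at most `2`. -/
theorem exists_mumfordIdeal_rep (h2 : (2 : k) ≠ 0) (hf : Squarefree (X ^ 5 + C (h : k)))
    (P : CommRing.Pic (CoordRing k h)) :
    ∃ u v : k[X], u ≠ 0 ∧ u.natDegree ≤ 2 ∧ u ∣ v ^ 2 - (X ^ 5 + C (h : k)) ∧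
      IsIdealRep P (mumfordIdeal h u v) := by
  have hne : ∀ {u : k[X]}, u ≠ 0 → ofPoly h u ≠ 0 := fun hu => by
    rw [← ofPoly_zero]; exact ofPoly_injective.ne hu
  -- Cantor reduction: with deg v < deg u and v² − x⁵ − h = uw, the principal ideal (y − v) is the
  -- product of (u, y − v) and (w, y − v). So (w, y + v) lies in the class of (u, y − v), and deg w
  -- < deg u as long as deg u > 2.
  have reduce : ∀ (N : ℕ) (u v : k[X]), u ≠ 0 → u.natDegree ≤ N →
      u ∣ v ^ 2 - (X ^ 5 + C (h : k)) → IsIdealRep P (mumfordIdeal h u v) →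
      ∃ u v : k[X], u ≠ 0 ∧ u.natDegree ≤ 2 ∧ u ∣ v ^ 2 - (X ^ 5 + C (h : k)) ∧
        IsIdealRep P (mumfordIdeal h u v) := by
    intro N
    induction N with
    | zero => intro u v hu hN hd hP; exact ⟨u, v, hu, by omega, hd, hP⟩
    | succ N ih =>
      intro u v hu hN hd hP
      by_cases hle : u.natDegree ≤ 2
      · exact ⟨u, v, hu, hle, hd, hP⟩
      have hvv : u ∣ v - v % u := ⟨v / u, by
        rw [sub_eq_iff_eq_add]; exact (EuclideanDomain.div_add_mod v u).symm⟩
      rw [mumfordIdeal_congr hvv] at hP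
      have hd' : u ∣ (v % u) ^ 2 - (X ^ 5 + C (h : k)) := by
        have : (v % u) ^ 2 - (X ^ 5 + C (h : k)) = v ^ 2 - (X ^ 5 + C (h : k)) -
          (v - v % u) * (v + v % u) := by ring
        rw [this]
        exact dvd_sub hd (hvv.mul_right _)
      have hdeg : (v % u).natDegree < u.natDegree := natDegree_mod_lt v (by omega)
      set v' := v % u
      obtain ⟨w, hw⟩ := hd'
      have hn := natDegree_le_of_norm (h := h) (a := v') (b := (1 : k[X])) one_ne_zero
      rw [one_pow, one_mul] at hn
      have hw0 : w ≠ 0 := by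
        rintro rfl
        exact hn.2 (by rw [hw, mul_zero])
      have hwd : w.natDegree ≤ N := by
        have h1 : (v' ^ 2 - (X ^ 5 + C (h : k))).natDegree ≤ max (2 * v'.natDegree) 5 := by
          refine (natDegree_sub_le _ _).trans ?_
          rw [natDegree_pow, natDegree_quintic]
        rw [hw, natDegree_mul hu hw0] at h1
        omega
      refine ih w (-v') hw0 hwd ⟨u, by rw [neg_sq, hw, mul_comm]⟩ ?_
      obtain ⟨Q, hQ⟩ := IsIdealRep.of_mul_eq_span (hne hw0)
        (mumfordIdeal_mul_conj h2 hf (u := w) (v := v') ⟨u, by rw [hw, mul_comm]⟩)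
      obtain ⟨Q', hQ'⟩ := IsIdealRep.of_mul_eq_span (I := mumfordIdeal h w (-v')) (hne hw0)
        (by rw [mul_comm]; exact mumfordIdeal_mul_conj h2 hf (u := w) (v := v')
              ⟨u, by rw [hw, mul_comm]⟩)
      have e1 : Q * Q' = 1 := by
        refine (hQ.mul hQ').unique ?_
        rw [mumfordIdeal_mul_conj h2 hf (u := w) (v := v') ⟨u, by rw [hw, mul_comm]⟩]
        exact IsIdealRep.span_singleton (hne hw0)
      have e2 : P * Q = 1 := by
        refine (hP.mul hQ).unique ?_
        rw [mumfordIdeal_mul h2 hf (by rw [hw]), mumfordIdeal_eq_span_of_dvd (by rw [hw])]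
        refine IsIdealRep.span_singleton fun h0 => ?_
        have := (ofPoly_add_eq_zero (h := h) (a := -v') (b := 1)).mp (by
          rw [ofPoly_neg, ofPoly_one, one_mul, neg_add_eq_sub]; exact h0)
        exact one_ne_zero this.2
      have : P = Q' := by
        rw [eq_comm, ← one_mul Q', ← e2, mul_assoc, e1, mul_one]
      rwa [this]
  obtain ⟨I, hI⟩ := IsIdealRep.exists_rep P
  obtain ⟨c, u, v, hc, hu, hd, rfl⟩ := exists_eq_span_mul_mumfordIdeal hI.ne_bot
  exact reduce u.natDegree u v hu le_rfl hd
    (hI.of_span_mul (hne hc) (hne hu) (mumfordIdeal_mul_conj h2 hf hd))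

/-- An ideal in Mumford form with `u` of degree `1` or `2` is not principal. -/
theorem mumfordIdeal_ne_span {u v : k[X]} (h1 : 1 ≤ u.natDegree) (h2 : u.natDegree ≤ 2)
    (hd : u ∣ v ^ 2 - (X ^ 5 + C (h : k))) (g : CoordRing k h) :
    mumfordIdeal h u v ≠ Ideal.span {g} := by
  intro hg
  have hu0 : u ≠ 0 := by rintro rfl; simp at h1
  have hu : ofPoly h u ∈ Ideal.span {g} := hg ▸ Ideal.subset_span (by simp)
  have hy : y k h - ofPoly h v ∈ Ideal.span {g} := hg ▸ Ideal.subset_span (by simp)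
  rw [Ideal.mem_span_singleton'] at hu hy
  obtain ⟨s, hs⟩ := hu
  obtain ⟨t, ht⟩ := hy
  obtain ⟨a, b, rfl⟩ := exists_eq g
  -- Otherwise the norm of the generator, of degree at least 5, divides u², of degree at most 4.
  have hb : b = 0 := by
    by_contra hb
    have hn := natDegree_le_of_norm (h := h) (a := a) hb
    have e := congrArg (CoordRing.norm h) hs
    rw [map_mul (CoordRing.norm h), norm_eq, norm_ofPoly] at e
    have hs0 : CoordRing.norm h s ≠ 0 := by
      intro h0
      rw [h0, zero_mul] at e
      exact pow_ne_zero 2 hu0 e.symm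
    have e2 := congrArg natDegree e
    rw [natDegree_mul hs0 hn.2, natDegree_pow] at e2
    omega
  subst hb
  rw [ofPoly_zero, zero_mul, add_zero] at hg ht
  obtain ⟨c, d, rfl⟩ := exists_eq t
  have e : ofPoly h (c * a) + ofPoly h (d * a) * y k h = ofPoly h (-v) + ofPoly h 1 * y k h := by
    rw [ofPoly_mul, ofPoly_mul, ofPoly_neg, ofPoly_one]
    linear_combination ht
  -- The y-coefficient of y − v is 1, so the generator is a unit. But the ideal is proper: y ↦ v
  -- modulo u kills it and not 1.
  have hda := (CoordRing.ext_iff.mp e).2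
  have htop : (1 : CoordRing k h) ∈ mumfordIdeal h u v := by
    rw [hg, Ideal.mem_span_singleton']
    exact ⟨ofPoly h d, by rw [← ofPoly_mul, hda, ofPoly_one]⟩
  rw [mumfordIdeal, Ideal.mem_span_pair] at htop
  obtain ⟨s, t, hst⟩ := htop
  let ev : CoordRing k h →+* AdjoinRoot u := CoordRing.lift h (AdjoinRoot.mk u)
    (AdjoinRoot.mk u v) (by
      rw [← map_pow, ← sub_eq_zero, ← map_sub, AdjoinRoot.mk_eq_zero]
      exact hd)
  have := congrArg ev hst
  have hnt : Nontrivial (AdjoinRoot u) := AdjoinRoot.nontrivial u (by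
    rw [degree_eq_natDegree hu0]
    exact_mod_cast (by omega : u.natDegree ≠ 0))
  have e1 : ev (ofPoly h u) = 0 := by
    rw [CoordRing.lift_ofPoly, AdjoinRoot.mk_self]
  have e2 : ev (y k h - ofPoly h v) = 0 := by
    rw [map_sub ev, CoordRing.lift_ofPoly, CoordRing.lift_y, sub_self]
  rw [map_add ev, map_mul ev, map_mul ev, e1, e2, map_one ev] at this
  simp at this

theorem mumfordIdeal_map {A B : Type} [CommRing A] [CommRing B] {h : ℤ} (f : A →+* B) (c : B)
    (hc : c ^ 5 = 1) (u v : A[X]) :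
    (mumfordIdeal h u v).map (CoordRing.map h f c hc) =
      mumfordIdeal h ((u.map f).comp (C c * X)) ((v.map f).comp (C c * X)) := by
  rw [mumfordIdeal, mumfordIdeal, Ideal.map_span, Set.image_pair, map_sub (CoordRing.map h f c hc),
    CoordRing.map_ofPoly, CoordRing.map_ofPoly, CoordRing.map_y]

/-- A class with a nontrivial Mumford representation does not become trivial over a field. -/
theorem IsMumfordRep.baseChange_ne_zero {A : Type} [CommRing A] {P : Jac A h} {u v : A[X]}
    (hP : IsMumfordRep P u v) (hne : (u, v) ≠ (1, 0)) (f : A →+* k) :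
    Jac.baseChange h f P ≠ 0 := by
  have hnt : Nontrivial A := f.domain_nontrivial
  intro h0
  -- Only principality is transported, so A may have zero divisors; ℤ/(λ) is not yet known to be a
  -- field when this is applied.
  obtain ⟨g, hg⟩ := IsIdealRep.map_principal (CoordRing.map h f 1 (one_pow 5))
    (P := P.toMul) hP.2 h0
  rw [mumfordIdeal_map] at hg
  simp only [C_1, one_mul, comp_X] at hg
  have hm := hP.1.monic
  refine mumfordIdeal_ne_span ?_ ?_ ?_ g hg
  · rw [hm.natDegree_map, Nat.one_le_iff_ne_zero]
    intro hd
    have hu : u = 1 := hm.natDegree_eq_zero.mp hd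
    have hv := hP.1.degree_lt
    rw [hu, degree_one] at hv
    exact hne (by rw [hu, (Nat.WithBot.lt_zero_iff.mp hv |> degree_eq_bot.mp)])
  · rw [hm.natDegree_map]
    exact hP.1.natDegree_le
  · simpa using Polynomial.map_dvd f hP.1.dvd

end FieldIdeals

/-! ### Picard groups under inversion of a prime element. -/

section Localization

variable {R R' : Type} [CommRing R] [CommRing R']

theorem Ideal.exists_eq_span_mul {b : R} {K : Ideal R} (hK : K ≤ Ideal.span {b}) :
    ∃ K', K = Ideal.span {b} * K' := by
  refine ⟨Submodule.comap (LinearMap.mulLeft R b) K, le_antisymm (fun x hx => ?_) ?_⟩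
  · obtain ⟨c, rfl⟩ := Ideal.mem_span_singleton.mp (hK hx)
    exact Ideal.mul_mem_mul (Ideal.mem_span_singleton_self b) hx
  · rw [Ideal.span_singleton_mul_le_iff]
    exact fun z hz => hz

/-- The ideal (ϖ) is prime, so each factor ϖ of the product can be pulled out of W or of V. -/
theorem Ideal.eq_span_pow_of_mul_eq [IsDomain R] {ϖ : R} (hϖ : Prime ϖ) (k : ℕ) {V W : Ideal R}
    (h : W * V = Ideal.span {ϖ ^ k}) : ∃ j, W = Ideal.span {ϖ ^ j} := by
  induction k generalizing V W with
  | zero =>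
    refine ⟨0, ?_⟩
    rw [pow_zero, Ideal.span_singleton_one] at h ⊢
    exact top_le_iff.mp (h ▸ Ideal.mul_le_left)
  | succ k ih =>
    have hp : (Ideal.span {ϖ}).IsPrime := (Ideal.span_singleton_prime hϖ.ne_zero).mpr hϖ
    have hle : W * V ≤ Ideal.span {ϖ} := by
      rw [h, Ideal.span_singleton_le_span_singleton]
      exact dvd_pow_self ϖ (Nat.succ_ne_zero k)
    have hs : Ideal.span {ϖ ^ (k + 1)} = Ideal.span {ϖ} * Ideal.span {ϖ ^ k} := by
      rw [Ideal.span_singleton_mul_span_singleton, pow_succ']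
    rw [hs] at h
    rcases hp.mul_le.mp hle with hW | hV
    · obtain ⟨W', rfl⟩ := Ideal.exists_eq_span_mul hW
      rw [mul_assoc, Ideal.span_singleton_mul_right_inj hϖ.ne_zero] at h
      obtain ⟨j, rfl⟩ := ih h
      exact ⟨j + 1, by rw [Ideal.span_singleton_mul_span_singleton, pow_succ']⟩
    · obtain ⟨V', rfl⟩ := Ideal.exists_eq_span_mul hV
      rw [mul_left_comm, Ideal.span_singleton_mul_right_inj hϖ.ne_zero] at h
      exact ih h

theorem Ideal.exists_pow_mul_mem_of_fg {ϖ b : R} {K : Ideal R} (hK : K.FG)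
    (H : ∀ x ∈ K, ∃ N, ϖ ^ N * x ∈ Ideal.span {b}) :
    ∃ N, Ideal.span {ϖ ^ N} * K ≤ Ideal.span {b} := by
  obtain ⟨s, rfl⟩ := hK
  have key : ∀ t : Finset R, t ⊆ s → ∃ N, ∀ x ∈ t, ϖ ^ N * x ∈ Ideal.span {b} := by
    classical
    intro t
    induction t using Finset.induction with
    | empty => exact fun _ => ⟨0, by simp⟩
    | insert a t ha ih =>
      intro hs
      obtain ⟨N, hN⟩ := ih ((Finset.subset_insert a t).trans hs)
      obtain ⟨M, hM⟩ := H a (Ideal.subset_span (hs (Finset.mem_insert_self a t)))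
      refine ⟨N + M, fun x hx => ?_⟩
      rcases Finset.mem_insert.mp hx with rfl | hx
      · rw [pow_add, mul_assoc]
        exact Ideal.mul_mem_left _ _ hM
      · rw [add_comm, pow_add, mul_assoc]
        exact Ideal.mul_mem_left _ _ (hN x hx)
  obtain ⟨N, hN⟩ := key s subset_rfl
  refine ⟨N, ?_⟩
  rw [Ideal.span_mul_span', Ideal.span_le]
  rintro _ ⟨_, rfl, x, hx, rfl⟩
  exact hN x hx

theorem Ideal.exists_pow_mul_eq_of_mem_map {φ : R →+* R'} {ϖ : R}
    (hloc : ∀ z, ∃ (N : ℕ) (x : R), φ ϖ ^ N * z = φ x) {K : Ideal R} {z : R'} (hz : z ∈ K.map φ) :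
    ∃ N, ∃ x ∈ K, φ ϖ ^ N * z = φ x := by
  refine Submodule.span_induction (p := fun z _ => ∃ N, ∃ x ∈ K, φ ϖ ^ N * z = φ x)
    ?_ ?_ ?_ ?_ hz
  · rintro _ ⟨x, hx, rfl⟩
    exact ⟨0, x, hx, by simp⟩
  · exact ⟨0, 0, K.zero_mem, by simp⟩
  · rintro a b - - ⟨N, x, hx, e⟩ ⟨M, x', hx', e'⟩
    refine ⟨N + M, ϖ ^ M * x + ϖ ^ N * x',
      add_mem (K.mul_mem_left _ hx) (K.mul_mem_left _ hx'), ?_⟩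
    rw [map_add, map_mul, map_mul, ← e, ← e', map_pow, map_pow]
    ring
  · rintro r a - ⟨N, x, hx, e⟩
    obtain ⟨M, y, hy⟩ := hloc r
    refine ⟨N + M, y * x, K.mul_mem_left _ hx, ?_⟩
    rw [map_mul, ← e, ← hy, smul_eq_mul]
    ring

variable [IsDomain R] [IsDomain R']

omit [IsDomain R'] in
/-- Inverting a prime element does not kill any class of the Picard group. -/
theorem Pic.eq_one_of_mapRingHom_eq_one {φ : R →+* R'} (hφ : Function.Injective φ) {ϖ : R}
    (hϖ : Prime ϖ) (hloc : ∀ z, ∃ (N : ℕ) (x : R), φ ϖ ^ N * z = φ x) {P : CommRing.Pic R}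
    (hP : CommRing.Pic.mapRingHom φ P = 1) : P = 1 := by
  obtain ⟨I, hI⟩ := IsIdealRep.exists_rep P
  obtain ⟨J, c, hJ, hc, hIJ⟩ := hI.exists_inverse
  obtain ⟨g, hg⟩ := hI.map_principal φ hP
  obtain ⟨N, g', hg', hgg⟩ := Ideal.exists_pow_mul_eq_of_mem_map hloc
    (K := I) (z := g) (hg ▸ Ideal.mem_span_singleton_self g)
  have hfg : I.FG := by
    have := hI.invertible
    exact (Module.Finite.iff_fg).mp inferInstance
  obtain ⟨k, hk⟩ := Ideal.exists_pow_mul_mem_of_fg (ϖ := ϖ) (b := g') hfg (by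
    intro x hx
    have h1 : φ x ∈ Ideal.span {g} := hg ▸ Ideal.mem_map_of_mem φ hx
    obtain ⟨r, hr⟩ := Ideal.mem_span_singleton'.mp h1
    obtain ⟨M, y, hy⟩ := hloc r
    refine ⟨N + M, Ideal.mem_span_singleton'.mpr ⟨y, hφ ?_⟩⟩
    rw [map_mul, map_mul, map_pow, ← hgg, ← hy, ← hr]
    ring)
  have hg0 : g' ≠ 0 := by
    rintro rfl
    obtain ⟨x, hx, hx0⟩ := Submodule.exists_mem_ne_zero_of_ne_bot hI.ne_bot
    have := hk (Ideal.mul_mem_mul (Ideal.mem_span_singleton_self _) hx)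
    rw [Ideal.mem_span_singleton, zero_dvd_iff] at this
    exact mul_ne_zero (pow_ne_zero k hϖ.ne_zero) hx0 this
  -- From ϖ^k·I ⊆ (g') ⊆ I, the quotients V = ϖ^k·I/g' and W = g'·J/c are integral ideals with
  -- product (ϖ^k). Hence W is a power of (ϖ) and J has trivial class.
  obtain ⟨V, hV⟩ := Ideal.exists_eq_span_mul hk
  obtain ⟨W, hW⟩ := Ideal.exists_eq_span_mul (b := c) (K := Ideal.span {g'} * J) (by
    rw [← hIJ]
    exact Ideal.mul_mono_left ((Ideal.span_singleton_le_iff_mem I).mpr hg'))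
  have hWV : W * V = Ideal.span {ϖ ^ k} := by
    rw [← Ideal.span_singleton_mul_right_inj (mul_ne_zero hc hg0),
      ← Ideal.span_singleton_mul_span_singleton]
    calc Ideal.span {c} * Ideal.span {g'} * (W * V)
        = (Ideal.span {c} * W) * (Ideal.span {g'} * V) := by ring
      _ = (Ideal.span {g'} * J) * (Ideal.span {ϖ ^ k} * I) := by rw [hV, hW]
      _ = (I * J) * Ideal.span {g'} * Ideal.span {ϖ ^ k} := by ring
      _ = _ := by rw [hIJ]
  obtain ⟨j, rfl⟩ := Ideal.eq_span_pow_of_mul_eq hϖ k hWV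
  have h1 := (IsIdealRep.span_singleton hg0).mul hJ
  rw [one_mul, hW, Ideal.span_singleton_mul_span_singleton] at h1
  exact inv_eq_one.mp (h1.unique
    (IsIdealRep.span_singleton (mul_ne_zero hc (pow_ne_zero j hϖ.ne_zero))))

/-- Since IJ = (b), the products aj cannot all lie in bM. One with aj = cb and c outside M makes a a
generator of I near M. -/
theorem Ideal.exists_mem_forall_mul_mem {I J M : Ideal R} {b : R} (hb : b ≠ 0)
    (h : I * J = Ideal.span {b}) (hM : M ≠ ⊤) :
    ∃ a ∈ I, ∃ s ∉ M, ∀ x ∈ I, s * x ∈ Ideal.span {a} := by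
  obtain ⟨a, ha, j, hj, c, hc, hcM⟩ : ∃ a ∈ I, ∃ j ∈ J, ∃ c, a * j = c * b ∧ c ∉ M := by
    by_contra! H
    have hle : I * J ≤ Ideal.span {b} * M := by
      rw [Ideal.mul_le]
      intro a ha j hj
      obtain ⟨c, hc⟩ := Ideal.mem_span_singleton'.mp (h ▸ Ideal.mul_mem_mul ha hj)
      rw [← hc, mul_comm c b]
      exact Ideal.mul_mem_mul (Ideal.mem_span_singleton_self b) (H a ha j hj c hc.symm)
    rw [h] at hle
    obtain ⟨m, hm, e⟩ := Ideal.mem_span_singleton_mul.mp (hle (Ideal.mem_span_singleton_self b))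
    have : m = 1 := mul_left_cancel₀ hb (by rw [e, mul_one])
    exact hM ((Ideal.eq_top_iff_one M).mpr (this ▸ hm))
  refine ⟨a, ha, c, hcM, fun x hx => ?_⟩
  obtain ⟨d, hd⟩ := Ideal.mem_span_singleton'.mp (h ▸ Ideal.mul_mem_mul hx hj)
  refine Ideal.mem_span_singleton'.mpr ⟨d, mul_left_cancel₀ hb ?_⟩
  linear_combination a * hd + x * hc

/-- An ideal of a domain that is invertible near every maximal ideal is invertible. -/
theorem Ideal.exists_mul_eq_span_of_local {I : Ideal R} (hI : I ≠ ⊥)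
    (H : ∀ M : Ideal R, M.IsMaximal → ∃ (J : Ideal R) (b s : R), b ≠ 0 ∧
      I * J ≤ Ideal.span {b} ∧ s ∉ M ∧ s * b ∈ I * J) :
    ∃ (J : Ideal R) (a : R), a ≠ 0 ∧ I * J = Ideal.span {a} := by
  obtain ⟨a, ha, ha0⟩ := Submodule.exists_mem_ne_zero_of_ne_bot hI
  -- The candidate inverse is (a) : I. The elements t with at ∈ I·J₀ form an ideal contained in no
  -- maximal ideal.
  let J₀ : Ideal R := (Ideal.span {a}).colon (I : Set R)
  have memJ₀ : ∀ J : Ideal R, I * J ≤ Ideal.span {a} → J ≤ J₀ := fun J hJ x hx =>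
    Submodule.mem_colon.mpr fun z hz => hJ (by
      rw [smul_eq_mul, mul_comm x z]; exact Ideal.mul_mem_mul hz hx)
  have hle : I * J₀ ≤ Ideal.span {a} := by
    rw [Ideal.mul_le]
    intro r hr s hs
    rw [mul_comm r s]
    exact Submodule.mem_colon.mp hs r hr
  refine ⟨J₀, a, ha0, le_antisymm hle ?_⟩
  let T : Ideal R := Submodule.comap (LinearMap.mulLeft R a) (I * J₀)
  have hT : T = ⊤ := by
    by_contra hne
    obtain ⟨M, hM, hTM⟩ := Ideal.exists_le_maximal T hne
    obtain ⟨J, b, s, hb, hJ, hs, hsb⟩ := H M hM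
    refine hs (hTM ?_)
    obtain ⟨J₁, hJ₁⟩ := Ideal.exists_eq_span_mul (b := b) (K := Ideal.span {a} * J)
      ((Ideal.mul_mono_left ((Ideal.span_singleton_le_iff_mem I).mpr ha)).trans hJ)
    have e : Ideal.span {b} * (I * J₁) = Ideal.span {a} * (I * J) := by
      rw [mul_left_comm, ← hJ₁]
      ring
    have h1 : J₁ ≤ J₀ := by
      refine memJ₀ J₁ ?_
      rw [← Ideal.span_singleton_mul_right_mono hb, e, mul_comm (Ideal.span {b})]
      exact Ideal.mul_mono_right hJ
    have h2 : b * (a * s) ∈ Ideal.span {b} * (I * J₁) := by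
      rw [e, show b * (a * s) = a * (s * b) by ring]
      exact Ideal.mul_mem_mul (Ideal.mem_span_singleton_self a) hsb
    obtain ⟨z, hz, hz2⟩ := Ideal.mem_span_singleton_mul.mp h2
    have : a * s ∈ I * J₁ := by rwa [← mul_left_cancel₀ hb hz2]
    exact Ideal.mul_mono_right h1 this
  rw [Ideal.span_singleton_le_iff_mem]
  have : (1 : R) ∈ T := hT ▸ Submodule.mem_top
  simpa [T] using this

/-- If `R/ϖ` has only invertible nonzero ideals then every class over `R[1/ϖ]` extends to `R`. -/
theorem Pic.mapRingHom_surjective {κ : Type} [CommRing κ] [IsDomain κ] [IsNoetherianRing R]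
    {φ : R →+* R'} (hφ : Function.Injective φ) {ψ : R →+* κ} (hψ : Function.Surjective ψ) {ϖ : R}
    (hψϖ : ∀ x, ψ x = 0 ↔ ϖ ∣ x) (hϖ : Prime ϖ) (hu : IsUnit (φ ϖ))
    (hloc : ∀ z, ∃ (N : ℕ) (x : R), φ ϖ ^ N * z = φ x)
    (hκ : ∀ I : Ideal κ, I ≠ ⊥ → ∃ (J : Ideal κ) (a : κ), a ≠ 0 ∧ I * J = Ideal.span {a}) :
    Function.Surjective (CommRing.Pic.mapRingHom φ) := by
  have map_comap : ∀ K : Ideal R', (K.comap φ).map φ = K := by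
    intro K
    refine le_antisymm Ideal.map_comap_le fun z hz => ?_
    obtain ⟨N, x, hx⟩ := hloc z
    rw [← (Ideal.unit_mul_mem_iff_mem _ (hu.pow N)), hx]
    exact Ideal.mem_map_of_mem φ (Ideal.mem_comap.mpr (hx ▸ K.mul_mem_left _ hz))
  intro F
  obtain ⟨I', hI'⟩ := IsIdealRep.exists_rep F
  obtain ⟨J', b, hJ', hb, hIJ⟩ := hI'.exists_inverse
  -- The contraction is saturated with respect to ϖ. Hence its image modulo ϖ is nonzero, and a
  -- relation in it divisible by ϖ can be divided by ϖ.
  set I := I'.comap φ with hIdef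
  have sat : ∀ z, ϖ * z ∈ I → z ∈ I := by
    intro z hz
    rw [hIdef, Ideal.mem_comap, map_mul, Ideal.unit_mul_mem_iff_mem _ hu] at hz
    exact hz
  have hI0 : I ≠ ⊥ := by
    intro h0
    have := map_comap I'
    rw [← hIdef, h0, Ideal.map_bot] at this
    exact hI'.ne_bot this.symm
  have hIψ : I.map ψ ≠ ⊥ := by
    obtain ⟨a, ha, ha0⟩ := Submodule.exists_mem_ne_zero_of_ne_bot hI0
    obtain ⟨n, c, hc, rfl⟩ := WfDvdMonoid.max_power_factor ha0 hϖ.irreducible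
    have hcI : c ∈ I := by
      clear ha0
      induction n with
      | zero => simpa using ha
      | succ n ih => exact ih (sat _ (by rwa [← mul_assoc, ← pow_succ']))
    intro h0
    have := Ideal.mem_map_of_mem ψ hcI
    rw [h0, Ideal.mem_bot, hψϖ] at this
    exact hc this
  obtain ⟨J, a, ha0, hJ⟩ := Ideal.exists_mul_eq_span_of_local hI0 (by
    intro M hM
    -- On the special fibre a local generator of I modulo ϖ is lifted, and Nakayama shows that the
    -- lift generates I near M.
    by_cases hϖM : ϖ ∈ M
    · obtain ⟨Jκ, bκ, hbκ, hIJκ⟩ := hκ _ hIψ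
      have hMψ : M.map ψ ≠ ⊤ := by
        intro htop
        have h1 : (1 : κ) ∈ M.map ψ := htop ▸ Submodule.mem_top
        obtain ⟨m, hm, hm1⟩ := (Ideal.mem_map_iff_of_surjective ψ hψ).mp h1
        have h2 : ψ (m - 1) = 0 := by rw [map_sub, hm1, map_one, sub_self]
        obtain ⟨z, hz⟩ := (hψϖ _).mp h2
        refine hM.ne_top ((Ideal.eq_top_iff_one M).mpr ?_)
        rw [show (1 : R) = m - ϖ * z by rw [← hz]; ring]
        exact sub_mem hm (M.mul_mem_right _ hϖM)
      obtain ⟨aκ, haκ, sκ, hsκ, H⟩ := Ideal.exists_mem_forall_mul_mem hbκ hIJκ hMψ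
      obtain ⟨a, ha, rfl⟩ := (Ideal.mem_map_iff_of_surjective ψ hψ).mp haκ
      obtain ⟨s, rfl⟩ := hψ sκ
      have hsM : s ∉ M := fun hs => hsκ (Ideal.mem_map_of_mem ψ hs)
      obtain ⟨t, m, hm, hts⟩ := hM.exists_inv hsM
      have hle : I ≤ Ideal.span {a} ⊔ M • I := by
        intro x hx
        obtain ⟨r, hr⟩ := Ideal.mem_span_singleton'.mp (H _ (Ideal.mem_map_of_mem ψ hx))
        obtain ⟨r, rfl⟩ := hψ r
        have h2 : ψ (s * x - r * a) = 0 := by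
          rw [map_sub, map_mul, map_mul, hr, sub_self]
        obtain ⟨z, hz⟩ := (hψϖ _).mp h2
        have hzI : z ∈ I := sat z (hz ▸ sub_mem (I.mul_mem_left _ hx) (I.mul_mem_left _ ha))
        rw [show x = t * r * a + (ϖ * (t * z) + m * x) by
          linear_combination (-x) * hts + t * hz]
        exact Submodule.add_mem_sup (Ideal.mul_mem_left _ _ (Ideal.mem_span_singleton_self a))
          (add_mem (Submodule.smul_mem_smul hϖM (I.mul_mem_left _ hzI))
            (Submodule.smul_mem_smul hm hx))
      obtain ⟨r, hr1, hr⟩ := Submodule.exists_sub_one_mem_and_smul_le_of_fg_of_le_sup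
        (IsNoetherian.noetherian I) le_rfl hle
      have hrM : r ∉ M := fun h => hM.ne_top ((Ideal.eq_top_iff_one M).mpr (by
        rw [show (1 : R) = r - (r - 1) by ring]
        exact sub_mem h hr1))
      have hrI : ∀ x ∈ I, r * x ∈ Ideal.span {a} := fun x hx =>
        hr (Submodule.smul_mem_pointwise_smul x r I hx)
      refine ⟨Ideal.span {r}, a, r, ?_, ?_, hrM, ?_⟩
      · rintro rfl
        obtain ⟨x, hx, hx0⟩ := Submodule.exists_mem_ne_zero_of_ne_bot hI0
        have h1 := hrI x hx
        rw [Ideal.mem_span_singleton, zero_dvd_iff] at h1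
        rcases mul_eq_zero.mp h1 with h2 | h2
        · exact hrM (h2 ▸ M.zero_mem)
        · exact hx0 h2
      · rw [mul_comm, Ideal.span_singleton_mul_le_iff]
        exact hrI
      · rw [mul_comm r a]
        exact Ideal.mul_mem_mul ha (Ideal.mem_span_singleton_self r)
    -- Off the special fibre ϖ is a unit at M, so the contraction of J' inverts I there once powers
    -- of ϖ are allowed for.
    · obtain ⟨N₀, b₁, hb₁⟩ := hloc b
      have hb₁0 : b₁ ≠ 0 := by
        rintro rfl
        rw [map_zero] at hb₁
        exact mul_ne_zero (hu.pow N₀).ne_zero hb hb₁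
      have hspan : Ideal.span {φ b₁} = Ideal.span {b} := by
        rw [← hb₁, Ideal.span_singleton_mul_left_unit (hu.pow N₀)]
      have hmap : (I * J'.comap φ).map φ = Ideal.span {φ b₁} := by
        rw [Ideal.map_mul, map_comap, map_comap, hIJ, hspan]
      obtain ⟨N, hN⟩ := Ideal.exists_pow_mul_mem_of_fg (ϖ := ϖ) (b := b₁)
        (IsNoetherian.noetherian (I * J'.comap φ)) (by
          intro x hx
          have h1 := Ideal.mem_map_of_mem φ hx
          rw [hmap] at h1
          obtain ⟨r, hr⟩ := Ideal.mem_span_singleton'.mp h1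
          obtain ⟨n, y, hy⟩ := hloc r
          refine ⟨n, Ideal.mem_span_singleton'.mpr ⟨y, hφ ?_⟩⟩
          rw [map_mul, map_mul, map_pow, ← hy, ← hr]
          ring)
      obtain ⟨m, x, hx, hmx⟩ := Ideal.exists_pow_mul_eq_of_mem_map hloc
        (K := I * J'.comap φ) (z := φ b₁) (hmap ▸ Ideal.mem_span_singleton_self _)
      have hx' : ϖ ^ m * b₁ = x := hφ (by rw [map_mul, map_pow, hmx])
      refine ⟨J'.comap φ * Ideal.span {ϖ ^ N}, b₁, ϖ ^ (N + m), hb₁0, ?_, ?_, ?_⟩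
      · rwa [← mul_assoc, mul_comm _ (Ideal.span {ϖ ^ N})]
      · exact fun h => hϖM (hM.isPrime.mem_of_pow_mem _ h)
      · rw [show ϖ ^ (N + m) * b₁ = x * ϖ ^ N by rw [← hx']; ring, ← mul_assoc]
        exact Ideal.mul_mem_mul hx (Ideal.mem_span_singleton_self _))
  obtain ⟨P, hP⟩ := IsIdealRep.of_mul_eq_span ha0 hJ
  refine ⟨P, (hP.map_of_injective hφ).unique ?_⟩
  rw [map_comap]
  exact hI'

end Localization

/-! ### Injectivity and surjectivity from models to the generic fibre. -/

section Specialization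

open CoordRing

variable {O E κ : Type} [CommRing O] [CommRing E] [CommRing κ] [IsDomain κ]
  {f : O →+* E} {g : O →+* κ} {π : O} {h : ℤ}

theorem Polynomial.exists_pow_mul_eq_map
    (hloc : ∀ e : E, ∃ (N : ℕ) (x : O), f π ^ N * e = f x) (a : E[X]) :
    ∃ (N : ℕ) (b : O[X]), C (f π) ^ N * a = b.map f := by
  induction a using Polynomial.induction_on' with
  | add p q hp hq =>
    obtain ⟨N, b, hb⟩ := hp
    obtain ⟨M, c, hc⟩ := hq
    refine ⟨N + M, C π ^ M * b + C π ^ N * c, ?_⟩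
    simp only [Polynomial.map_add, Polynomial.map_mul, Polynomial.map_pow, map_C, ← hb, ← hc]
    ring
  | monomial n e =>
    obtain ⟨N, x, hx⟩ := hloc e
    exact ⟨N, monomial n x, by rw [map_monomial, ← hx, ← C_pow, C_mul_monomial]⟩

theorem CoordRing.exists_pow_mul_eq_map
    (hloc : ∀ e : E, ∃ (N : ℕ) (x : O), f π ^ N * e = f x) (z : CoordRing E h) :
    ∃ (N : ℕ) (w : CoordRing O h),
      (CoordRing.map h f 1 (one_pow 5) (const h π)) ^ N * z = CoordRing.map h f 1 (one_pow 5) w := by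
  obtain ⟨a, b, rfl⟩ := exists_eq z
  obtain ⟨N, a', ha⟩ := Polynomial.exists_pow_mul_eq_map hloc a
  obtain ⟨M, b', hb⟩ := Polynomial.exists_pow_mul_eq_map hloc b
  have ha' := congrArg (ofPoly h) ha
  have hb' := congrArg (ofPoly h) hb
  rw [ofPoly_mul, ofPoly_pow] at ha' hb'
  refine ⟨N + M, ofPoly h (C π ^ M * a') + ofPoly h (C π ^ N * b') * y O h, ?_⟩
  rw [map_add (CoordRing.map h f 1 (one_pow 5)), map_mul (CoordRing.map h f 1 (one_pow 5)),
    map_one_ofPoly, map_one_ofPoly, map_one_ofPoly, map_y, map_C, Polynomial.map_mul,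
    Polynomial.map_mul, Polynomial.map_pow, Polynomial.map_pow, map_C, ofPoly_mul, ofPoly_mul,
    ofPoly_pow, ofPoly_pow, ← ha', ← hb']
  ring

/-- The quotient by this constant embeds in the coordinate ring over κ, which is a domain. -/
theorem CoordRing.prime_const (hg : ∀ a, g a = 0 ↔ π ∣ a) (hπ : π ≠ 0) :
    Prime (const h π) := by
  have key := CoordRing.map_eq_zero_iff (h := h) hg
  refine ⟨?_, ?_, ?_⟩
  · rw [← ofPoly_zero]
    exact ofPoly_injective.ne (C_ne_zero.mpr hπ)
  · intro hu
    have := (key 1).mpr (isUnit_iff_dvd_one.mp hu)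
    rw [map_one (CoordRing.map h g 1 (one_pow 5))] at this
    exact one_ne_zero this
  · intro a b hab
    rw [← key, map_mul (CoordRing.map h g 1 (one_pow 5)), mul_eq_zero, key, key] at hab
    exact hab

/-- Over E only powers of the constant π appear as new denominators, and π is prime because the
special curve is integral. Smoothness enters only for surjectivity. -/
theorem Jac.baseChange_injective [IsDomain O] (hf : Function.Injective f) (hg : ∀ a, g a = 0 ↔ π ∣ a)
    (hπ : π ≠ 0) (hloc : ∀ e : E, ∃ (N : ℕ) (x : O), f π ^ N * e = f x) :
    Function.Injective (Jac.baseChange h f) := by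
  rw [injective_iff_map_eq_zero]
  intro P hP
  exact Pic.eq_one_of_mapRingHom_eq_one (P := P.toMul) (CoordRing.map_injective hf)
    (CoordRing.prime_const (h := h) hg hπ) (CoordRing.exists_pow_mul_eq_map hloc) hP

theorem Jac.baseChange_surjective [IsDomain O] [IsDomain E] [IsNoetherianRing O] {κ : Type} [Field κ]
    {g : O →+* κ} (h2 : (2 : κ) ≠ 0)
    (h5 : (5 : κ) ≠ 0) (hh : (h : κ) ≠ 0) (hf : Function.Injective f)
    (hgs : Function.Surjective g) (hg : ∀ a, g a = 0 ↔ π ∣ a) (hπ : π ≠ 0) (hu : IsUnit (f π))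
    (hloc : ∀ e : E, ∃ (N : ℕ) (x : O), f π ^ N * e = f x) :
    Function.Surjective (Jac.baseChange h f) := by
  have : IsNoetherianRing (CoordRing O h) :=
    isNoetherianRing_of_surjective _ _ (AdjoinRoot.mk _) AdjoinRoot.mk_surjective
  refine Pic.mapRingHom_surjective (CoordRing.map_injective hf)
    (CoordRing.map_surjective hgs) (CoordRing.map_eq_zero_iff hg)
    (CoordRing.prime_const (h := h) hg hπ) ?_ (CoordRing.exists_pow_mul_eq_map hloc)
    (fun I hI => exists_mul_eq_span h2 (quintic_squarefree h5 hh) hI)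
  rw [map_one_ofPoly, map_C]
  exact (hu.map C).map (AdjoinRoot.of _)

end Specialization

/-! ### Norms along t ↦ t^m as products over roots of unity. -/

section RootsOfUnityProduct

variable {L : Type} [Field L]

theorem prod_sub_root_mul [Infinite L] {m : ℕ} (hm : 0 < m) {ω : L} (hω : IsPrimitiveRoot ω m) {T : Type}
    [CommRing T] (τ : L →+* T) (u : L) (t : T) :
    ∏ ζ ∈ nthRootsFinset m (1 : L), (τ u - τ ζ * t) = τ u ^ m - t ^ m := by
  have key : ∏ ζ ∈ nthRootsFinset m (1 : L), (C u - C ζ * X) = C u ^ m - X ^ m := by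
    refine Polynomial.funext fun s => ?_
    rw [eval_prod]
    simpa using (hω.pow_sub_pow_eq_prod_sub_mul u s hm).symm
  rw [← C_pow] at key
  have := congrArg (eval₂ τ t) key
  rw [eval₂_finsetProd, eval₂_sub, eval₂_C, eval₂_X_pow, map_pow] at this
  simpa using this

/-- The product of `F(ζ·X)` over the `m`-th roots of unity `ζ` is a polynomial in `X ^ m`. -/
theorem exists_prod_comp_eq_expand {m : ℕ} (hm : 0 < m) {ω : L} (hω : IsPrimitiveRoot ω m)
    (F : L[X][X]) : ∃ Q : L[X][X],
      ∏ ζ ∈ nthRootsFinset m (1 : L), F.comp (C (C ζ) * X) = expand L[X] m Q := by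
  set P := ∏ ζ ∈ nthRootsFinset m (1 : L), F.comp (C (C ζ) * X) with hP
  have hω0 : ω ≠ 0 := hω.ne_zero hm.ne'
  -- Replacing X by ωX permutes the factors, so only exponents divisible by m survive.
  have hinv : P.comp (C (C ω) * X) = P := by
    rw [hP, prod_comp]
    refine Finset.prod_bij (fun ζ _ => ζ * ω) ?_ ?_ ?_ ?_
    · intro ζ hζ
      rw [mem_nthRootsFinset hm] at hζ ⊢
      rw [mul_pow, hζ, hω.pow_eq_one, one_mul]
    · intro a _ b _ hab
      exact mul_right_cancel₀ hω0 hab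
    · intro ζ hζ
      refine ⟨ζ * ω⁻¹, ?_, by field_simp⟩
      rw [mem_nthRootsFinset hm] at hζ ⊢
      rw [mul_pow, inv_pow, hζ, hω.pow_eq_one, inv_one, one_mul]
    · intro ζ _
      rw [comp_assoc]
      simp [mul_assoc]
  refine ⟨contract m P, ?_⟩
  ext1 i
  rw [coeff_expand hm]
  split_ifs with hi
  · rw [coeff_contract hm.ne', Nat.div_mul_cancel hi]
  · have h1 := congrArg (fun q => q.coeff i) hinv
    simp only [comp_C_mul_X_coeff] at h1
    have h2 : P.coeff i * (C ω ^ i - 1) = 0 := by rw [mul_sub, h1, mul_one, sub_self]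
    rcases mul_eq_zero.mp h2 with h3 | h3
    · exact h3
    · exfalso
      rw [← C_pow, ← C_1, ← C_sub, C_eq_zero, sub_eq_zero] at h3
      exact hi ((hω.pow_eq_one_iff_dvd i).mp h3)

/-- `Q` is the norm of `F`. Depending only on t^m, it can be evaluated on the curve, where t^m but
not t is a function. -/
theorem exists_forall_eval_eq_prod {m : ℕ} (hm : 0 < m) {ω : L} (hω : IsPrimitiveRoot ω m)
    (F : L[X][X]) : ∃ Q : L[X][X], ∀ {T : Type} [CommRing T] (τ : L →+* T) (Y t : T),
      eval₂ (eval₂RingHom τ Y) (t ^ m) Q =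
        ∏ ζ ∈ nthRootsFinset m (1 : L), eval₂ (eval₂RingHom τ Y) (τ ζ * t) F := by
  obtain ⟨Q, hQ⟩ := exists_prod_comp_eq_expand hm hω F
  refine ⟨Q, fun τ Y t => ?_⟩
  have h1 := congrArg (eval₂ (eval₂RingHom τ Y) t) hQ
  rw [expand_eq_comp_X_pow, eval₂_comp, eval₂_X_pow, eval₂_finsetProd] at h1
  rw [← h1]
  refine Finset.prod_congr rfl fun ζ _ => ?_
  rw [eval₂_comp, eval₂_mul, eval₂_X, eval₂_C, coe_eval₂RingHom, eval₂_C]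

end RootsOfUnityProduct

/-! ### Tangent lines of the Hermitian curve. -/

section HermitianIdentity

/-- The tangent to s^(p+1) = t^(p+1) + 1 at (U, S) is S^p·s = U^p·t + 1; it meets the curve p times
at (U, S) and once at the p²-Frobenius image. With Y = √H·s^r and b = √H·S^r, the r-th power of this
equation becomes the first factor here, and the identity exhibits its zeros. -/
theorem tangent_mul_conj {T : Type} [CommRing T] (p : ℕ) [Fact p.Prime] [CharP T p] {r : ℕ}
    (hr : 2 * r = p + 1) {H U b t Y : T} (hH : H ^ p = H) (hY : Y ^ 2 = H * (t ^ (p + 1) + 1))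
    (hb : b ^ 2 = H * (U ^ (p + 1) + 1)) :
    (H ^ r * (1 + U ^ p * t) ^ r - b ^ p * Y) * (H ^ r * (1 + U ^ p * t) ^ r - b ^ p * (-Y)) =
      -(H ^ 2 * (t - U ^ (p ^ 2)) * (t - U) ^ p) := by
  have e1 : (1 + U ^ p * t) ^ p = 1 + U ^ (p ^ 2) * t ^ p := by
    rw [add_pow_char, one_pow, mul_pow, ← pow_mul, sq]
  have e2 : (t - U) ^ p = t ^ p - U ^ p := sub_pow_char t U
  have e3 : (b ^ p) ^ 2 = H * (U ^ p * U ^ (p ^ 2) + 1) := by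
    rw [← pow_mul, mul_comm p 2, pow_mul, hb, mul_pow, hH, add_pow_char, one_pow, ← pow_mul,
      add_mul, one_mul, pow_add, ← sq, mul_comm (U ^ p)]
  have e4 : (H ^ r * (1 + U ^ p * t) ^ r) ^ 2 =
      H ^ 2 * ((1 + U ^ p * t) * (1 + U ^ (p ^ 2) * t ^ p)) := by
    rw [mul_pow, ← pow_mul, ← pow_mul, mul_comm r 2, hr, pow_succ, hH, pow_succ, e1]
    ring
  have e5 : (H ^ r * (1 + U ^ p * t) ^ r - b ^ p * Y) *
      (H ^ r * (1 + U ^ p * t) ^ r - b ^ p * (-Y)) =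
      (H ^ r * (1 + U ^ p * t) ^ r) ^ 2 - (b ^ p) ^ 2 * Y ^ 2 := by ring
  rw [e5, e4, e3, hY, e2, pow_succ t p]
  ring

end HermitianIdentity

/-! ### Points over the field with p² elements are killed by p + 1. -/

section PointClass

open CoordRing

/-- Comaximality cancels the complementary factors: A = AB + AC = CD + AC lies in C, and
symmetrically. -/
theorem Ideal.eq_of_mul_eq_mul_of_sup_eq_top {R : Type} [CommRing R] {A B C D : Ideal R}
    (h : A * B = C * D) (h1 : A ⊔ D = ⊤) (h2 : B ⊔ C = ⊤) : A = C := by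
  apply le_antisymm
  · rw [← Ideal.mul_top A, ← h2, Ideal.mul_sup, h]
    exact sup_le Ideal.mul_le_left Ideal.mul_le_right
  · rw [← Ideal.mul_top C, ← h1, Ideal.mul_sup, ← h]
    exact sup_le Ideal.mul_le_right Ideal.mul_le_left

theorem IsIdealRep.pow {R : Type} [CommRing R] {P : CommRing.Pic R} {I : Ideal R}
    (hP : IsIdealRep P I) (n : ℕ) : IsIdealRep (P ^ n) (I ^ n) := by
  induction n with
  | zero => rw [pow_zero, pow_zero, Ideal.one_eq_top]; exact .one
  | succ n ih => rw [pow_succ, pow_succ]; exact ih.mul hP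

variable {L : Type} [Field L] {h : ℤ}

/-- Evaluation at the point `(a, b)` of the curve. -/
def evalPoint (h : ℤ) (a b : L) (hab : b ^ 2 = a ^ 5 + h) : CoordRing L h →+* L :=
  CoordRing.lift h (evalRingHom a) b (by simpa using hab)

theorem evalPoint_sub_mem {a b : L} (hab : b ^ 2 = a ^ 5 + h) (z : CoordRing L h) :
    z - const h (evalPoint h a b hab z) ∈ mumfordIdeal h (X - C a) (C b) := by
  obtain ⟨c, d, rfl⟩ := exists_eq z
  have e : ∀ c : L[X], ∃ q, c - C (c.eval a) = (X - C a) * q := fun c =>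
    dvd_iff_isRoot.mpr (by simp)
  obtain ⟨q, hq⟩ := e c
  obtain ⟨q', hq'⟩ := e d
  have hq := congrArg (ofPoly h) hq
  have hq' := congrArg (ofPoly h) hq'
  rw [ofPoly_sub, ofPoly_mul] at hq hq'
  refine Ideal.mem_span_pair.mpr ⟨ofPoly h q + ofPoly h q' * ofPoly h (C b), ofPoly h d, ?_⟩
  rw [map_add (evalPoint h a b hab), map_mul (evalPoint h a b hab)]
  simp only [evalPoint, lift_ofPoly, lift_y, coe_evalRingHom, const]
  rw [show C (eval a c + eval a d * b) = C (eval a c) + C (eval a d) * C b by rw [C_add, C_mul],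
    ofPoly_add, ofPoly_mul]
  linear_combination (-1 : CoordRing L h) * hq - ofPoly h (C b) * hq'

/-- Modulo the ideal of a point a function equals its value there, and a nonzero value is a unit. -/
theorem span_sup_mumfordIdeal_eq_top {a b : L} (hab : b ^ 2 = a ^ 5 + h) {z : CoordRing L h}
    (hz : evalPoint h a b hab z ≠ 0) :
    Ideal.span {z} ⊔ mumfordIdeal h (X - C a) (C b) = ⊤ := by
  refine Ideal.eq_top_of_isUnit_mem _ (x := const h (evalPoint h a b hab z)) ?_
    (((Ne.isUnit hz).map C).map (AdjoinRoot.of _))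
  have := sub_mem (Ideal.mem_sup_left (Ideal.mem_span_singleton_self z))
    (Ideal.mem_sup_right (S := Ideal.span {z}) (evalPoint_sub_mem hab z))
  simpa using this

theorem hom_eval₂_eval₂ {S T : Type} [CommRing S] [CommRing T] (ψ : S →+* T) (τ : L →+* S) (Y t : S)
    (Q : L[X][X]) : ψ (eval₂ (eval₂RingHom τ Y) t Q) =
      eval₂ (eval₂RingHom (ψ.comp τ) (ψ Y)) (ψ t) Q := by
  rw [hom_eval₂]
  congr 1
  exact Polynomial.ringHom_ext (by simp) (by simp)

theorem X_sub_C_dvd {a b : L} (hab : b ^ 2 = a ^ 5 + h) :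
    X - C a ∣ C b ^ 2 - (X ^ 5 + C (h : L)) :=
  dvd_iff_isRoot.mpr (by simp [hab])

/-- The norm to the curve `y² = x⁵ + h` of a tangent line of the Hermitian curve. -/
theorem exists_tangent_norm [IsAlgClosed L] (p : ℕ) [Fact p.Prime] [CharP L p] {k : ℕ}
    (hk : p + 1 = 10 * k) (hh : (h : L) ≠ 0) {a b : L} (hab : b ^ 2 = a ^ 5 + h)
    (hb : b ≠ 0) (ha2 : a ^ p ^ 2 = a) (hb2 : b ^ p ^ 2 = b) (h2 : (2 : L) ≠ 0) :
    ∃ (N N' : CoordRing L h) (c : L), c ≠ 0 ∧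
      N * N' = const h c * ofPoly h (X - C a) ^ (p + 1) ∧
      evalPoint h a b hab N' ≠ 0 ∧ evalPoint h a (-b) (by rw [neg_sq, hab]) N ≠ 0 := by
  have hp : p.Prime := Fact.out
  have hinf : Infinite L := IsAlgClosed.instInfinite
  have hk0 : 0 < k := by omega
  have hm : 0 < 2 * k := by omega
  have hr : 2 * (5 * k) = p + 1 := by omega
  have : NeZero ((2 * k : ℕ) : L) := ⟨by
    intro h0
    rw [CharP.cast_eq_zero_iff L p] at h0
    have := Nat.le_of_dvd hm h0
    omega⟩
  obtain ⟨ω, hω⟩ := HasEnoughRootsOfUnity.exists_primitiveRoot L (2 * k)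
  -- As p + 1 = 5·2k, the substitution x = α·t^(2k) turns y² = x⁵ + h into Y² = h·(t^(p+1) + 1).
  obtain ⟨α, hα⟩ := IsAlgClosed.exists_pow_nat_eq (h : L) (n := 5) (by norm_num)
  have hα0 : α ≠ 0 := by
    rintro rfl
    exact hh (by rw [← hα]; norm_num)
  obtain ⟨U, hU⟩ := IsAlgClosed.exists_pow_nat_eq (α⁻¹ * a) hm
  have hhp : (h : L) ^ p = h := by
    have := map_intCast (frobenius L p) h
    rwa [frobenius_def] at this
  have hhp1 : (h : L) ^ (p - 1) = 1 := by
    refine mul_right_cancel₀ hh ?_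
    rw [← pow_succ, Nat.sub_add_cancel hp.one_le, hhp, one_mul]
  have hαp : α ^ p ^ 2 = α := by
    have e : p ^ 2 = 5 * ((p - 1) * (2 * k)) + 1 := by
      obtain ⟨q, rfl⟩ : ∃ q, p = q + 1 := ⟨p - 1, by omega⟩
      have hq : q + 2 = 10 * k := hk
      rw [Nat.add_sub_cancel]
      calc (q + 1) ^ 2 = q * (q + 2) + 1 := by ring
        _ = _ := by rw [hq]; ring
    rw [e, pow_succ, pow_mul, hα, pow_mul, hhp1, one_pow, one_mul]
  -- The tangent function, with y as inner and t as outer variable.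
  set F : L[X][X] := C (C ((h : L) ^ (5 * k))) * (1 + C (C (U ^ p)) * X) ^ (5 * k) -
    C (C (b ^ p) * X) with hF
  have hFev : ∀ {T : Type} [CommRing T] (τ : L →+* T) (Y t : T),
      eval₂ (eval₂RingHom τ Y) t F =
        τ h ^ (5 * k) * (1 + τ U ^ p * t) ^ (5 * k) - τ b ^ p * Y := by
    intro T _ τ Y t
    rw [hF, eval₂_sub, eval₂_mul, eval₂_C, eval₂_pow, eval₂_add, eval₂_one, eval₂_mul, eval₂_C,
      eval₂_X, eval₂_C]
    simp only [coe_eval₂RingHom, eval₂_C, eval₂_mul, eval₂_X, _root_.map_pow]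
    rw [← C_pow, eval₂_C, _root_.map_pow]
  obtain ⟨Q, hQ⟩ := exists_forall_eval_eq_prod hm hω F
  have hUp : U ^ (p + 1) = (α⁻¹ * a) ^ 5 := by
    rw [← hU, ← pow_mul, hk]
    congr 1
    ring
  have hbU : b ^ 2 = h * (U ^ (p + 1) + 1) := by
    rw [hab, hUp, mul_pow, inv_pow, hα]
    field_simp
  -- U need not be fixed by the p²-Frobenius, but U and U^(p²) lie over the same x-coordinate a,
  -- which is all the norm sees.
  have hU2 : (U ^ p ^ 2) ^ (2 * k) = α⁻¹ * a := by
    rw [← pow_mul, mul_comm, pow_mul, hU, mul_pow, inv_pow, hαp, ha2]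
  -- evaluation away from the given point
  have hne : ∀ t : L, t ^ (2 * k) = α⁻¹ * a →
      (h : L) ^ (5 * k) * (1 + U ^ p * t) ^ (5 * k) - b ^ p * (-b) ≠ 0 := by
    intro t ht h0
    have ht2 : t ^ (p + 1) = U ^ (p + 1) := by
      rw [hUp, ← ht, ← pow_mul, hk]
      congr 1
      ring
    have hprod := tangent_mul_conj p hr hhp (t := t) (Y := b) (by rw [ht2]; exact hbU) hbU
    rw [h0, mul_zero, eq_comm, neg_eq_zero, mul_eq_zero, mul_eq_zero, or_iff_right
      (pow_ne_zero 2 hh), pow_eq_zero_iff hp.ne_zero, sub_eq_zero, sub_eq_zero] at hprod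
    -- A zero forces t = U^(p²) or t = U. In both cases the first term is b^(p+1), so the value is
    -- 2b^(p+1) ≠ 0.
    have contra : (h : L) ^ (5 * k) * (1 + U ^ p * t) ^ (5 * k) = b ^ (p + 1) → False := by
      intro e
      rw [e, mul_neg, ← pow_succ, sub_neg_eq_add, ← two_mul] at h0
      exact mul_ne_zero h2 (pow_ne_zero _ hb) h0
    rcases hprod with rfl | rfl
    · refine contra ?_
      have e1 : (1 + U ^ p * U ^ p ^ 2) = (1 + U ^ (p + 1)) ^ p := by
        rw [add_pow_char, one_pow, ← pow_mul, ← pow_add]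
        congr 2
        ring
      rw [← mul_pow, e1]
      nth_rw 1 [← hhp]
      rw [← mul_pow, add_comm, ← hbU, ← pow_mul, ← pow_mul,
        show 2 * (p * (5 * k)) = p ^ 2 + p by rw [mul_left_comm, hr]; ring, pow_add, hb2, pow_succ,
        mul_comm]
    · refine contra ?_
      rw [← mul_pow, ← pow_succ, add_comm, ← hbU, ← pow_mul, hr]
  let cst : L →+* CoordRing L h := (AdjoinRoot.of _).comp C
  let x₁ : CoordRing L h := cst α⁻¹ * ofPoly h X
  refine ⟨eval₂ (eval₂RingHom cst (y L h)) x₁ Q, eval₂ (eval₂RingHom cst (-y L h)) x₁ Q,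
    (-(h : L) ^ 2) ^ (nthRootsFinset (2 * k) (1 : L)).card * α⁻¹ ^ (p + 1), ?_, ?_, ?_, ?_⟩
  · exact mul_ne_zero (pow_ne_zero _ (neg_ne_zero.mpr (pow_ne_zero 2 hh)))
      (pow_ne_zero _ (inv_ne_zero hα0))
  -- The root t of t^(2k) = x/α exists only after extending the function field, so the identity is
  -- checked there.
  · let T := AlgebraicClosure (FractionRing (CoordRing L h))
    let ψ : CoordRing L h →+* T :=
      (algebraMap (FractionRing (CoordRing L h)) T).comp (algebraMap (CoordRing L h) _)
    have hψ : Function.Injective ψ := (algebraMap (FractionRing (CoordRing L h)) T).injective.comp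
      (IsFractionRing.injective _ _)
    let τ : L →+* T := ψ.comp cst
    have hchar : CharP T p := charP_of_injective_ringHom τ.injective p
    obtain ⟨t, ht⟩ := IsAlgClosed.exists_pow_nat_eq (ψ x₁) hm
    apply hψ
    have hY : ψ (y L h) ^ 2 = ψ (ofPoly h X) ^ 5 + τ h := by
      rw [← map_pow ψ, y_sq, ofPoly_add, ofPoly_pow, map_add ψ, map_pow ψ]
      rfl
    have hτh : τ h ^ p = τ h := by rw [← map_pow, hhp]
    have hx : ψ (ofPoly h X) = τ α * t ^ (2 * k) := by
      rw [ht, map_mul ψ]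
      change _ = τ α * (τ α⁻¹ * _)
      rw [← mul_assoc, ← map_mul, mul_inv_cancel₀ hα0, map_one, one_mul]
    have factor : ∀ ζ ∈ nthRootsFinset (2 * k) (1 : L),
        eval₂ (eval₂RingHom τ (ψ (y L h))) (τ ζ * t) F *
          eval₂ (eval₂RingHom τ (ψ (-y L h))) (τ ζ * t) F =
        (-τ h ^ 2) * ((τ (U ^ p ^ 2) - τ ζ * t) * (τ U - τ ζ * t) ^ p) := by
      intro ζ hζ
      rw [mem_nthRootsFinset hm] at hζ
      have e1 : (τ ζ * t) ^ (p + 1) = (t ^ (2 * k)) ^ 5 := by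
        rw [hk, show 10 * k = 2 * k * 5 by ring, pow_mul, mul_pow, ← map_pow, hζ, map_one, one_mul]
      have hodd : Odd p := ⟨5 * k - 1, by omega⟩
      have e2 : τ ζ * t - τ U = -(τ U - τ ζ * t) := by ring
      rw [hFev, hFev, map_neg ψ, tangent_mul_conj p hr hτh (U := τ U) (b := τ b), e2,
        hodd.neg_pow, map_pow]
      · ring
      · rw [hY, hx, e1, mul_pow, ← map_pow τ, hα]
        ring
      · rw [← map_pow, hbU]
        simp
    rw [map_mul ψ, hom_eval₂_eval₂, hom_eval₂_eval₂, ← ht]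
    change eval₂ (eval₂RingHom τ _) _ _ * eval₂ (eval₂RingHom τ _) _ _ = _
    rw [hQ, hQ, ← Finset.prod_mul_distrib, Finset.prod_congr rfl factor, Finset.prod_mul_distrib,
      Finset.prod_mul_distrib, Finset.prod_const, Finset.prod_pow, prod_sub_root_mul hm hω,
      prod_sub_root_mul hm hω, ← map_pow τ (U ^ p ^ 2), hU2, ← map_pow τ U, hU, ← pow_succ', ht]
    have e3 : ψ (const h ((-(h : L) ^ 2) ^ (nthRootsFinset (2 * k) (1 : L)).card *
        α⁻¹ ^ (p + 1))) = (-τ h ^ 2) ^ (nthRootsFinset (2 * k) (1 : L)).card *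
          τ α⁻¹ ^ (p + 1) := by
      change τ _ = _
      simp
    have e4 : τ (α⁻¹ * a) - ψ x₁ = τ α⁻¹ * -(ψ (ofPoly h (X - C a))) := by
      rw [map_mul τ, map_mul ψ, ofPoly_sub, map_sub ψ]
      change τ α⁻¹ * τ a - τ α⁻¹ * _ = τ α⁻¹ * -(_ - τ a)
      ring
    have heven : Even (p + 1) := ⟨5 * k, by omega⟩
    rw [e4, map_mul ψ (const h _), e3, mul_pow, heven.neg_pow, map_pow ψ, mul_assoc]
  · have hx : evalPoint h a b hab x₁ = α⁻¹ * a := by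
      simp [x₁, cst, evalPoint]
    have hc : (evalPoint h a b hab).comp cst = RingHom.id L := by
      ext z
      simp [cst, evalPoint]
    rw [hom_eval₂_eval₂, hx, ← hU, hc, hQ, Finset.prod_ne_zero_iff]
    intro ζ hζ
    rw [mem_nthRootsFinset hm] at hζ
    rw [hFev]
    have : evalPoint h a b hab (-y L h) = -b := by simp [evalPoint]
    rw [this]
    exact hne _ (by rw [RingHom.id_apply, mul_pow, hζ, one_mul, hU])
  · have hx : evalPoint h a (-b) (by rw [neg_sq, hab]) x₁ = α⁻¹ * a := by
      simp [x₁, cst, evalPoint]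
    have hc : (evalPoint h a (-b) (by rw [neg_sq, hab])).comp cst = RingHom.id L := by
      ext z
      simp [cst, evalPoint]
    rw [hom_eval₂_eval₂, hx, ← hU, hc, hQ, Finset.prod_ne_zero_iff]
    intro ζ hζ
    rw [mem_nthRootsFinset hm] at hζ
    rw [hFev]
    have : evalPoint h a (-b) (by rw [neg_sq, hab]) (y L h) = -b := by simp [evalPoint]
    rw [this]
    exact hne _ (by rw [RingHom.id_apply, mul_pow, hζ, one_mul, hU])

/-- A point of `y² = x⁵ + h` over the field with `p²` elements, `p ≡ 9 mod 10`, is annihilated by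
`p + 1`. -/
theorem mumfordIdeal_pow_eq_span [IsAlgClosed L] (p : ℕ) [Fact p.Prime] [CharP L p] {k : ℕ}
    (hk : p + 1 = 10 * k) (hh : (h : L) ≠ 0) {a b : L} (hab : b ^ 2 = a ^ 5 + h)
    (ha2 : a ^ p ^ 2 = a) (hb2 : b ^ p ^ 2 = b) (h2 : (2 : L) ≠ 0)
    (hf : Squarefree (X ^ 5 + C (h : L))) :
    ∃ N ≠ 0, mumfordIdeal h (X - C a) (C b) ^ (p + 1) = Ideal.span {N} := by
  have hx0 : ofPoly h (X - C a) ≠ 0 := by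
    rw [← ofPoly_zero]
    exact ofPoly_injective.ne (X_sub_C_ne_zero a)
  have hconj := mumfordIdeal_mul_conj h2 hf (X_sub_C_dvd hab)
  rw [← C_neg] at hconj
  -- A point with b = 0 is 2-torsion, and p + 1 is even.
  by_cases hb : b = 0
  · subst hb
    rw [neg_zero] at hconj
    refine ⟨ofPoly h (X - C a) ^ (5 * k), pow_ne_zero _ hx0, ?_⟩
    rw [show p + 1 = 2 * (5 * k) by omega, pow_mul,
      sq (mumfordIdeal h (X - C a) (C 0)), hconj, Ideal.span_singleton_pow]
  · obtain ⟨N, N', c, hc, hN, hN1, hN2⟩ := exists_tangent_norm p hk hh hab hb ha2 hb2 h2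
    have hcu : IsUnit (const h c) := (hc.isUnit.map C).map (AdjoinRoot.of _)
    refine ⟨N, ?_, ?_⟩
    · rintro rfl
      rw [zero_mul, eq_comm] at hN
      exact mul_ne_zero hcu.ne_zero (pow_ne_zero _ hx0) hN
    -- N does not vanish at (a, −b) nor N' at (a, b), so N takes exactly the share of (x − a)^(p+1)
    -- belonging to (a, b).
    · symm
      refine Ideal.eq_of_mul_eq_mul_of_sup_eq_top (B := Ideal.span {N'})
        (D := mumfordIdeal h (X - C a) (C (-b)) ^ (p + 1)) ?_ ?_ ?_
      · rw [← mul_pow, hconj, Ideal.span_singleton_mul_span_singleton, hN,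
          Ideal.span_singleton_mul_left_unit hcu, Ideal.span_singleton_pow]
      · exact Ideal.sup_pow_eq_top (span_sup_mumfordIdeal_eq_top _ hN2)
      · exact Ideal.sup_pow_eq_top (span_sup_mumfordIdeal_eq_top _ hN1)

end PointClass

/-! ### Classes over 𝔽_p as sums of points; the action of ζ. -/

section FrobeniusPoints

open CoordRing

/-- The class `P` is that of the point `(a, b)`. -/
def IsPointClass {L : Type} [Field L] {h : ℤ} (P : Jac L h) (a b : L) : Prop :=
  b ^ 2 = a ^ 5 + h ∧ IsIdealRep P.toMul (mumfordIdeal h (X - C a) (C b))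

variable {L : Type} [Field L] [IsAlgClosed L] {h : ℤ} {p : ℕ} [Fact p.Prime] [CharP L p]

omit [IsAlgClosed L] in
theorem pow_eval₂_eq (f : ZMod p →+* L) (u : (ZMod p)[X]) (a : L) :
    eval₂ f a u ^ p = eval₂ f (a ^ p) u := by
  have := hom_eval₂ u f (frobenius L p) a
  rwa [Subsingleton.elim ((frobenius L p).comp f) f] at this

omit [IsAlgClosed L] in
-- Frobenius permutes the roots of u; if a were not fixed by its square, then a, a^p, a^(p²) would
-- be three distinct roots.
theorem pow_sq_eq_of_eval₂_eq_zero (f : ZMod p →+* L) {u : (ZMod p)[X]} (hu : u ≠ 0)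
    (hd : u.natDegree ≤ 2) {a : L} (ha : eval₂ f a u = 0) : a ^ p ^ 2 = a := by
  classical
  have hp : p.Prime := Fact.out
  have step : ∀ {a : L}, eval₂ f a u = 0 → eval₂ f (a ^ p) u = 0 := fun {a} ha => by
    rw [← pow_eval₂_eq, ha, zero_pow hp.ne_zero]
  have inj : Function.Injective fun z : L => z ^ p := frobenius_inj L p
  by_contra hne
  rw [sq, pow_mul] at hne
  have h1 : a ^ p ≠ a := fun h1 => hne (by rw [h1, h1])
  have h2 : (a ^ p) ^ p ≠ a ^ p := fun h2 => h1 (inj h2)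
  have hu' : u.map f ≠ 0 := (Polynomial.map_ne_zero_iff f.injective).mpr hu
  have hcard : ({a, a ^ p, (a ^ p) ^ p} : Finset L).card = 3 := by
    rw [Finset.card_eq_three]
    exact ⟨a, a ^ p, (a ^ p) ^ p, h1.symm, Ne.symm hne, h2.symm, rfl⟩
  have := card_le_degree_of_subset_roots (p := u.map f)
    (Z := ({a, a ^ p, (a ^ p) ^ p} : Finset L)) (by
      intro z hz
      rw [mem_roots hu', IsRoot, eval_map]
      simp only [Finset.mem_val, Finset.mem_insert, Finset.mem_singleton] at hz
      rcases hz with rfl | rfl | rfl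
      · exact ha
      · exact step ha
      · exact step (step ha))
  rw [hcard, natDegree_map] at this
  omega

theorem ofPoly_ne_zero {A : Type} [CommRing A] {h : ℤ} {u : A[X]} (hu : u ≠ 0) :
    ofPoly h u ≠ 0 := by
  rw [← ofPoly_zero]
  exact ofPoly_injective.ne hu

/-- Over an algebraically closed field a Mumford ideal factors into ideals of points, one root of u
at a time. The predicate `good` carries what is known about these points. -/
theorem mem_of_rep (h2 : (2 : L) ≠ 0) (hf : Squarefree (X ^ 5 + C (h : L)))
    (S : AddSubgroup (Jac L h))
    (good : L → L → Prop) (hS : ∀ P a b, good a b → IsPointClass P a b → P ∈ S) (N : ℕ) :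
    ∀ (u v : L[X]) (P : Jac L h), u ≠ 0 → u.natDegree ≤ N →
      u ∣ v ^ 2 - (X ^ 5 + C (h : L)) → (∀ a, u.IsRoot a → good a (v.eval a)) →
      IsIdealRep P.toMul (mumfordIdeal h u v) → P ∈ S := by
  have base : ∀ (u v : L[X]) (P : Jac L h), u ≠ 0 → u.natDegree = 0 →
      IsIdealRep P.toMul (mumfordIdeal h u v) → P ∈ S := by
    intro u v P hu hd hP
    rw [natDegree_eq_zero] at hd
    obtain ⟨c, rfl⟩ := hd
    have htop : mumfordIdeal h (C c) v = ⊤ := by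
      refine Ideal.eq_top_of_isUnit_mem _ (Ideal.subset_span (by simp) : ofPoly h (C c) ∈ _) ?_
      exact ((Ne.isUnit (C_ne_zero.mp hu)).map C).map (AdjoinRoot.of _)
    rw [htop] at hP
    have : P = 0 := hP.unique .one
    rw [this]
    exact zero_mem S
  induction N with
  | zero => intro u v P hu hd _ _ hP; exact base u v P hu (by omega) hP
  | succ N ih =>
    intro u v P hu hN hd hgood hP
    by_cases hdeg : u.natDegree = 0
    · exact base u v P hu hdeg hP
    obtain ⟨a, ha⟩ := IsAlgClosed.exists_root u (fun h0 => hdeg (natDegree_eq_of_degree_eq_some h0))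
    obtain ⟨w, rfl⟩ := dvd_iff_isRoot.mpr ha
    have hw : w ≠ 0 := right_ne_zero_of_mul hu
    have hX : X - C a ≠ 0 := X_sub_C_ne_zero a
    have hwd : w.natDegree ≤ N := by
      rw [natDegree_mul hX hw, natDegree_X_sub_C] at hN
      omega
    have hd1 : X - C a ∣ v ^ 2 - (X ^ 5 + C (h : L)) := (dvd_mul_right _ _).trans hd
    have hd2 : w ∣ v ^ 2 - (X ^ 5 + C (h : L)) := (dvd_mul_left _ _).trans hd
    have hva : X - C a ∣ v - C (v.eval a) := dvd_iff_isRoot.mpr (by simp)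
    obtain ⟨A, hA⟩ := IsIdealRep.of_mul_eq_span (ofPoly_ne_zero hX)
      (mumfordIdeal_mul_conj h2 hf hd1)
    obtain ⟨B, hB⟩ := IsIdealRep.of_mul_eq_span (ofPoly_ne_zero hw)
      (mumfordIdeal_mul_conj h2 hf hd2)
    have hAB := hA.mul hB
    rw [mumfordIdeal_mul h2 hf hd] at hAB
    have hPAB : P = (Additive.ofMul A : Jac L h) + (Additive.ofMul B : Jac L h) :=
      hP.unique hAB
    rw [hPAB]
    refine add_mem (hS _ a (v.eval a) (hgood a ha) ⟨?_, ?_⟩) (ih w v _ hw hwd hd2 ?_ hB)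
    · have := dvd_iff_isRoot.mp hd1
      simpa [sub_eq_zero] using this
    · rw [← mumfordIdeal_congr hva]
      exact hA
    · intro c hc
      exact hgood c (root_mul_left_of_isRoot _ hc)

/-- The image over `L` of a class over the prime field is a sum of points over the field with `p²`
elements. -/
theorem Jac.baseChange_mem (h2 : (2 : L) ≠ 0) (h5 : (5 : L) ≠ 0) (hh : (h : L) ≠ 0)
    (f : ZMod p →+* L) (S : AddSubgroup (Jac L h))
    (hS : ∀ P a b, a ^ p ^ 2 = a → b ^ p ^ 2 = b → IsPointClass P a b → P ∈ S)
    (G : Jac (ZMod p) h) : Jac.baseChange h f G ∈ S := by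
  have h2' : (2 : ZMod p) ≠ 0 := fun h0 => h2 (by rw [← map_ofNat f, h0, map_zero])
  have h5' : (5 : ZMod p) ≠ 0 := fun h0 => h5 (by rw [← map_ofNat f, h0, map_zero])
  have hh' : (h : ZMod p) ≠ 0 := fun h0 => hh (by rw [← map_intCast f, h0, map_zero])
  obtain ⟨u, v, hu, hd, hdvd, hG⟩ := exists_mumfordIdeal_rep h2' (quintic_squarefree h5' hh')
    G.toMul
  have hrep := hG.map_of_injective (CoordRing.map_injective (h := h) f.injective)
  rw [mumfordIdeal_map] at hrep
  simp only [C_1, one_mul, comp_X] at hrep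
  refine mem_of_rep h2 (quintic_squarefree h5 hh) S (fun a b => a ^ p ^ 2 = a ∧ b ^ p ^ 2 = b)
    (fun P a b hab hP => hS P a b hab.1 hab.2 hP) 2 (u.map f) (v.map f) _
    ((Polynomial.map_ne_zero_iff f.injective).mpr hu) (by rwa [natDegree_map]) ?_ ?_ hrep
  · simpa using Polynomial.map_dvd f hdvd
  · intro a ha
    rw [IsRoot, eval_map] at ha
    have ha2 := pow_sq_eq_of_eval₂_eq_zero f hu hd ha
    refine ⟨ha2, ?_⟩
    rw [eval_map, sq, pow_mul, pow_eval₂_eq, pow_eval₂_eq, ← pow_mul, ← sq, ha2]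

/-- For `p ≡ 9 mod 10` the number `p + 1` annihilates the Jacobian over the prime field. -/
theorem Jac.succ_nsmul_baseChange_eq_zero {k : ℕ} (hk : p + 1 = 10 * k) (h2 : (2 : L) ≠ 0)
    (h5 : (5 : L) ≠ 0) (hh : (h : L) ≠ 0) (f : ZMod p →+* L) (G : Jac (ZMod p) h) :
    (p + 1) • Jac.baseChange h f G = 0 := by
  refine Jac.baseChange_mem h2 h5 hh f (nsmulAddMonoidHom (p + 1) : Jac L h →+ Jac L h).ker ?_ G
  rintro P a b ha hb ⟨hab, hP⟩
  obtain ⟨N, hN, hpow⟩ := mumfordIdeal_pow_eq_span p hk hh hab ha hb h2 (quintic_squarefree h5 hh)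
  have := hP.pow (p + 1)
  rw [hpow] at this
  exact this.eq_one_iff.mpr ⟨N, hN, rfl⟩

/-- The automorphism of the Jacobian induced by `x ↦ c·x` on functions, where `c⁵ = 1`. -/
def Jac.scale {A : Type} [CommRing A] (h : ℤ) (c : A) (hc : c ^ 5 = 1) :
    AddMonoid.End (Jac A h) :=
  Jac.push (CoordRing.map h (RingHom.id A) c hc)

theorem Jac.scale_one {A : Type} [CommRing A] (h : ℤ) : Jac.scale h (1 : A) (one_pow 5) = 1 := by
  refine AddMonoidHom.ext fun P => ?_
  have : CoordRing.map h (RingHom.id A) 1 (one_pow 5) = RingHom.id _ :=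
    CoordRing.hom_ext (by simp) (by simp) (by simp)
  rw [scale, this]
  exact DFunLike.congr_fun CommRing.Pic.mapRingHom_id P.toMul

theorem Jac.scale_scale {A : Type} [CommRing A] {h : ℤ} {c d : A} (hc : c ^ 5 = 1) (hd : d ^ 5 = 1)
    (P : Jac A h) :
    Jac.scale h c hc (Jac.scale h d hd P) =
      Jac.scale h (c * d) (by rw [mul_pow, hc, hd, one_mul]) P := by
  have e : (CoordRing.map h (RingHom.id A) c hc).comp (CoordRing.map h (RingHom.id A) d hd) =
      CoordRing.map h (RingHom.id A) (c * d) (by rw [mul_pow, hc, hd, one_mul]) := by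
    rw [CoordRing.map_comp_map]
    exact CoordRing.hom_ext (by simp) (by simp [mul_comm]) (by simp)
  exact (Jac.push_push _ _ P).trans (congrArg (fun φ => Jac.push φ P) e)

theorem Jac.scale_mul {A : Type} [CommRing A] {h : ℤ} {c d : A} (hc : c ^ 5 = 1) (hd : d ^ 5 = 1) :
    Jac.scale h c hc * Jac.scale h d hd =
      Jac.scale h (c * d) (by rw [mul_pow, hc, hd, one_mul]) := 
  AddMonoidHom.ext (Jac.scale_scale hc hd)

theorem Jac.scale_pow {A : Type} [CommRing A] {h : ℤ} {c : A} (hc : c ^ 5 = 1) (i : ℕ) :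
    Jac.scale h (c ^ i) (by rw [← pow_mul, mul_comm, pow_mul, hc, one_pow]) =
      Jac.scale h c hc ^ i := by
  induction i with
  | zero =>
    simp only [pow_zero, Jac.scale_one]
  | succ i ih => simp only [pow_succ, ← ih, Jac.scale_mul]

theorem CoordRing.map_id_injective {A : Type} [CommRing A] {h : ℤ} {c : A} (hc : c ^ 5 = 1) :
    Function.Injective (CoordRing.map h (RingHom.id A) c hc) := by
  have hc4 : (c ^ 4) ^ 5 = 1 := by rw [← pow_mul, mul_comm, pow_mul, hc, one_pow]
  refine Function.LeftInverse.injective (g := CoordRing.map h (RingHom.id A) (c ^ 4) hc4) fun z => ?_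
  have : (CoordRing.map h (RingHom.id A) (c ^ 4) hc4).comp (CoordRing.map h (RingHom.id A) c hc) =
      RingHom.id _ := by
    rw [CoordRing.map_comp_map]
    refine CoordRing.hom_ext (by simp) ?_ (by simp)
    rw [CoordRing.map_ofPoly, RingHom.id_apply c, ← pow_succ', hc]
    simp
  exact DFunLike.congr_fun this z

omit [IsAlgClosed L] in
theorem IsIdealRep.scale {h : ℤ} {c : L} (hc : c ^ 5 = 1) {P : Jac L h} {u v : L[X]}
    (hP : IsIdealRep P.toMul (mumfordIdeal h u v)) :
    IsIdealRep (Jac.scale h c hc P).toMul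
      (mumfordIdeal h (u.comp (C c * X)) (v.comp (C c * X))) := by
  have := hP.map_of_injective (CoordRing.map_id_injective (h := h) hc)
  rw [mumfordIdeal_map] at this
  simp only [Polynomial.map_id] at this
  exact this

/-- The sum of the conjugates of a class under the fifth roots of unity is zero. -/
theorem Jac.sum_scale_eq_zero (h2 : (2 : L) ≠ 0) (h5 : (5 : L) ≠ 0) (hh : (h : L) ≠ 0)
    (f : ZMod p →+* L) {c : L} (hc : c ^ 5 = 1) (hc1 : c ^ 4 + c ^ 3 + c ^ 2 + c + 1 = 0)
    (G : Jac (ZMod p) h) :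
    (1 + Jac.scale h c hc + Jac.scale h c hc ^ 2 + Jac.scale h c hc ^ 3 + Jac.scale h c hc ^ 4 :
      AddMonoid.End (Jac L h)) (Jac.baseChange h f G) = 0 := by
  have hf := quintic_squarefree h5 hh
  set z := Jac.scale h c hc with hz
  let T : AddMonoid.End (Jac L h) := 1 + z + z ^ 2 + z ^ 3 + z ^ 4
  refine Jac.baseChange_mem h2 h5 hh f (AddMonoidHom.ker T) ?_ G
  -- The five conjugates of (a, b) are the zeros of y − b, so their classes sum to zero.
  rintro P a b - - ⟨hab, hP⟩
  have hrep : ∀ i, IsIdealRep ((z ^ i) P).toMul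
      (mumfordIdeal h (C c ^ i * X - C a) (C b)) := by
    intro i
    have := hP.scale (c := c ^ i) (by rw [← pow_mul, mul_comm, pow_mul, hc, one_pow])
    rw [Jac.scale_pow] at this
    simpa only [sub_comp, X_comp, C_comp, C_pow] using this
  have htot : (C c ^ 0 * X - C a) * (C c ^ 1 * X - C a) * (C c ^ 2 * X - C a) *
      (C c ^ 3 * X - C a) * (C c ^ 4 * X - C a) = X ^ 5 - C a ^ 5 := by
    have e2 : C c ^ 4 + C c ^ 3 + C c ^ 2 + C c + (1 : L[X]) = 0 := by
      simpa using congrArg C hc1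
    generalize C c = c at *
    generalize C a = a at *
    linear_combination (X*a^4 - c^3*X^2*a^3 - c*X^2*a^3 + c^5*X^3*a^2 + c^3*X^3*a^2 - c^6*X^4*a +
      c^6*X^5 - c^5*X^5 + c*X^5 - X^5) * e2
  have hfeq : (C b) ^ 2 - (X ^ 5 + C (h : L)) = -(X ^ 5 - C a ^ 5) := by
    rw [← C_pow, hab, C_add, C_pow]
    ring
  have hd5 : (C c ^ 0 * X - C a) * (C c ^ 1 * X - C a) * (C c ^ 2 * X - C a) *
      (C c ^ 3 * X - C a) * (C c ^ 4 * X - C a) ∣ (C b) ^ 2 - (X ^ 5 + C (h : L)) := by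
    rw [htot, hfeq, dvd_neg]
  have hd4 := (dvd_mul_right _ _).trans hd5
  have hd3 := (dvd_mul_right _ _).trans hd4
  have hd2 := (dvd_mul_right _ _).trans hd3
  have hprod := ((((hrep 0).mul (hrep 1)).mul (hrep 2)).mul (hrep 3)).mul (hrep 4)
  rw [mumfordIdeal_mul h2 hf hd2, mumfordIdeal_mul h2 hf hd3, mumfordIdeal_mul h2 hf hd4,
    mumfordIdeal_mul h2 hf hd5, htot, mumfordIdeal_eq_span_of_dvd (by rw [hfeq, neg_dvd])] at hprod
  have hone := hprod.eq_one_iff.mpr ⟨_, ?_, rfl⟩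
  · change T P = 0
    rw [pow_zero, pow_one] at hone
    exact hone
  · have := (ofPoly_add_eq_zero (h := h) (a := -C b) (b := (1 : L[X]))).not.mpr (by simp)
    rw [ofPoly_one, one_mul, ofPoly_neg] at this
    rwa [sub_eq_neg_add]

end FrobeniusPoints

/-! ### Frobenius on Picard groups and the cuspidal curve. -/

section Frobenius

open CoordRing CommRing

/-- The p-th powers of elements of I generate an ideal inside I^p. The same inclusion for J,
together with IJ = (a), forces equality. -/
theorem CommRing.Pic.mapRingHom_frobenius {R : Type} [CommRing R] [IsDomain R] (p : ℕ) [Fact p.Prime]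
    [CharP R p] (P : Pic R) : Pic.mapRingHom (frobenius R p) P = P ^ p := by
  obtain ⟨I, hI⟩ := IsIdealRep.exists_rep P
  obtain ⟨J, a, -, ha, hIJ⟩ := hI.exists_inverse
  have hap : frobenius R p a ≠ 0 := by
    rw [frobenius_def]
    exact pow_ne_zero _ ha
  have hle : ∀ K : Ideal R, K.map (frobenius R p) ≤ K ^ p := fun K => by
    rw [Ideal.map_le_iff_le_comap]
    exact fun x hx => Ideal.pow_mem_pow hx p
  have hge : I ^ p ≤ I.map (frobenius R p) := by
    have h1 : Ideal.span {frobenius R p a} ≤ I.map (frobenius R p) * J ^ p := by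
      rw [← Set.image_singleton, ← Ideal.map_span, ← hIJ, Ideal.map_mul]
      exact Ideal.mul_mono_right (hle J)
    have h2 : Ideal.span {frobenius R p a} * I ^ p ≤
        Ideal.span {frobenius R p a} * I.map (frobenius R p) := by
      calc _ ≤ I.map (frobenius R p) * J ^ p * I ^ p := Ideal.mul_mono_left h1
        _ = (I * J) ^ p * I.map (frobenius R p) := by rw [mul_pow]; ring
        _ = _ := by rw [hIJ, Ideal.span_singleton_pow, frobenius_def]
    exact (Ideal.span_singleton_mul_right_mono hap).mp h2
  have hmap := hI.map (frobenius R p) hIJ hap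
  rw [le_antisymm (hle I) hge] at hmap
  exact hmap.unique (hI.pow p)

/-- On the cuspidal curve `y² = x⁵` over the field with `p` elements, `p` annihilates the Picard
group, as Frobenius factors through the affine line. -/
theorem Jac.nsmul_eq_zero_of_cusp {p : ℕ} [Fact p.Prime] (hp : 5 < p) {h : ℤ}
    (hh : (h : ZMod p) = 0) (P : Jac (ZMod p) h) : p • P = 0 := by
  have hpp : p.Prime := Fact.out
  obtain ⟨m, hm⟩ : ∃ m, p = 2 * m + 5 := by
    obtain ⟨j, rfl⟩ := hpp.odd_of_ne_two (by omega)
    exact ⟨j - 2, by omega⟩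
  have : CharP (CoordRing (ZMod p) h) p :=
    charP_of_injective_ringHom (f := (AdjoinRoot.of _).comp C)
      (ofPoly_injective.comp (C_injective (R := ZMod p))) p
  have hf : X ^ 5 + C (h : ZMod p) = X ^ 5 := by rw [hh, C_0, add_zero]
  have hy : y (ZMod p) h ^ 2 = ofPoly h X ^ 5 := by
    exact (y_sq h).trans ((congrArg (ofPoly h) hf).trans (ofPoly_pow h _ _))
  -- `β` is the normalization x = t², y = t⁵. Under it y·x^m becomes t^(2m+5) = t^p, so `γ` must
  -- send t to y·x^m.
  let β : CoordRing (ZMod p) h →+* (ZMod p)[X] :=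
    CoordRing.lift h (eval₂RingHom C (X ^ 2)) (X ^ 5) (by rw [hf]; simp; ring)
  let γ : (ZMod p)[X] →+* CoordRing (ZMod p) h :=
    eval₂RingHom ((AdjoinRoot.of _).comp C) (y (ZMod p) h * ofPoly h X ^ m)
  have hfac : γ.comp β = frobenius (CoordRing (ZMod p) h) p := by
    refine hom_ext (fun a => ?_) ?_ ?_
    · have h1 : γ (β (const h a)) = const h a := by simp [γ, β]
      have h2 : frobenius (CoordRing (ZMod p) h) p (const h a) = const h a := by
        rw [frobenius_def, ← ofPoly_pow, ← C_pow, ZMod.pow_card]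
      exact h1.trans h2.symm
    · have h1 : γ (β (ofPoly h X)) = (y (ZMod p) h * ofPoly h X ^ m) ^ 2 := by simp [γ, β]
      refine h1.trans ?_
      rw [frobenius_def, mul_pow, hy, ← pow_mul, ← pow_add, hm]
      congr 1
      ring
    · have h1 : γ (β (y (ZMod p) h)) = (y (ZMod p) h * ofPoly h X ^ m) ^ 5 := by simp [γ, β]
      refine h1.trans ?_
      have h2 : y (ZMod p) h ^ p = y (ZMod p) h ^ 5 * (y (ZMod p) h ^ 2) ^ m := by
        rw [← pow_mul, ← pow_add]
        congr 1
        omega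
      rw [frobenius_def, h2, hy, mul_pow, ← pow_mul, ← pow_mul, mul_comm m]
  have key : CommRing.Pic.mapRingHom γ (CommRing.Pic.mapRingHom β P.toMul) = P.toMul ^ p := by
    rw [CommRing.Pic.mapRingHom_mapRingHom, hfac, CommRing.Pic.mapRingHom_frobenius]
  -- The affine line over a field has trivial Picard group.
  rw [Subsingleton.elim (CommRing.Pic.mapRingHom β P.toMul) 1, map_one] at key
  exact key.symm

end Frobenius

/-! ### Homomorphisms out of ℤ[(1+√5)/2] and ℚ(√5). -/

section GoldenHom

theorem GoldenInt.hom_ext {A : Type} [CommRing A] {f g : GoldenInt →+* A}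
    (hfg : f goldenEta = g goldenEta) : f = g := by
  have key : ∀ (f : GoldenInt →+* A) (z : GoldenInt), f z = z.re + z.im * (f goldenEta + 1) := by
    intro f z
    have hz : z = (z.re : GoldenInt) + (z.im : GoldenInt) * (goldenEta + 1) := by
      rw [goldenEta, sub_add_cancel]
      ext <;> simp
    conv_lhs => rw [hz]
    rw [map_add, map_mul, map_add, map_intCast, map_intCast, map_one]
  refine RingHom.ext fun z => ?_
  rw [key f, key g, hfg]

theorem GoldenInt.exists_hom {A : Type} [CommRing A] {η : A} (hη : η ^ 2 + η = 1) :
    ∃ f : GoldenInt →+* A, f goldenEta = η := by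
  refine ⟨(QuadraticAlgebra.lift (R := ℤ) (a := 1) (b := 1) (A := A)
    ⟨1 + η, by simp only [one_smul]; linear_combination hη⟩).toRingHom, ?_⟩
  simp [goldenEta, QuadraticAlgebra.re_one, QuadraticAlgebra.im_one]

theorem QSqrtFive.exists_hom {E : Type} [Field E] [CharZero E] {η : E} (hη : η ^ 2 + η = 1) :
    ∃ f : QSqrtFive →+* E, f (goldenToField goldenEta) = η := by
  refine ⟨(QuadraticAlgebra.lift (R := ℚ) (a := 5) (b := 0) (A := E)
    ⟨1 + 2 * η, by
      rw [zero_smul, add_zero, Algebra.smul_def, mul_one, map_ofNat]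
      linear_combination 4 * hη⟩).toRingHom, ?_⟩
  have : goldenToField goldenEta = ⟨-1 / 2, 1 / 2⟩ := by
    rw [goldenToField_apply]
    ext <;> simp [goldenEta, QuadraticAlgebra.re_one, QuadraticAlgebra.im_one]
    norm_num
  rw [this]
  simp [Algebra.smul_def]
  ring

end GoldenHom

/-! ### Multiplication by √5 over rings containing ζ. -/

section FifthRoots

theorem pow_pow_five_eq_one {T : Type} [Monoid T] {z : T} (hz : z ^ 5 = 1) (i : ℕ) :
    (z ^ i) ^ 5 = 1 := by
  rw [← pow_mul, mul_comm, pow_mul, hz, one_pow]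

theorem exists_fifth_root {L : Type} [Field L] [IsAlgClosed L] {η : L} (hη : η ^ 2 + η = 1) :
    ∃ ζ : L, ζ ^ 5 = 1 ∧ ζ ^ 4 + ζ ^ 3 + ζ ^ 2 + ζ + 1 = 0 ∧ ζ + ζ ^ 4 = η := by
  obtain ⟨ζ, hζ⟩ := IsAlgClosed.exists_root (X ^ 2 - C η * X + 1 : L[X]) (by
    have : (X ^ 2 - C η * X + 1 : L[X]).degree = 2 := by compute_degree!
    rw [this]; decide)
  have e : ζ ^ 2 - η * ζ + 1 = 0 := by simpa using hζ
  have h4 : ζ ^ 4 + ζ ^ 3 + ζ ^ 2 + ζ + 1 = 0 := by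
    linear_combination (ζ ^ 2 + (1 + η) * ζ + 1) * e + ζ ^ 2 * hη
  have h5 : ζ ^ 5 = 1 := by linear_combination (ζ - 1) * h4
  refine ⟨ζ, h5, h4, ?_⟩
  have hζ0 : ζ ≠ 0 := by
    rintro rfl
    simp at h5
  refine mul_left_cancel₀ hζ0 ?_
  linear_combination h5 + e

/-- Multiplication by `√5` on the Jacobian in the presence of a fifth root of unity. -/
def Jac.sqrtFive {A : Type} [CommRing A] (h : ℤ) (ζ : A) (hζ : ζ ^ 5 = 1) :
    AddMonoid.End (Jac A h) :=
  1 + 2 * (Jac.scale h ζ hζ + Jac.scale h ζ hζ ^ 4)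

theorem Jac.sqrtFive_apply {A : Type} [CommRing A] {h : ℤ} {ζ : A} (hζ : ζ ^ 5 = 1) (P : Jac A h) :
    Jac.sqrtFive h ζ hζ P = P + 2 • (Jac.scale h ζ hζ P +
      Jac.scale h (ζ ^ 4) (pow_pow_five_eq_one hζ 4) P) := by
  rw [Jac.scale_pow]
  rfl

theorem Jac.baseChange_scale {A B : Type} [CommRing A] [CommRing B] {h : ℤ} (f : A →+* B) {c : A}
    (hc : c ^ 5 = 1) {d : B} (hd : d ^ 5 = 1) (hcd : f c = d) (P : Jac A h) :
    Jac.baseChange h f (Jac.scale h c hc P) = Jac.scale h d hd (Jac.baseChange h f P) := by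
  subst hcd
  have e : (CoordRing.map h f 1 (one_pow 5)).comp (CoordRing.map h (RingHom.id A) c hc) =
      (CoordRing.map h (RingHom.id B) (f c) hd).comp (CoordRing.map h f 1 (one_pow 5)) := by
    rw [CoordRing.map_comp_map, CoordRing.map_comp_map]
    exact CoordRing.hom_ext (by simp) (by simp) (by simp)
  exact (Jac.push_push _ _ P).trans ((congrArg (fun φ => Jac.push φ P) e).trans
    (Jac.push_push _ _ P).symm)

theorem Jac.baseChange_sqrtFive {A B : Type} [CommRing A] [CommRing B] {h : ℤ} (f : A →+* B)
    {c : A} (hc : c ^ 5 = 1) {d : B} (hd : d ^ 5 = 1) (hcd : f c = d) (P : Jac A h) :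
    Jac.baseChange h f (Jac.sqrtFive h c hc P) = Jac.sqrtFive h d hd (Jac.baseChange h f P) := by
  rw [Jac.sqrtFive_apply, Jac.sqrtFive_apply, map_add (Jac.baseChange h f), map_nsmul,
    map_add (Jac.baseChange h f),
    Jac.baseChange_scale f _ hd hcd,
    Jac.baseChange_scale f _ (d := d ^ 4) (pow_pow_five_eq_one hd 4)
      (by rw [map_pow, hcd])]

theorem Jac.baseChange_eq_sqrtFive {A T B : Type} [CommRing A] [CommRing T] [CommRing B] {h : ℤ}
    {P Q : Jac A h} (ι : A →+* T) {z : T} (hz : ∀ i, (z ^ (4 * i)) ^ 5 = 1)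
    (hPQ : Jac.baseChange h ι Q = Jac.baseChange h ι P +
      2 • (Jac.scale h (z ^ (4 * 1)) (hz 1) (Jac.baseChange h ι P) +
        Jac.scale h (z ^ (4 * 4)) (hz 4) (Jac.baseChange h ι P)))
    (τ : T →+* B) {ζ : B} (hζ : ζ ^ 5 = 1) (hτ : τ z = ζ) :
    Jac.baseChange h (τ.comp ι) Q = Jac.sqrtFive h ζ hζ (Jac.baseChange h (τ.comp ι) P) := by
  have hpow : ∀ i : ℕ, (ζ ^ i) ^ 5 = 1 := pow_pow_five_eq_one hζ
  have key := congrArg (Jac.baseChange h τ) hPQ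
  rw [map_add (Jac.baseChange h τ), map_nsmul, map_add (Jac.baseChange h τ),
    Jac.baseChange_scale τ _ (hpow (4 * 1)) (by rw [map_pow, hτ]),
    Jac.baseChange_scale τ _ (hpow (4 * 4)) (by rw [map_pow, hτ]), Jac.baseChange_baseChange,
    Jac.baseChange_baseChange] at key
  rw [key, Jac.sqrtFive_apply, add_comm (Jac.scale h ζ hζ _)]
  -- On functions ζ^i acts with exponent 4i, so the exponents are 4 and 16 ≡ 1 mod 5: the two
  -- summands trade places.
  have h16 : ζ ^ (4 * 4) = ζ := by linear_combination (ζ ^ 11 + ζ ^ 6 + ζ) * hζ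
  simp only [h16, mul_one]

/-- The defining relation lives over A[ζ]. A ring B with a suitable ζ receives a map from A[ζ], so
the relation can be read in B. -/
theorem IsSqrtFiveMul.baseChange_eq {A B : Type} [CommRing A] [CommRing B] {h : ℤ}
    {f : GoldenInt →+* A} {P Q : Jac A h} (hPQ : IsSqrtFiveMul f P Q) (g : A →+* B) {ζ : B}
    (hζ : ζ ^ 5 = 1) (hη : ζ + ζ ^ 4 = g (f goldenEta)) :
    Jac.baseChange h g Q = Jac.sqrtFive h ζ hζ (Jac.baseChange h g P) := by
  have hroot : (X ^ 2 - C (f goldenEta) * X + 1 : A[X]).eval₂ g ζ = 0 := by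
    simp only [eval₂_sub, eval₂_add, eval₂_mul, eval₂_pow, eval₂_X, eval₂_C, eval₂_one]
    rw [← hη]
    linear_combination -hζ
  have he : f goldenEta ^ 2 + f goldenEta = 1 := by
    rw [← map_pow, ← map_add, goldenEta_sq, map_one]
  have hτg : (AdjoinRoot.lift g ζ hroot).comp (AdjoinRoot.of _) = g :=
    RingHom.ext fun _ => AdjoinRoot.lift_of hroot
  have key := Jac.baseChange_eq_sqrtFive (T := ZetaExt A (f goldenEta)) (AdjoinRoot.of _)
    (z := ZetaExt.zeta (f goldenEta)) (fun i => pow_pow_five_eq_one (ZetaExt.zeta_pow_five he) _) hPQ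
    (AdjoinRoot.lift g ζ hroot) hζ (AdjoinRoot.lift_root hroot)
  rwa [hτg] at key

end FifthRoots

/-! ### Lifting ζ to Witt vectors; reduction commutes with √5. -/

section WittLift

variable {L : Type} [Field L] {p : ℕ} [Fact p.Prime] [CharP L p]

/-- The Teichmüller lift works: it is not 1, since ζ = 1 would give 5 = 0 in L. -/
theorem WittVector.exists_fifth_root (hp5 : p ≠ 5) {ζ : L} (h5 : ζ ^ 5 = 1)
    (h4 : ζ ^ 4 + ζ ^ 3 + ζ ^ 2 + ζ + 1 = 0) :
    ∃ z : WittVector p L, WittVector.constantCoeff z = ζ ∧ z ^ 5 = 1 ∧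
      z ^ 4 + z ^ 3 + z ^ 2 + z + 1 = 0 := by
  have hz0 : WittVector.constantCoeff (WittVector.teichmuller p ζ) = ζ :=
    WittVector.teichmuller_coeff_zero p ζ
  have hz5 : WittVector.teichmuller p ζ ^ 5 = 1 := by rw [← map_pow, h5, map_one]
  refine ⟨WittVector.teichmuller p ζ, hz0, hz5, ?_⟩
  have hne : WittVector.teichmuller p ζ - 1 ≠ 0 := by
    intro h0
    have h1 := congrArg WittVector.constantCoeff h0
    rw [map_sub, hz0, map_one, map_zero, sub_eq_zero] at h1
    rw [h1] at h4
    have h5' : ((5 : ℕ) : L) = 0 := by push_cast; linear_combination h4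
    rw [CharP.cast_eq_zero_iff L p] at h5'
    exact hp5 ((Nat.prime_dvd_prime_iff_eq Fact.out Nat.prime_five).mp h5')
  refine (mul_eq_zero.mp ?_).resolve_left hne
  linear_combination hz5

theorem WittVector.constantCoeff_eq_zero_iff [IsAlgClosed L] (a : WittVector p L) :
    WittVector.constantCoeff a = 0 ↔ (p : WittVector p L) ∣ a := by
  have : PerfectRing L p := PerfectField.toPerfectRing p
  rw [← Ideal.mem_span_singleton, WittVector.mem_span_p_iff_coeff_zero_eq_zero]
  rfl

theorem WittVector.exists_pow_mul_eq_algebraMap [IsAlgClosed L] (e : FractionRing (WittVector p L)) :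
    ∃ (N : ℕ) (x : WittVector p L), algebraMap (WittVector p L) (FractionRing (WittVector p L)) p ^ N
      * e = algebraMap _ _ x := by
  have : PerfectRing L p := PerfectField.toPerfectRing p
  obtain ⟨a, b, hb, rfl⟩ := IsFractionRing.div_surjective (A := WittVector p L) e
  obtain ⟨N, u, rfl⟩ := WittVector.exists_eq_pow_p_mul' b (nonZeroDivisors.ne_zero hb)
  refine ⟨N, a * ↑u⁻¹, ?_⟩
  have hu : algebraMap (WittVector p L) (FractionRing (WittVector p L)) u *
      algebraMap (WittVector p L) (FractionRing (WittVector p L)) ↑u⁻¹ = 1 := by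
    rw [← map_mul, Units.mul_inv, map_one]
  have hpN : algebraMap (WittVector p L) (FractionRing (WittVector p L)) p ≠ 0 := by
    rw [Ne, FaithfulSMul.algebraMap_eq_zero_iff]
    exact WittVector.p_nonzero p L
  rw [map_mul, map_mul, map_pow]
  have hu0 := left_ne_zero_of_mul_eq_one hu
  field_simp
  linear_combination (-algebraMap (WittVector p L) (FractionRing (WittVector p L)) a) * hu

theorem WittVector.charZero : CharZero (WittVector p L) := by
  refine charZero_of_inj_zero fun m hm => ?_
  by_contra hm0
  obtain ⟨k, m', hm', rfl⟩ := Nat.exists_eq_pow_mul_and_not_dvd hm0 p (Fact.out : p.Prime).ne_one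
  rw [Nat.cast_mul, Nat.cast_pow] at hm
  have h0 := (mul_eq_zero.mp hm).resolve_left (pow_ne_zero k (WittVector.p_nonzero p L))
  have h1 := congrArg WittVector.constantCoeff h0
  rw [map_natCast, map_zero, CharP.cast_eq_zero_iff L p] at h1
  exact hm' h1

end WittLift

/-- Reduction of points modulo a prime divisor of `λ_n` commutes with multiplication by `√5`. -/
theorem Jac.exists_sqrtFive_reduction {n : ℕ} (hn : Odd n) {L : Type} [Field L] [IsAlgClosed L]
    {p : ℕ} [Fact p.Prime] [CharP L p] (hp5 : p ≠ 5) (ρ : ZMod (lam n) →+* L) (h : ℤ) :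
    ∃ (ζ : L) (hζ : ζ ^ 5 = 1), ζ ^ 4 + ζ ^ 3 + ζ ^ 2 + ζ + 1 = 0 ∧
      ζ + ζ ^ 4 = ρ (goldenToZMod n hn goldenEta) ∧
      (∀ (P Q : Jac QSqrtFive h) (P' Q' : Jac (ZMod (lam n)) h), IsSqrtFiveMul goldenToField P Q →
        ReducesTo n hn P P' → ReducesTo n hn Q Q' →
        Jac.baseChange h ρ Q' = Jac.sqrtFive h ζ hζ (Jac.baseChange h ρ P')) ∧
      ∀ (P : Jac QSqrtFive h) (P' P'' : Jac (ZMod (lam n)) h),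
        ReducesTo n hn P P' → ReducesTo n hn P P'' →
        Jac.baseChange h ρ P' = Jac.baseChange h ρ P'' := by
  have hη : ρ (goldenToZMod n hn goldenEta) ^ 2 + ρ (goldenToZMod n hn goldenEta) = 1 := by
    rw [← map_pow, ← map_pow, ← map_add, ← map_add, goldenEta_sq, map_one, map_one]
  obtain ⟨ζ, h5, h4, hζη⟩ := exists_fifth_root hη
  refine ⟨ζ, h5, h4, hζη, ?_⟩
  -- The Witt vectors of L form a characteristic zero discrete valuation ring with residue field L
  -- and a lift of ζ. `LocalGolden n hn` maps to them and ℚ(√5) to their fraction field, compatibly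
  -- with both reductions.
  obtain ⟨z, hz, hz5, hz4⟩ := WittVector.exists_fifth_root hp5 h5 h4
  let r : WittVector p L →+* L := WittVector.constantCoeff
  let f := algebraMap (WittVector p L) (FractionRing (WittVector p L))
  have hf : Function.Injective f := IsFractionRing.injective _ _
  have hO : CharZero (WittVector p L) := WittVector.charZero
  have hE : CharZero (FractionRing (WittVector p L)) := charZero_of_injective_algebraMap hf
  have hzη : (z + z ^ 4) ^ 2 + (z + z ^ 4) = 1 := by
    linear_combination (z ^ 3 + 2) * hz5 + hz4
  obtain ⟨σ, hσ⟩ := GoldenInt.exists_hom hzη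
  have hrσ : r.comp σ = ρ.comp (goldenToZMod n hn) := GoldenInt.hom_ext (by
    rw [RingHom.comp_apply, hσ, RingHom.comp_apply, ← hζη, map_add, map_pow]
    exact congrArg (fun t => t + t ^ 4) hz)
  let S : LocalGolden n hn →+* WittVector p L :=
    IsLocalization.lift (M := goodDenominators n hn) (g := σ) (by
      rintro ⟨b, hb⟩
      apply WittVector.isUnit_of_coeff_zero_ne_zero
      have hb' : IsUnit (goldenToZMod n hn b) := hb
      have : r (σ b) ≠ 0 := by
        rw [← RingHom.comp_apply, hrσ]
        exact (hb'.map ρ).ne_zero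
      exact this)
  have hS : S.comp (algebraMap _ _) = σ := IsLocalization.lift_comp _
  have hrS : r.comp S = ρ.comp (localToZMod n hn) := by
    refine IsLocalization.ringHom_ext (goodDenominators n hn) ?_
    rw [RingHom.comp_assoc, hS, hrσ, RingHom.comp_assoc]
    congr 1
    exact (IsLocalization.lift_comp _).symm
  obtain ⟨κ, hκ⟩ := QSqrtFive.exists_hom (E := FractionRing (WittVector p L)) (η := f (z + z ^ 4)) (by
    rw [← map_pow, ← map_add, hzη, map_one])
  have hκS : κ.comp (localToField n hn) = f.comp S := by
    refine IsLocalization.ringHom_ext (goodDenominators n hn) ?_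
    rw [RingHom.comp_assoc, RingHom.comp_assoc, hS]
    have : (localToField n hn).comp (algebraMap _ _) = goldenToField := IsLocalization.lift_comp _
    rw [this]
    exact GoldenInt.hom_ext (by rw [RingHom.comp_apply, hκ, RingHom.comp_apply, hσ])
  -- This injectivity brings relations from the generic fibre down to the Witt vectors, from where
  -- they reduce to L.
  have hinj : Function.Injective (Jac.baseChange h f) :=
    Jac.baseChange_injective hf WittVector.constantCoeff_eq_zero_iff (WittVector.p_nonzero p L)
      WittVector.exists_pow_mul_eq_algebraMap
  have hK : ∀ R : Jac (LocalGolden n hn) h, Jac.baseChange h f (Jac.baseChange h S R) =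
      Jac.baseChange h κ (Jac.baseChange h (localToField n hn) R) := fun R => by
    rw [Jac.baseChange_baseChange, Jac.baseChange_baseChange, hκS]
  have hL : ∀ R : Jac (LocalGolden n hn) h, Jac.baseChange h r (Jac.baseChange h S R) =
      Jac.baseChange h ρ (Jac.baseChange h (localToZMod n hn) R) := fun R => by
    rw [Jac.baseChange_baseChange, Jac.baseChange_baseChange, hrS]
  constructor
  · rintro P Q P' Q' hPQ ⟨R, rfl, rfl⟩ ⟨T, rfl, rfl⟩
    have hfz : (f z) ^ 5 = 1 := by rw [← map_pow, hz5, map_one]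
    have key := hPQ.baseChange_eq κ hfz (by rw [hκ, map_add, map_pow])
    rw [← hK, ← hK, ← Jac.baseChange_sqrtFive f hz5 hfz rfl] at key
    rw [← hL, ← hL, hinj key, Jac.baseChange_sqrtFive r hz5 h5 hz]
  · rintro P P' P'' ⟨R, rfl, rfl⟩ ⟨T, hT, rfl⟩
    have key := congrArg (Jac.baseChange h κ) hT
    rw [← hK, ← hK] at key
    rw [← hL, ← hL, hinj key]

/-! ### Algebra of an endomorphism z with z⁵ = 1. -/

section EndAlgebra

variable {M : Type} [AddCommGroup M] {z : AddMonoid.End M}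

/-- Endomorphism rings are not commutative, so the identity is proved in ℤ[X] modulo X⁵ − 1 and
evaluated at z. -/
theorem sqrtFive_sq (hz : z ^ 5 = 1) :
    (1 + 2 * (z + z ^ 4)) ^ 2 = 5 + 4 * (1 + z + z ^ 2 + z ^ 3 + z ^ 4) := by
  have e : ((1 + 2 * (X + X ^ 4)) ^ 2 : ℤ[X]) =
      5 + 4 * (1 + X + X ^ 2 + X ^ 3 + X ^ 4) + (X ^ 5 - 1) * (8 + 4 * X ^ 3) := by ring
  have h2 : aeval z (2 : ℤ[X]) = 2 := map_ofNat (aeval z).toRingHom 2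
  have h4 : aeval z (4 : ℤ[X]) = 4 := map_ofNat (aeval z).toRingHom 4
  have h5 : aeval z (5 : ℤ[X]) = 5 := map_ofNat (aeval z).toRingHom 5
  simpa [hz, h2, h4, h5] using congrArg (aeval z) e

theorem norm_mul_sqrtFive (hz : z ^ 5 = 1) :
    (1 + z + z ^ 2 + z ^ 3 + z ^ 4) * (1 + 2 * (z + z ^ 4)) =
      5 * (1 + z + z ^ 2 + z ^ 3 + z ^ 4) := by
  have e : ((1 + X + X ^ 2 + X ^ 3 + X ^ 4) * (1 + 2 * (X + X ^ 4)) : ℤ[X]) =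
      5 * (1 + X + X ^ 2 + X ^ 3 + X ^ 4) + (X ^ 5 - 1) * (2 * X ^ 3 + 2 * X ^ 2 + 2 * X + 4) := by
    ring
  have h2 : aeval z (2 : ℤ[X]) = 2 := map_ofNat (aeval z).toRingHom 2
  have h4 : aeval z (4 : ℤ[X]) = 4 := map_ofNat (aeval z).toRingHom 4
  have h5 : aeval z (5 : ℤ[X]) = 5 := map_ofNat (aeval z).toRingHom 5
  simpa [hz, h2, h4, h5] using congrArg (aeval z) e

theorem sqrtFive_pow_apply (hz : z ^ 5 = 1) {m : M}
    (hm : (1 + z + z ^ 2 + z ^ 3 + z ^ 4 : AddMonoid.End M) m = 0) (k : ℕ) :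
    ((1 + 2 * (z + z ^ 4) : AddMonoid.End M) ^ (2 * k)) m = 5 ^ k • m := by
  induction k with
  | zero => simp
  | succ k ih =>
    have h2 : ((1 + 2 * (z + z ^ 4) : AddMonoid.End M) ^ 2) m = 5 • m := by
      rw [sqrtFive_sq hz]
      change 5 • m + 4 • ((1 + z + z ^ 2 + z ^ 3 + z ^ 4 : AddMonoid.End M) m) = 5 • m
      rw [hm, smul_zero, add_zero]
    have hs : ((1 + 2 * (z + z ^ 4) : AddMonoid.End M) ^ (2 * (k + 1))) m =
        ((1 + 2 * (z + z ^ 4) : AddMonoid.End M) ^ (2 * k))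
          (((1 + 2 * (z + z ^ 4) : AddMonoid.End M) ^ 2) m) := by
      rw [Nat.mul_succ, pow_add]
      rfl
    rw [hs, h2, map_nsmul, ih, smul_smul, pow_succ']

/-- For the norm ν = 1 + z + … + z⁴ one has νz = ν, hence ν·√5 = 5ν. So νm is killed by both 5^k and
p. This serves the cuspidal case. -/
theorem norm_eq_zero_of_coprime (hz : z ^ 5 = 1) {m : M} {p : ℕ} (hp : p.Coprime 5)
    (hpm : p • m = 0) {k : ℕ} (hk : ((1 + 2 * (z + z ^ 4) : AddMonoid.End M) ^ k) m = 0) :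
    (1 + z + z ^ 2 + z ^ 3 + z ^ 4 : AddMonoid.End M) m = 0 := by
  have key : ∀ k : ℕ, (1 + z + z ^ 2 + z ^ 3 + z ^ 4) * (1 + 2 * (z + z ^ 4)) ^ k =
      5 ^ k * (1 + z + z ^ 2 + z ^ 3 + z ^ 4) := by
    intro k
    induction k with
    | zero => simp
    | succ k ih => rw [pow_succ _ k, ← mul_assoc, ih, mul_assoc, norm_mul_sqrtFive hz, ← mul_assoc,
        ← pow_succ 5 k]
  have h1 : 5 ^ k • (1 + z + z ^ 2 + z ^ 3 + z ^ 4 : AddMonoid.End M) m = 0 := by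
    have e : (5 ^ k : AddMonoid.End M) = ((5 ^ k : ℕ) : AddMonoid.End M) := by push_cast; rfl
    have := DFunLike.congr_fun (key k) m
    rw [e] at this
    refine Eq.trans this.symm ?_
    change (1 + z + z ^ 2 + z ^ 3 + z ^ 4 : AddMonoid.End M)
      (((1 + 2 * (z + z ^ 4) : AddMonoid.End M) ^ k) m) = 0
    rw [hk, map_zero]
  have h2 : p • (1 + z + z ^ 2 + z ^ 3 + z ^ 4 : AddMonoid.End M) m = 0 := by
    rw [← map_nsmul, hpm, map_zero]
  rw [← addOrderOf_dvd_iff_nsmul_eq_zero] at h1 h2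
  rw [← AddMonoid.addOrderOf_eq_one_iff]
  exact Nat.eq_one_of_dvd_coprimes (hp.pow_right k) h2 h1

end EndAlgebra

/-! ### Prime factors of λ. -/

section NumberTheory

/-- Quadratic reciprocity for 5 ≡ 1 mod 4. -/
theorem mod_five_of_isSquare {p : ℕ} [Fact p.Prime] (hp2 : p ≠ 2) (hp5 : p ≠ 5)
    (h : IsSquare (5 : ZMod p)) : p % 5 = 1 ∨ p % 5 = 4 := by
  have key : ∀ a : ZMod 5, IsSquare a → a ≠ 0 → a.val = 1 ∨ a.val = 4 := by
    rintro _ ⟨b, rfl⟩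
    revert b
    decide
  have hfive : Fact (Nat.Prime 5) := ⟨Nat.prime_five⟩
  have h1 : IsSquare (p : ZMod 5) :=
    (ZMod.exists_sq_eq_prime_iff_of_mod_four_eq_one (p := 5) (q := p) (by norm_num) hp2).mpr
      (by exact_mod_cast h)
  have h0 : (p : ZMod 5) ≠ 0 := by
    rw [Ne, ZMod.natCast_eq_zero_iff]
    exact fun hd => hp5 ((Nat.prime_dvd_prime_iff_eq Nat.prime_five Fact.out).mp hd).symm
  simpa [ZMod.val_natCast] using key _ h1 h0

/-- A product of primes congruent to 1 is itself congruent to 1. -/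
theorem exists_prime_dvd_mod_five (m : ℕ) (hm : m % 5 = 4)
    (h : ∀ p, p.Prime → p ∣ m → p % 5 = 1 ∨ p % 5 = 4) : ∃ p, p.Prime ∧ p ∣ m ∧ p % 5 = 4 := by
  by_contra! hc
  have key : ∀ N, ∀ m ≤ N, m ≠ 0 → (∀ p, p.Prime → p ∣ m → p % 5 = 1) → m % 5 = 1 := by
    intro N
    induction N with
    | zero => intro m hm h0; omega
    | succ N ih =>
      intro m hm h0 hp
      by_cases h1 : m = 1
      · rw [h1]
      obtain ⟨q, hq, c, rfl⟩ := Nat.exists_prime_and_dvd h1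
      have hc0 : c ≠ 0 := by rintro rfl; simp at h0
      have hcN : c ≤ N := by
        have := hq.two_le
        have := Nat.pos_of_ne_zero hc0
        nlinarith
      rw [Nat.mul_mod, hp q hq (dvd_mul_right _ _),
        ih c hcN hc0 fun p hp' hd => hp p hp' (hd.mul_left q)]
  have := key m m le_rfl (by omega) fun p hp hd => (h p hp hd).resolve_right (hc p hp hd)
  omega

/-- `λ_n` has a prime factor that is `9` modulo `10`. -/
theorem exists_prime_dvd_lam {n : ℕ} (hn : Odd n) :
    ∃ p k, p.Prime ∧ p ∣ lam n ∧ p + 1 = 10 * k := by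
  have hlam := lam_add_one n
  have h5n : 5 ∣ 5 ^ n := dvd_pow_self 5 hn.pos.ne'
  have hodd : ∀ p, p ∣ lam n → p ≠ 2 := by rintro p hp rfl; omega
  obtain ⟨p, hp, hpd, hp4⟩ := exists_prime_dvd_mod_five (lam n) (by omega) (fun p hp hpd => by
    have : Fact p.Prime := ⟨hp⟩
    refine mod_five_of_isSquare (hodd p hpd) (by rintro rfl; omega) ?_
    have h0 : ((lam n + 1 : ℕ) : ZMod p) = ((4 * 5 ^ n : ℕ) : ZMod p) := by rw [hlam]
    rw [Nat.cast_add, (ZMod.natCast_eq_zero_iff _ _).mpr hpd] at h0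
    obtain ⟨m, rfl⟩ := hn
    -- Its square is 5·(4·5^n), which is 5 modulo p.
    refine ⟨2 * 5 ^ (m + 1), ?_⟩
    push_cast at h0
    linear_combination 5 * h0)
  have h2 := hp.eq_two_or_odd.resolve_left (hodd p hpd)
  exact ⟨p, (p + 1) / 10, hp, hpd, by omega⟩

/-- Write p + 1 = c·5^n with c ≤ 4. Odd c makes p even, and c = 2 gives λ = 2p + 1, which p does not
divide. -/
theorem eq_lam_of_dvd {n p : ℕ} (hp : p.Prime) (hp2 : p ≠ 2) (hpd : p ∣ lam n)
    (h : 5 ^ n ∣ p + 1) : p = lam n := by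
  have hlam := lam_add_one n
  have hle := Nat.le_of_dvd (by have := two_lt_lam n; omega) hpd
  obtain ⟨c, hc⟩ := h
  have h2 := hp.eq_two_or_odd.resolve_left hp2
  have hodd : 5 ^ n % 2 = 1 := Nat.odd_iff.mp (Odd.pow (by decide))
  have hc4 : c ≤ 4 := by
    by_contra! h5
    have : 5 ^ n * 5 ≤ 5 ^ n * c := Nat.mul_le_mul_left _ h5
    have : 0 < 5 ^ n := by positivity
    omega
  interval_cases c
  · omega
  · omega
  · have h1 : lam n = 2 * p + 1 := by omega
    rw [h1] at hpd
    have := (Nat.dvd_add_right (dvd_mul_left p 2)).mp hpd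
    exact absurd (Nat.dvd_one.mp this) hp.ne_one
  · omega
  · omega

end NumberTheory

/-! ### The kernel of reduction modulo λ and the ring S. -/

section GoldenReduction

theorem goldenToField_injective : Function.Injective goldenToField :=
  (injective_iff_map_eq_zero _).mpr fun _ hz => by_contra fun h0 => goldenToField_ne_zero h0 hz

instance : IsDomain GoldenInt := goldenToField_injective.isDomain

instance : IsNoetherianRing GoldenInt := IsNoetherianRing.of_finite ℤ GoldenInt

/-- The generator `2·5^((n-1)/2)·√5 - 1` of the kernel of reduction modulo `λ_n`. -/
def goldenLam (n : ℕ) : GoldenInt := ⟨-2 * 5 ^ ((n - 1) / 2) - 1, 4 * 5 ^ ((n - 1) / 2)⟩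

theorem goldenToZMod_apply {n : ℕ} (hn : Odd n) (z : GoldenInt) :
    goldenToZMod n hn z = z.re + z.im * (2 * 5 ^ n + 5 ^ ((n + 1) / 2)) := by
  simp [goldenToZMod]
  ring

theorem goldenToZMod_eq_zero_iff {n : ℕ} (hn : Odd n) (z : GoldenInt) :
    goldenToZMod n hn z = 0 ↔ goldenLam n ∣ z := by
  have h4 := four_mul_five_pow n
  obtain ⟨k, rfl⟩ := id hn
  have e1 : (2 * k + 1 + 1) / 2 = k + 1 := by omega
  have e2 : (2 * k + 1 - 1) / 2 = k := by omega
  constructor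
  · intro hz
    rw [goldenToZMod_apply, e1] at hz
    have hz' : ((z.re + z.im * (2 * 5 ^ (2 * k + 1) + 5 ^ (k + 1)) : ℤ) :
        ZMod (lam (2 * k + 1))) = 0 := by
      push_cast
      exact hz
    rw [ZMod.intCast_zmod_eq_zero_iff_dvd] at hz'
    obtain ⟨c, hc⟩ := hz'
    have hl : ((lam (2 * k + 1) : ℕ) : ℤ) = 4 * 5 ^ (2 * k + 1) - 1 := by
      have := lam_add_one (2 * k + 1)
      zify at this
      linarith
    rw [hl] at hc
    -- The first term uses λ = (2·5^k·√5 − 1)(2·5^k·√5 + 1); the second is the quotient of ω −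
    -- (2·5^n + 5^(k+1)) by the generator, times the ω-coordinate of z.
    refine ⟨c * ⟨1 - 2 * 5 ^ k, 4 * 5 ^ k⟩ +
      z.im * ⟨5 ^ k, -(1 + 2 * 5 ^ k)⟩, ?_⟩
    rw [goldenLam, e2]
    ext
    · simp
      linear_combination hc
    · simp
      ring
  · rintro ⟨w, rfl⟩
    rw [map_mul, goldenToZMod_apply, goldenLam, e1, e2]
    convert zero_mul _
    push_cast
    linear_combination (2 * 5 ^ k + 1) * h4

theorem goldenLam_ne_zero (n : ℕ) : goldenLam n ≠ 0 := by
  intro h0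
  have := congrArg QuadraticAlgebra.im h0
  simp [goldenLam] at this

theorem goldenToZMod_surjective {n : ℕ} (hn : Odd n) : Function.Surjective (goldenToZMod n hn) :=
  fun a => by
    obtain ⟨m, rfl⟩ := ZMod.intCast_surjective a
    exact ⟨m, map_intCast _ m⟩

theorem exists_mul_eq_goldenToField (e : QSqrtFive) :
    ∃ (d : ℤ) (a : GoldenInt), d ≠ 0 ∧ goldenToField d * e = goldenToField a := by
  refine ⟨e.re.den * e.im.den, ⟨e.re.num * e.im.den - e.im.num * e.re.den,
    2 * (e.im.num * e.re.den)⟩, by simp, ?_⟩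
  have h1 : (e.re.den : ℚ) * e.re = e.re.num := Rat.den_mul_eq_num _
  have h2 : (e.im.den : ℚ) * e.im = e.im.num := Rat.den_mul_eq_num _
  rw [map_intCast, goldenToField_apply]
  ext
  · simp
    linear_combination (e.im.den : ℚ) * h1
  · simp
    linear_combination (e.re.den : ℚ) * h2

variable {n : ℕ} (hn : Odd n)

theorem localToField_algebraMap (z : GoldenInt) :
    localToField n hn (algebraMap _ _ z) = goldenToField z := IsLocalization.lift_eq _ _

theorem localToZMod_algebraMap (z : GoldenInt) :
    localToZMod n hn (algebraMap _ _ z) = goldenToZMod n hn z := IsLocalization.lift_eq _ _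

theorem goodDenominators_le : goodDenominators n hn ≤ nonZeroDivisors GoldenInt := by
  intro b hb
  rw [mem_nonZeroDivisors_iff_ne_zero]
  rintro rfl
  have h0 : IsUnit (goldenToZMod n hn 0) := hb
  have : Fact (1 < lam n) := ⟨by have := two_lt_lam n; omega⟩
  rw [map_zero] at h0
  exact not_isUnit_zero h0

instance : IsDomain (LocalGolden n hn) :=
  IsLocalization.isDomain_localization (goodDenominators_le hn)

instance : IsNoetherianRing (LocalGolden n hn) :=
  IsLocalization.isNoetherianRing (goodDenominators n hn) _ inferInstance

theorem localToField_injective : Function.Injective (localToField n hn) := by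
  rw [injective_iff_map_eq_zero]
  intro s hs
  obtain ⟨a, b, rfl⟩ := IsLocalization.exists_mk'_eq (goodDenominators n hn) s
  have h1 := congrArg (localToField n hn) (IsLocalization.mk'_spec (LocalGolden n hn) a b)
  rw [map_mul, hs, zero_mul, localToField_algebraMap] at h1
  have ha : a = 0 := by_contra fun h0 => goldenToField_ne_zero h0 h1.symm
  rw [ha, IsLocalization.mk'_zero]

theorem localToZMod_surjective : Function.Surjective (localToZMod n hn) := fun a => by
  obtain ⟨z, rfl⟩ := goldenToZMod_surjective hn a
  exact ⟨algebraMap _ _ z, localToZMod_algebraMap hn z⟩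

theorem localToZMod_eq_zero_iff (s : LocalGolden n hn) :
    localToZMod n hn s = 0 ↔ algebraMap GoldenInt (LocalGolden n hn) (goldenLam n) ∣ s := by
  constructor
  · intro hs
    obtain ⟨a, b, rfl⟩ := IsLocalization.exists_mk'_eq (goodDenominators n hn) s
    have h1 := congrArg (localToZMod n hn) (IsLocalization.mk'_spec (LocalGolden n hn) a b)
    rw [map_mul, hs, zero_mul, localToZMod_algebraMap, eq_comm, goldenToZMod_eq_zero_iff] at h1
    obtain ⟨c, rfl⟩ := h1
    exact ⟨IsLocalization.mk' _ c b, (IsLocalization.mul_mk'_eq_mk'_of_mul _ _ _).symm⟩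
  · rintro ⟨t, rfl⟩
    rw [map_mul, localToZMod_algebraMap, (goldenToZMod_eq_zero_iff hn _).mpr dvd_rfl, zero_mul]

/-- The exact power of `goldenLam n` is split off from an integer denominator. What remains is
nonzero in the field ℤ/(λ), hence an admissible denominator. -/
theorem exists_pow_mul_eq_localToField [Fact (lam n).Prime] (e : QSqrtFive) :
    ∃ (N : ℕ) (x : LocalGolden n hn),
      localToField n hn (algebraMap GoldenInt _ (goldenLam n)) ^ N * e = localToField n hn x := by
  obtain ⟨d, a, hd, hda⟩ := exists_mul_eq_goldenToField e
  have hd0 : (d : GoldenInt) ≠ 0 := by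
    intro h0
    have := congrArg QuadraticAlgebra.re h0
    simp at this
    exact hd this
  have hnu : ¬ IsUnit (goldenLam n) := fun hu => by
    have := hu.map (goldenToZMod n hn)
    rw [(goldenToZMod_eq_zero_iff hn _).mpr dvd_rfl] at this
    exact not_isUnit_zero this
  obtain ⟨d', hd', hdd⟩ := (FiniteMultiplicity.of_not_isUnit hnu hd0).exists_eq_pow_mul_and_not_dvd
  have hb : d' ∈ goodDenominators n hn := by
    have : goldenToZMod n hn d' ≠ 0 := fun h0 => hdd ((goldenToZMod_eq_zero_iff hn _).mp h0)
    exact this.isUnit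
  generalize multiplicity (goldenLam n) (d : GoldenInt) = N at hd'
  refine ⟨N, IsLocalization.mk' _ a ⟨d', hb⟩, ?_⟩
  have h1 := congrArg (localToField n hn)
    (IsLocalization.mk'_spec (LocalGolden n hn) a ⟨d', hb⟩)
  rw [map_mul, localToField_algebraMap, localToField_algebraMap, ← hda, hd', map_mul, map_pow] at h1
  rw [localToField_algebraMap]
  have h2 : goldenToField d' ≠ 0 := goldenToField_ne_zero (by rintro rfl; simp at hdd)
  refine mul_right_cancel₀ h2 ?_
  rw [h1]
  ring

end GoldenReduction

/-! ### Assembly. -/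

section Main

theorem Jac.scale_pow_five {A : Type} [CommRing A] {h : ℤ} {c : A} (hc : c ^ 5 = 1) :
    Jac.scale h c hc ^ 5 = 1 := by
  rw [← Jac.scale_pow hc, ← Jac.scale_one]
  simp only [hc]

theorem IsMumfordRep.eq_zero {A : Type} [CommRing A] {h : ℤ} {P : Jac A h}
    (hP : IsMumfordRep P 1 0) : P = 0 := by
  have htop : mumfordIdeal h (1 : A[X]) 0 = ⊤ :=
    Ideal.eq_top_of_isUnit_mem _ (Ideal.subset_span (by simp) : CoordRing.ofPoly h 1 ∈ _)
      (by rw [CoordRing.ofPoly_one]; exact isUnit_one)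
  have hP2 : IsIdealRep P.toMul (mumfordIdeal h 1 0) := hP.2
  rw [htop] at hP2
  exact hP2.unique .one

theorem ReducesTo.nsmul {n : ℕ} {hn : Odd n} {h : ℤ} {P : Jac QSqrtFive h}
    {Q : Jac (ZMod (lam n)) h} (hPQ : ReducesTo n hn P Q) (k : ℕ) :
    ReducesTo n hn (k • P) (k • Q) := by
  obtain ⟨R, rfl, rfl⟩ := hPQ
  exact ⟨k • R, map_nsmul _ _ _, map_nsmul _ _ _⟩

/-- The classes coming from `𝔽_p` are killed by the norm of `ζ` if they are killed by a power of
`√5`. -/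
theorem Jac.norm_scale_eq_zero {L : Type} [Field L] [IsAlgClosed L] {p : ℕ} [Fact p.Prime]
    [CharP L p] (hp : 5 < p) {h : ℤ} (f : ZMod p →+* L) {ζ : L} (h5 : ζ ^ 5 = 1)
    (h4 : ζ ^ 4 + ζ ^ 3 + ζ ^ 2 + ζ + 1 = 0) (G : Jac (ZMod p) h)
    (hG : (h : ZMod p) = 0 → ∃ k, (Jac.sqrtFive h ζ h5 ^ k) (Jac.baseChange h f G) = 0) :
    (1 + Jac.scale h ζ h5 + Jac.scale h ζ h5 ^ 2 + Jac.scale h ζ h5 ^ 3 + Jac.scale h ζ h5 ^ 4 :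
      AddMonoid.End (Jac L h)) (Jac.baseChange h f G) = 0 := by
  have hcast : ∀ q : ℕ, 0 < q → q < p → (q : L) ≠ 0 := fun q hq hqp h0 =>
    Nat.not_dvd_of_pos_of_lt hq hqp ((CharP.cast_eq_zero_iff L p q).mp h0)
  -- On the cuspidal curve the argument with the divisor of y − b is not available; coprimality of p
  -- and 5 replaces it.
  by_cases hh : (h : ZMod p) = 0
  · obtain ⟨k, hk⟩ := hG hh
    refine norm_eq_zero_of_coprime (Jac.scale_pow_five h5) (p := p) ?_ ?_ hk
    · exact (Nat.coprime_primes Fact.out Nat.prime_five).mpr (by omega)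
    · rw [← map_nsmul, Jac.nsmul_eq_zero_of_cusp hp hh, map_zero]
  · refine Jac.sum_scale_eq_zero (by exact_mod_cast hcast 2 (by omega) (by omega))
      (by exact_mod_cast hcast 5 (by omega) (by omega)) ?_ f h5 h4 G
    rwa [← map_intCast f, Ne, map_eq_zero_iff f f.injective]

end Main

end

theorem theorem3p6 (n : ℕ) (hn1 : 1 < n) (hn : Odd n) (h : ℤ) (hh : ¬ (lam n : ℤ) ∣ h)
    (F : Jac QSqrtFive h) (D : ℕ → Jac QSqrtFive h)
    (hD0 : D 0 = 4 • F)
    (hD : ∀ i < 2 * n, IsSqrtFiveMul goldenToField (D i) (D (i + 1)))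
    (u v : ℕ → (ZMod (lam n))[X])
    (hred : ∀ j ≤ 2 * n, ReducesToMumford n hn (D j) (u j) (v j))
    (hne : ∀ j ≤ 2 * n - 1, (u j, v j) ≠ (1, 0))
    (hlast : (u (2 * n), v (2 * n)) = (1, 0)) :
    (lam n).Prime ∧
      (∃ Fbar : Jac (ZMod (lam n)) h, ReducesTo n hn F Fbar) ∧
      ∀ Fbar : Jac (ZMod (lam n)) h, ReducesTo n hn F Fbar →
        ¬ ∃ G : Jac (ZMod (lam n)) h, IsSqrtFiveMul (goldenToZMod n hn) G Fbar := by

  obtain ⟨p, k, hp, hpd, hk⟩ := exists_prime_dvd_lam hn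
  have hpF : Fact p.Prime := ⟨hp⟩
  have hp5 : 5 < p := by
    by_contra! hle
    omega
  let L := AlgebraicClosure (ZMod p)
  have hcast : ∀ q : ℕ, 0 < q → q < p → (q : L) ≠ 0 := fun q hq hqp h0 =>
    Nat.not_dvd_of_pos_of_lt hq hqp ((CharP.cast_eq_zero_iff L p q).mp h0)
  let f : ZMod p →+* L := algebraMap (ZMod p) L
  let c : ZMod (lam n) →+* ZMod p := ZMod.castHom hpd (ZMod p)
  obtain ⟨ζ, h5, h4, hη, hmul, huniq⟩ := Jac.exists_sqrtFive_reduction hn (by omega) (f.comp c) h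
  choose Q hDQ hQ using hred
  set s := Jac.sqrtFive h ζ h5 with hs
  have hz := Jac.scale_pow_five (h := h) h5
  have hseq : ∀ j (hj : j ≤ 2 * n), Jac.baseChange h (f.comp c) (Q j hj) =
      (s ^ j) (Jac.baseChange h (f.comp c) (Q 0 (Nat.zero_le _))) := by
    intro j
    induction j with
    | zero => intro hj; rfl
    | succ j ih =>
      intro hj
      rw [hmul _ _ _ _ (hD j (by omega)) (hDQ j (by omega)) (hDQ (j + 1) hj), ih (by omega),
        pow_succ' s j]
      rfl
  set m := Jac.baseChange h (f.comp c) (Q 0 (Nat.zero_le _)) with hm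
  have hm2n : (s ^ (2 * n)) m = 0 := by
    have := hQ (2 * n) le_rfl
    rw [Prod.mk.injEq] at hlast
    rw [hlast.1, hlast.2] at this
    rw [← hseq _ le_rfl, this.eq_zero, map_zero]
  have hmj : ∀ j ≤ 2 * n - 1, (s ^ j) m ≠ 0 := fun j hj => by
    rw [← hseq j (by omega)]
    exact (hQ j (by omega)).baseChange_ne_zero (hne j hj) _
  have hmbase : m = Jac.baseChange h f (Jac.baseChange h c (Q 0 (Nat.zero_le _))) :=
    (Jac.baseChange_baseChange c f _).symm
  have hN := Jac.norm_scale_eq_zero hp5 f h5 h4 (Jac.baseChange h c (Q 0 (Nat.zero_le _)))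
    fun _ => ⟨2 * n, by rw [← hmbase]; exact hm2n⟩
  rw [← hmbase] at hN
  have hsm : ∀ k, (s ^ (2 * k)) m = 5 ^ k • m := sqrtFive_pow_apply hz hN
  have h5n : 5 ^ n • m = 0 := by rw [← hsm, hm2n]
  -- If p ∣ h, then both p and 5^n kill m, so m = 0, against the case j = 0 of `hmj`.
  have hhp : (h : ZMod p) ≠ 0 := by
    intro h0
    refine hmj 0 (Nat.zero_le _) ?_
    have hpm : p • m = 0 := by
      rw [hmbase, ← map_nsmul, Jac.nsmul_eq_zero_of_cusp hp5 h0, map_zero]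
    have hcop : p.Coprime (5 ^ n) :=
      ((Nat.coprime_primes hp Nat.prime_five).mpr (by omega)).pow_right n
    rw [← addOrderOf_dvd_iff_nsmul_eq_zero] at hpm h5n
    rw [pow_zero]
    exact AddMonoid.addOrderOf_eq_one_iff.mp (Nat.eq_one_of_dvd_coprimes hcop hpm h5n)
  have hhL : (h : L) ≠ 0 := by rwa [← map_intCast f, Ne, map_eq_zero_iff f f.injective]
  have h2L : (2 : L) ≠ 0 := by exact_mod_cast hcast 2 (by omega) (by omega)
  have h5L : (5 : L) ≠ 0 := by exact_mod_cast hcast 5 (by omega) (by omega)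
  have hp1 : (p + 1) • m = 0 := by
    rw [hmbase]
    exact Jac.succ_nsmul_baseChange_eq_zero hk h2L h5L hhL f _
  have hord : addOrderOf m = 5 ^ n := by
    obtain ⟨r, rfl⟩ : ∃ r, n = r + 1 := ⟨n - 1, by omega⟩
    have : Fact (Nat.Prime 5) := ⟨Nat.prime_five⟩
    refine addOrderOf_eq_prime_pow ?_ h5n
    -- 5^(n−1)·m is √5^(2(n−1))·m, nonzero because 2(n − 1) ≤ 2n − 1.
    rw [← hsm]
    exact hmj _ (by omega)
  have hplam : p = lam n := by
    refine eq_lam_of_dvd hp (by omega) hpd ?_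
    rw [← hord]
    exact addOrderOf_dvd_iff_nsmul_eq_zero.mpr hp1
  have hlamF : Fact (lam n).Prime := ⟨hplam ▸ hp⟩
  have hhlam : (h : ZMod (lam n)) ≠ 0 := by
    rwa [Ne, ZMod.intCast_zmod_eq_zero_iff_dvd]
  have hcl : ∀ q : ℕ, 0 < q → q < p → (q : ZMod (lam n)) ≠ 0 := fun q hq hqp h0 => by
    rw [ZMod.natCast_eq_zero_iff, ← hplam] at h0
    exact Nat.not_dvd_of_pos_of_lt hq hqp h0
  refine ⟨hlamF.out, ?_, ?_⟩
  · have hπ : algebraMap GoldenInt (LocalGolden n hn) (goldenLam n) ≠ 0 := by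
      rw [Ne, FaithfulSMul.algebraMap_eq_zero_iff]
      exact goldenLam_ne_zero n
    -- Good reduction: λ is now prime and does not divide 10h.
    obtain ⟨R, hR⟩ := Jac.baseChange_surjective (h := h)
      (by exact_mod_cast hcl 2 (by omega) (by omega))
      (by exact_mod_cast hcl 5 (by omega) (by omega)) hhlam (localToField_injective hn)
      (localToZMod_surjective hn) (localToZMod_eq_zero_iff hn) hπ
      ((map_ne_zero_iff _ (localToField_injective hn)).mpr hπ).isUnit
      (exists_pow_mul_eq_localToField hn) F
    exact ⟨_, R, hR, rfl⟩
  · rintro Fbar hF ⟨G, hG⟩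
    have hN' := Jac.norm_scale_eq_zero hp5 f h5 h4 (Jac.baseChange h c G) (absurd · hhp)
    rw [Jac.baseChange_baseChange] at hN'
    set g := Jac.baseChange h (f.comp c) G with hg
    have hmg : m = 4 • s g := by
      have hF4 := hF.nsmul 4
      rw [← hD0] at hF4
      -- Both `Q 0` and 4·F̄ are reductions of D_0, so they agree over L.
      have h1 := huniq (D 0) _ _ (hDQ 0 (Nat.zero_le _)) hF4
      rw [hm, h1, map_nsmul, hG.baseChange_eq (f.comp c) h5 hη]
    -- √5^(2n−1)·m = 4·√5^(2n)·g = 4·5^n·g = (λ + 1)·g, and λ + 1 = p + 1 kills g.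
    refine hmj (2 * n - 1) le_rfl ?_
    have h3 : (s ^ (2 * n - 1)) (s g) = (s ^ (2 * n)) g := by
      obtain ⟨r, rfl⟩ : ∃ r, n = r + 1 := ⟨n - 1, by omega⟩
      have e : 2 * (r + 1) = (2 * (r + 1) - 1) + 1 := by omega
      conv_rhs => rw [e, pow_succ s]
      rfl
    have h6 : (s ^ (2 * n)) g = 5 ^ n • g := sqrtFive_pow_apply hz hN' n
    rw [hmg, map_nsmul, h3, h6, smul_smul, ← lam_add_one, ← hplam, hg,
      ← Jac.baseChange_baseChange]
    exact Jac.succ_nsmul_baseChange_eq_zero hk h2L h5L hhL f _
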